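/- Let $P\subset\mathbb E^d$ be a $d$-dimensional parallelohedron, i.e. a full-dimensional convex polytope, and let $\mathcal T_P\ni P$ be a face-to-face tiling of $\mathbb E^d$ by translates of $P$ (any two cells have disjoint interiors and meet in the empty set or in a common face). Let $s$ be a canonical scaling of $\mathcal T_P$: a positive function on the $(d-1)$-faces such that for every $(d-2)$-face $G$ and each direction of going round $G$, $\sum_{F\supset G}s(F)\,\mathbf n_F=0$, where $F$ runs over all $(d-1)$-faces of $\mathcal T_P$ containing $G$ and $\mathbf n_F$ is the unit normal to $F$ chosen in agreement with the direction of going round. Assume that $s$ is translation invariant, i.e. preserved by all translations that preserve $\mathcal T_P$. Let $\mathcal G_P\subset\mathbb E^{d+1}=\mathbb E^d\times\mathbb R$ be the union of all lifts $L[P_0,\dots,P_k]$ along chains of cells with $P_0=P$ and $P_{i-1},P_i$ adjacent by a $(d-1)$-face, where $L[P_0]=P\times\{0\}$ with normal $(0,-1)$, and $L[P_0,\dots,P_i]$ is the lift of $P_i$ that meets $L[P_0,\dots,P_{i-1}]$ in a lift of $P_{i-1}\cap P_i$ and whose normal is obtained by adding $s(P_{i-1}\cap P_i)\,\mathbf n_{i-1,i}$,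 with $\mathbf n_{i-1,i}$ the unit normal to $P_{i-1}\cap P_i$ directed from $P_{i-1}$ to $P_i$. Then $P$ has a centre of symmetry $c$. There is exactly one symmetric nondegenerate $d\times d$ matrix $Q$ with $Q\,\mathbf p=s\bigl(P\cap(P+\mathbf p)\bigr)\,\mathbf n$ for every vector $\mathbf p$ such that $P+\mathbf p$ is a cell adjacent to $P$ by a $(d-1)$-face, $\mathbf n$ being the unit normal to that face directed from $P$ to $P+\mathbf p$; this $Q$ is positive definite. There are linear isomorphisms $\mathcal A_d$ of $\mathbb E^d$ that take the form $Q(x)=\tfrac12x^TQx$ to the standard form, $\tfrac12x^TQx=\sum_i(\mathcal A_dx)_i^2$. For each such $\mathcal A_d$, take the origin of $\mathbb E^d$ at $c$; that is, let $\mathcal T_{\mathcal A_dP}$ be the image of $\mathcal T_P$ under $x\mapsto\mathcal A_d(x-c)$ and let $\mathcal G_{\mathcal A_dP}$ be the image of $\mathcal G_P$ under $(x,h)\mapsto(\mathcal A_d(x-c),h)$. Then: (a) The centres of the cells of $\mathcal T_{\mathcal A_dP}$ form a $d$-dimensional lattice $\Lambda$ (the integer span of a basis of $\mathbb E^d$),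 every cell has a centre, and the cell with centre $\mathbf p$ is the Dirichlet (Voronoi) cell $\{x:\|x-\mathbf p\|\le\|x-\mathbf q\|\ \ \forall\,\mathbf q\in\Lambda\}$. Thus $\mathcal T_{\mathcal A_dP}$ is a tiling by Voronoi parallelohedra. (b) $\mathcal G_{\mathcal A_dP}$ is a generatrix of $\mathcal T_{\mathcal A_dP}$: it is the graph of a continuous function $\mathbb E^d\to\mathbb R$ that is affine on every cell and is not given by a single affine function on the union of any two distinct cells. (c) $\mathcal G_{\mathcal A_dP}$ is circumscribed about the standard paraboloid $y^{d+1}=\sum_{i=1}^d(y^i)^2$: it lies nowhere above the paraboloid, meets it exactly over the centres of the cells, and its part over each cell lies in the tangent hyperplane to the paraboloid at the point above the centre of that cell. -/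

import Mathlib

open scoped Pointwise RealInnerProductSpace

/-- Euclidean `d`-space. The space `𝔼^{d+1} = 𝔼^d × ℝ` is written `Euc d × ℝ`; only its points and
graphs over `Euc d` are used, never the norm of the product. -/
abbrev Euc (d : ℕ) : Type := EuclideanSpace ℝ (Fin d)

/-- A `d`-dimensional convex polytope in `𝔼^d`. -/
def IsPolytope {d : ℕ} (P : Set (Euc d)) : Prop :=
  (∃ S : Set (Euc d), S.Finite ∧ P = convexHull ℝ S) ∧ (interior P).Nonempty

/-- `F` is a (nonempty) face of codimension `k` of the polytope `C ⊆ 𝔼^d`. -/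
def IsFaceOfCodim {d : ℕ} (k : ℕ) (C F : Set (Euc d)) : Prop :=
  IsExposed ℝ C F ∧ F.Nonempty ∧ Module.finrank ℝ (vectorSpan ℝ F) + k = d

/-- `T` is a normal (face-to-face) tiling of `𝔼^d` by parallel copies of the polytope `P`, one of
the cells being `P` itself; so `P` is a parallelohedron and `T` is its tiling.  The empty set is
exposed in Mathlib's sense, so `face_to_face` says: empty or a common face. -/
structure IsParallelohedralTiling {d : ℕ} (P : Set (Euc d)) (T : Set (Set (Euc d))) : Prop where
  polytope : IsPolytope P
  self_mem : P ∈ T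
  translate : ∀ C ∈ T, ∃ t : Euc d, C = t +ᵥ P
  cover : ∀ x : Euc d, ∃ C ∈ T, x ∈ C
  disjoint : ∀ C ∈ T, ∀ C' ∈ T, C ≠ C' → Disjoint (interior C) (interior C')
  face_to_face : ∀ C ∈ T, ∀ C' ∈ T, IsExposed ℝ C (C ∩ C') ∧ IsExposed ℝ C' (C ∩ C')

/-- The faces of codimension `k` of the cells of `T`. -/
def tilingFaces {d : ℕ} (k : ℕ) (T : Set (Set (Euc d))) : Set (Set (Euc d)) :=
  {F | ∃ C ∈ T, IsFaceOfCodim k C F}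

/-- Two cells are adjacent if they meet in a common facet. -/
def AdjacentCells {d : ℕ} (C C' : Set (Euc d)) : Prop :=
  IsFaceOfCodim 1 C (C ∩ C') ∧ IsFaceOfCodim 1 C' (C ∩ C')

/-- `n` is the unit normal to the common facet `C ∩ C'` directed from `C` to `C'`. -/
def IsNormalFromTo {d : ℕ} (C C' : Set (Euc d)) (n : Euc d) : Prop :=
  ‖n‖ = 1 ∧ n ∈ (vectorSpan ℝ (C ∩ C'))ᗮ ∧ ∀ x ∈ C, ∀ y ∈ C', ⟪n, x⟫ ≤ ⟪n, y⟫

/-! ### Canonical scalings -/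

/-- `J` acts on the (two-dimensional) subspace `W` as a rotation by a right angle.  The two
possible rotations are the two directions of going round. -/
structure IsQuarterTurn {d : ℕ} (W : Submodule ℝ (Euc d)) (J : Euc d →ₗ[ℝ] Euc d) : Prop where
  map_mem : ∀ x ∈ W, J x ∈ W
  norm_map : ∀ x ∈ W, ‖J x‖ = ‖x‖
  inner_map : ∀ x ∈ W, ⟪J x, x⟫ = 0

/-- `e` is the unit vector orthogonal to the ridge `G` that points from `G` into the facet `F`:
the projection of `F` along `G` to the plane orthogonal to `G` lies on the ray spanned by `e`. -/
def IsInwardDirection {d : ℕ} (G F : Set (Euc d)) (e : Euc d) : Prop :=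
  ‖e‖ = 1 ∧ e ∈ (vectorSpan ℝ G)ᗮ ∧ e ∈ vectorSpan ℝ F ∧ ∀ g ∈ G, ∀ x ∈ F, 0 ≤ ⟪e, x - g⟫

/-- `Δ` is the torsion of the scaling `s` round the `(d-2)`-face `G` of `T`: the sum of
`s F • n F` over all facets `F ⊇ G` of `T`, where `n F = J e` is the unit normal to `F` pointing in
the direction of going round `G` given by the quarter turn `J` of the plane orthogonal to `G`. -/
def HasTorsion {d : ℕ} (T : Set (Set (Euc d))) (s : Set (Euc d) → ℝ) (G : Set (Euc d))
    (J : Euc d →ₗ[ℝ] Euc d) (Δ : Euc d) : Prop :=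
  ∃ (S : Finset (Set (Euc d))) (n : Set (Euc d) → Euc d),
    (∀ F, F ∈ S ↔ F ∈ tilingFaces 1 T ∧ G ⊆ F) ∧
    (∀ F ∈ S, ∃ e, IsInwardDirection G F e ∧ n F = J e) ∧
    Δ = ∑ F ∈ S, s F • n F

/-- `s` is a canonical scaling of the facets of `T`: it is positive and has zero torsion round
every `(d-2)`-face.  (Values of `s` on sets which are not facets play no role.) -/
def IsCanonicalScaling {d : ℕ} (T : Set (Set (Euc d))) (s : Set (Euc d) → ℝ) : Prop :=
  (∀ F ∈ tilingFaces 1 T, 0 < s F) ∧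
  ∀ G ∈ tilingFaces 2 T, ∀ J : Euc d →ₗ[ℝ] Euc d, IsQuarterTurn (vectorSpan ℝ G)ᗮ J →
    HasTorsion T s G J 0

/-- `s` is preserved by all translations that preserve the tiling `T`. -/
def IsTranslationInvariant {d : ℕ} (T : Set (Set (Euc d))) (s : Set (Euc d) → ℝ) : Prop :=
  ∀ v : Euc d, (∀ C, v +ᵥ C ∈ T ↔ C ∈ T) → ∀ F ∈ tilingFaces 1 T, s (v +ᵥ F) = s F

/-! ### The generatrix -/

/-- The lift of a cell `C` to the hyperplane `h = ⟪g, x⟫ + a` of `𝔼^{d+1}`, whose normal with last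
coordinate `-1` is `(g, -1)`. -/
def liftedCell {d : ℕ} (C : Set (Euc d)) (g : Euc d) (a : ℝ) : Set (Euc d × ℝ) :=
  {z | z.1 ∈ C ∧ z.2 = ⟪g, z.1⟫ + a}

/-- `IsChainLift T s P₀ C g a`: the lift of `C` with normal `(g, -1)` and height `a` is
`L[P₀, …, C]` for some chain of successively adjacent cells.  `P₀` is lifted by the identity, with
normal `(0, -1)`; each next cell `C'` is lifted up to the lift of the preceding cell `C` (the two
lifts meet exactly in a lift of `C ∩ C'`) with normal increment `s (C ∩ C') • n`, where `n` is the
unit normal from `C` to `C'`. -/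
inductive IsChainLift {d : ℕ} (T : Set (Set (Euc d))) (s : Set (Euc d) → ℝ) (P₀ : Set (Euc d)) :
    Set (Euc d) → Euc d → ℝ → Prop
  | start : IsChainLift T s P₀ P₀ 0 0
  | step (C C' : Set (Euc d)) (g n : Euc d) (a a' : ℝ) :
      IsChainLift T s P₀ C g a → C' ∈ T → AdjacentCells C C' → IsNormalFromTo C C' n →
      Prod.fst '' (liftedCell C g a ∩ liftedCell C' (g + s (C ∩ C') • n) a') = C ∩ C' →
      IsChainLift T s P₀ C' (g + s (C ∩ C') • n) a'

/-- The polyhedral surface `𝒢(T, s)`: the union of all chain lifts. -/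
def generatrixSurface {d : ℕ} (T : Set (Set (Euc d))) (s : Set (Euc d) → ℝ) (P₀ : Set (Euc d)) :
    Set (Euc d × ℝ) :=
  {z | ∃ C g a, IsChainLift T s P₀ C g a ∧ z ∈ liftedCell C g a}

/-- `S ⊆ 𝔼^{d+1}` is a generatrix of the tiling `T`: it projects bijectively to `𝔼^d`, and its
facets project to the cells of `T`. -/
def IsGeneratrix {d : ℕ} (T : Set (Set (Euc d))) (S : Set (Euc d × ℝ)) : Prop :=
  ∃ f : Euc d → ℝ, Continuous f ∧ S = {z | z.2 = f z.1} ∧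
    (∀ C ∈ T, ∃ l : Euc d →ᵃ[ℝ] ℝ, Set.EqOn f l C) ∧
    ∀ C ∈ T, ∀ C' ∈ T, C ≠ C' → ¬ ∃ l : Euc d →ᵃ[ℝ] ℝ, Set.EqOn f l (C ∪ C')

/-! ### Centres, the quadratic form, Voronoi tilings -/

/-- `p` is a centre of symmetry of `C`. -/
def IsCentre {d : ℕ} (p : Euc d) (C : Set (Euc d)) : Prop :=
  ∀ x ∈ C, (2 : ℝ) • p - x ∈ C

/-- The linear operator of a matrix, and the quadratic form `Q(x) = ½ xᵀ Q x`. -/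
noncomputable def matAct {d : ℕ} (Q : Matrix (Fin d) (Fin d) ℝ) (x : Euc d) : Euc d :=
  WithLp.toLp 2 (Q.mulVec x.ofLp)

noncomputable def halfForm {d : ℕ} (Q : Matrix (Fin d) (Fin d) ℝ) (x : Euc d) : ℝ :=
  (1 / 2) * ⟪x, matAct Q x⟫

/-- `Q` is a symmetric nondegenerate matrix which takes every facet vector `p` of `P`
(the vector with `p + P` adjacent to `P`) to `m = s (P ∩ (p + P)) n`, where `n` is the unit normal
directed from `P` to `p + P`. -/
def IsFormMatrix {d : ℕ} (P : Set (Euc d)) (T : Set (Set (Euc d))) (s : Set (Euc d) → ℝ)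
    (Q : Matrix (Fin d) (Fin d) ℝ) : Prop :=
  Q.IsSymm ∧ IsUnit Q.det ∧
  ∀ p n : Euc d, p +ᵥ P ∈ T → AdjacentCells P (p +ᵥ P) → IsNormalFromTo P (p +ᵥ P) n →
    matAct Q p = s (P ∩ (p +ᵥ P)) • n

/-- The Dirichlet (Voronoi) cell of `p` with respect to `L`. -/
def dirichletCell {d : ℕ} (L : Set (Euc d)) (p : Euc d) : Set (Euc d) :=
  {x | ∀ q ∈ L, ‖x - p‖ ≤ ‖x - q‖}

/-- The set of the centres of the cells of `T`. -/
def cellCentres {d : ℕ} (T : Set (Set (Euc d))) : Set (Euc d) :=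
  {p | ∃ C ∈ T, IsCentre p C}

/-- The centres of the cells form a `d`-dimensional lattice, and each cell has a centre and is the
Dirichlet cell of its centre. -/
def IsVoronoiTiling {d : ℕ} (T : Set (Set (Euc d))) : Prop :=
  (∃ b : Module.Basis (Fin d) ℝ (Euc d),
    cellCentres T = (Submodule.span ℤ (Set.range b) : Set (Euc d))) ∧
  ∀ C ∈ T, (∃ p, IsCentre p C) ∧ ∀ p, IsCentre p C → C = dirichletCell (cellCentres T) p

/-- The surface `S` over the tiling `T` is circumscribed about the standard paraboloid
`y^{d+1} = ∑ (y^i)²`: it lies below the paraboloid, meets it exactly over the centres of the cells,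
and the facet over each cell lies in the tangent hyperplane to the paraboloid at the point above
the centre of the cell. -/
def CircumscribesStdParaboloid {d : ℕ} (T : Set (Set (Euc d))) (S : Set (Euc d × ℝ)) : Prop :=
  (∀ z ∈ S, z.2 ≤ ∑ i, (z.1 i) ^ 2) ∧
  (∀ z ∈ S, z.2 = ∑ i, (z.1 i) ^ 2 ↔ z.1 ∈ cellCentres T) ∧
  ∀ C ∈ T, ∀ p, IsCentre p C → ∀ y ∈ C, (y, ∑ i, (p i) ^ 2 + ∑ i, 2 * p i * (y i - p i)) ∈ S

/-- The images of a tiling and of a surface in `𝔼^{d+1}` under `x ↦ A (x - c)`, respectively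
`(x, h) ↦ (A (x - c), h)`: the maps `A_d` and `A_{d+1}` in coordinates with the origin at `c`. -/
def imageTiling {d : ℕ} (A : Euc d ≃ₗ[ℝ] Euc d) (c : Euc d) (T : Set (Set (Euc d))) :
    Set (Set (Euc d)) :=
  (fun C => (fun x => A (x - c)) '' C) '' T

def imageSurface {d : ℕ} (A : Euc d ≃ₗ[ℝ] Euc d) (c : Euc d) (S : Set (Euc d × ℝ)) :
    Set (Euc d × ℝ) :=
  (fun z => (A (z.1 - c), z.2)) '' S

/-! The facet data $s(F)\mathbf n_F$ prescribe how the gradient of a piecewise affine function jumps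
from cell to cell. The core of the proof is that these jumps integrate to a global assignment `u` of
affine functions to cells. Translation invariance then makes `u` quadratic in the lattice vector of
the cell, and positivity of `s` makes it a convex upper envelope. An affine change of coordinates
turns this envelope into the family of tangent hyperplanes of a paraboloid, that is, into a Voronoi
diagram.

Integration. Local solutions exist at every point off the faces of codimension at least 3: off the
ridges at most two cells meet, and around a ridge the jumps are summed while turning about it, which
closes up because the torsion vanishes (`leftGrad_eq_rightGrad`). Solutions at a point are unique up
to a constant, so along an affinely parametrized plane missing codimension 3 they differ by a
locally constant cocycle. The parameter plane is simply connected, so the cocycle is a coboundary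
(`exists_primitive_of_cocycle`) and the local solutions patch. `exists_global_solution` transports
the value from `P` to each cell inside generic planes through a fixed base point and compares the
results across a facet.

Quadratic dependence. The translation vectors of the cells are the group generated by the facet
vectors, and they form a lattice. By invariance the gradient of `u (v +ᵥ P)` is additive in `v`,
hence equal to `L v` with `L` linear. Computing the constant terms along the two orders of two facet
vectors shows that `L` is symmetric. Correcting the constant terms by $\tfrac12\langle Lv,v\rangle$
leaves a linear functional, represented through `L` by a point `c` (`exists_quadratic`).

Convexity. Leaving a cell through a facet towards `x` strictly increases the affine value at `x`, so
the function of a cell containing `x` is maximal at `x` (`mem_iff_affineValue_le`). For `P` this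
reads $\langle Lw,x-c\rangle\le\tfrac12\langle Lw,w\rangle$ for all lattice vectors `w`. The
condition is symmetric about `c`, and at $x=c$ it gives positivity of `L` on the lattice, hence
everywhere by approximation. If $\|Ax\|^2=\tfrac12\langle Lx,x\rangle$, then in coordinates centred
at `c` the affine function of the cell `v +ᵥ P` is $\|y\|^2-\|y-Av\|^2$ (`norm_sq_sub`). Maximal
value means nearest lattice point, and the gap below the paraboloid is the squared distance to the
centre; both the Voronoi and the tangency statements follow. -/

section
open Topology Filter Set

/-! ### Monodromy: primitives of locally constant cocycles -/

/-- The total space of the covering attached to a locally constant cocycle. -/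
structure CocycleCover {X A : Type} (c : X → X → A) where
  pt : X
  val : A

section Monodromy
variable {X A : Type} [TopologicalSpace X] [AddCommGroup A]

/-- This is the topology of germs: near a point `(p, a)` the space looks like the graph `q ↦ a + c p
q` of the local primitive through it, and `A` counts as discrete. -/
instance (c : X → X → A) : TopologicalSpace (CocycleCover c) where
  IsOpen U := ∀ e ∈ U, ∀ᶠ q in 𝓝 e.pt, (⟨q, e.val + c e.pt q⟩ : CocycleCover c) ∈ U
  isOpen_univ := by simp
  isOpen_inter U V hU hV e he := (hU e he.1).and (hV e he.2)
  isOpen_sUnion S hS e := by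
    rintro ⟨U, hU, he⟩
    filter_upwards [hS U hU e he] with q hq using ⟨U, hU, hq⟩

theorem CocycleCover.isOpen_iff (c : X → X → A) (U : Set (CocycleCover c)) :
    IsOpen U ↔ ∀ e ∈ U, ∀ᶠ q in 𝓝 e.pt, (⟨q, e.val + c e.pt q⟩ : CocycleCover c) ∈ U := Iff.rfl

theorem CocycleCover.continuous_pt (c : X → X → A) :
    Continuous (CocycleCover.pt : CocycleCover c → X) := by
  refine ⟨fun U hU e he => ?_⟩
  filter_upwards [hU.mem_nhds he] with q hq using hq

/-- The cocycle identity makes `val - c p pt` constant along every local primitive over `N`, so its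
level sets are open sheets. -/
theorem CocycleCover.isOpen_sheet {c : X → X → A} {p : X} {N : Set X} (hN : IsOpen N)
    (hc : ∀ q ∈ N, ∀ᶠ r in 𝓝 q, c p r = c p q + c q r) (a : A) :
    IsOpen {e : CocycleCover c | e.pt ∈ N ∧ e.val - c p e.pt = a} := by
  rintro e ⟨he, hea⟩
  filter_upwards [hN.mem_nhds he, hc _ he] with q hq hq'
  refine ⟨hq, ?_⟩
  rw [← hea]
  simp only [hq']
  abel

/-- Over a neighbourhood of `p` where the cocycle identity holds, subtracting `c p x` from the value
trivializes the projection, with discrete fibre `A`. -/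
theorem CocycleCover.isCoveringMap {c : X → X → A}
    (hc : ∀ p, ∀ᶠ q in 𝓝 p, ∀ᶠ r in 𝓝 q, c p r = c p q + c q r) :
    IsCoveringMap (CocycleCover.pt : CocycleCover c → X) := by
  intro p
  let _ : TopologicalSpace A := ⊥
  have : DiscreteTopology A := ⟨rfl⟩
  obtain ⟨N, hNc, hN, hpN⟩ := eventually_nhds_iff.1 (hc p)
  refine IsEvenlyCovered.to_isEvenlyCovered_preimage (I := A) ⟨inferInstance, N, hpN, hN,
    hN.preimage (continuous_pt c), ?_⟩
  refine ⟨⟨⟨fun e => (⟨e.1.pt, e.2⟩, e.1.val - c p e.1.pt),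
    fun z => ⟨⟨z.1, z.2 + c p z.1⟩, z.1.2⟩, ?_, ?_⟩, ?_, ?_⟩, ?_⟩
  · rintro ⟨⟨x, a⟩, hx⟩
    simp
  · rintro ⟨⟨x, hx⟩, a⟩
    simp
  · refine Continuous.prodMk ?_ ?_
    · exact Continuous.subtype_mk ((continuous_pt c).comp continuous_subtype_val) _
    · rw [continuous_discrete_rng]
      intro a
      refine ⟨_, isOpen_sheet hN hNc a, ?_⟩
      ext e
      simp only [mem_preimage, mem_ofPred_eq, mem_singleton_iff, and_iff_right_iff_imp]
      exact fun _ => e.2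
  · refine Continuous.subtype_mk ⟨fun U hU => ?_⟩ _
    rw [isOpen_iff_mem_nhds]
    rintro ⟨⟨q, hq⟩, a⟩ hz
    have h1 := (isOpen_iff c U).1 hU _ hz
    rw [nhds_prod_eq]
    have h2 : ∀ᶠ r : N in 𝓝 ⟨q, hq⟩, c p r = c p q + c q r ∧
        (⟨r, a + c p q + c q r⟩ : CocycleCover c) ∈ U :=
      continuous_subtype_val.continuousAt.eventually
        (p := fun r => c p r = c p q + c q r ∧ (⟨r, a + c p q + c q r⟩ : CocycleCover c) ∈ U)
        ((hNc q hq).and h1)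
    rw [mem_prod_iff]
    refine ⟨_, h2, {a}, (isOpen_discrete _).mem_nhds rfl, ?_⟩
    rintro ⟨r, b⟩ ⟨⟨h3, h4⟩, hb⟩
    rw [mem_singleton_iff] at hb
    dsimp only at hb h3 h4 ⊢
    subst hb
    rw [mem_preimage, h3, ← add_assoc]
    exact h4
  · intro x; rfl

/-- A locally constant additive cocycle on a simply connected space is a coboundary. -/
theorem exists_primitive_of_cocycle [SimplyConnectedSpace X] [LocallyPathConnectedSpace X]
    (c : X → X → A) (hc : ∀ p, ∀ᶠ q in 𝓝 p, ∀ᶠ r in 𝓝 q, c p r = c p q + c q r) :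
    ∃ h : X → A, ∀ p, ∀ᶠ q in 𝓝 p, h q = h p + c p q := by
  obtain ⟨a₀⟩ : Nonempty X := inferInstance
  -- Lifting the identity map of the simply connected base gives a global section; its value
  -- component is the primitive.
  obtain ⟨F, ⟨-, hF⟩, -⟩ := (CocycleCover.isCoveringMap hc).existsUnique_continuousMap_lifts
    (ContinuousMap.id X) a₀ ⟨a₀, 0⟩ rfl
  have hF' : ∀ x, (F x).pt = x := fun x => congrFun hF x
  refine ⟨fun x => (F x).val, fun p => ?_⟩
  -- The cocycle identity with all three points equal to `p`.
  have hpp : c p p = 0 := by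
    have := (hc p).self_of_nhds.self_of_nhds
    simpa using this
  obtain ⟨N, hNc, hN, hpN⟩ := eventually_nhds_iff.1 (hc p)
  have h1 := (CocycleCover.isOpen_sheet hN hNc (F p).val).preimage F.continuous
  have h2 : p ∈ F ⁻¹' {e : CocycleCover c | e.pt ∈ N ∧ e.val - c p e.pt = (F p).val} := by
    simp [hF', hpN, hpp]
  filter_upwards [h1.mem_nhds h2] with q hq
  have := hq.2
  rw [hF'] at this
  rw [← this]; abel

end Monodromy


/-! ### Points in general position -/

theorem affineSpan_ne_top_of_finrank_lt {d : ℕ} {S : Set (Euc d)}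
    (h : Module.finrank ℝ (vectorSpan ℝ S) < d) : affineSpan ℝ S ≠ ⊤ := by
  intro htop
  have h1 : (affineSpan ℝ S).direction = ⊤ := by rw [htop, AffineSubspace.direction_top]
  rw [direction_affineSpan] at h1
  rw [h1, finrank_top, finrank_euclideanSpace_fin] at h
  exact lt_irrefl _ h

/-- Proper affine subspaces are Lebesgue-null, so countably many cannot cover a nonempty open set.
This gives general position with respect to all faces of the tiling at once. -/
theorem exists_mem_open_forall_notMem {d : ℕ} {ι : Type*} [Countable ι] {V : Set (Euc d)}
    (hV : IsOpen V) (hne : V.Nonempty) (S : ι → Set (Euc d))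
    (hS : ∀ i, Module.finrank ℝ (vectorSpan ℝ (S i)) < d) :
    ∃ x ∈ V, ∀ i, x ∉ affineSpan ℝ (S i) := by
  by_contra! hcon
  have h1 : V ⊆ ⋃ i, (affineSpan ℝ (S i) : Set (Euc d)) := fun x hx =>
    mem_iUnion.2 (hcon x hx)
  have h2 : MeasureTheory.volume (⋃ i, (affineSpan ℝ (S i) : Set (Euc d))) = 0 :=
    MeasureTheory.measure_iUnion_null_iff.2 fun i =>
      MeasureTheory.Measure.addHaar_affineSubspace _ _ (affineSpan_ne_top_of_finrank_lt (hS i))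
  exact (hV.measure_pos MeasureTheory.volume hne).ne' (MeasureTheory.measure_mono_null h1 h2)

/-- A convex set is not covered by finitely many affine subspaces none of which contains it. -/
theorem Convex.exists_forall_notMem_affineSubspace {d : ℕ} {K : Set (Euc d)} (hK : Convex ℝ K)
    (hne : K.Nonempty) {ι : Type*} (s : Finset ι) (E : ι → AffineSubspace ℝ (Euc d))
    (hE : ∀ i ∈ s, ¬ K ⊆ E i) : ∃ x ∈ K, ∀ i ∈ s, x ∉ E i := by
  classical
  induction s using Finset.induction_on with
  | empty => exact ⟨hne.some, hne.some_mem, by simp⟩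
  | insert j s hj ih =>
    obtain ⟨p, hpK, hp⟩ := ih fun i hi => hE i (Finset.mem_insert_of_mem hi)
    obtain ⟨q, hqK, hq⟩ := not_subset.1 (hE j (Finset.mem_insert_self _ _))
    -- A subspace meeting the line through `p` and `q` in two points contains both `p` and `q`. By
    -- the choice of these points none does, so only finitely many parameters in $[0,1]$ are
    -- forbidden.
    have hsub : ∀ i ∈ insert j s, {t : ℝ | AffineMap.lineMap p q t ∈ E i}.Subsingleton := by
      intro i hi t ht t' ht'
      by_contra hne'
      have key : ∀ r : ℝ, AffineMap.lineMap p q r ∈ E i := by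
        intro r
        have h1 := AffineMap.lineMap_mem ((r - t) / (t' - t)) ht ht'
        rwa [← AffineMap.apply_lineMap, AffineMap.lineMap_apply (k := ℝ) t, smul_eq_mul,
          vsub_eq_sub, vadd_eq_add, div_mul_cancel₀ _ (sub_ne_zero.2 (Ne.symm hne')),
          sub_add_cancel] at h1
      rcases Finset.mem_insert.1 hi with rfl | hi'
      · exact hq (by simpa using key 1)
      · exact hp i hi' (by simpa using key 0)
    have hfin : (⋃ i ∈ insert j s, {t : ℝ | AffineMap.lineMap p q t ∈ E i}).Finite :=
      Set.Finite.biUnion (Finset.finite_toSet _) fun i hi => (hsub i hi).finite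
    obtain ⟨t, ht, ht'⟩ := ((Set.Icc_infinite (zero_lt_one (α := ℝ))).sdiff hfin).nonempty
    refine ⟨_, hK.lineMap_mem hpK hqK ht, fun i hi hmem => ht' ?_⟩
    simp only [mem_iUnion]
    exact ⟨i, hi, hmem⟩

/-- A point of `S` on the line at a parameter $t\ne0$ could be solved for `q`, putting `q` in the
span of `x` and `S`. Lines from `x` to generic points therefore meet `S` at most in `x`. -/
theorem eq_zero_of_lineMap_mem {d : ℕ} {x q : Euc d} {S : Set (Euc d)}
    (hq : q ∉ affineSpan ℝ (insert x S)) {t : ℝ} (ht : AffineMap.lineMap x q t ∈ S) : t = 0 := by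
  by_contra h0
  apply hq
  have h1 := AffineMap.lineMap_mem t⁻¹ (mem_affineSpan ℝ (mem_insert x S))
    (mem_affineSpan ℝ (mem_insert_of_mem x ht))
  rwa [AffineMap.lineMap_apply_module', AffineMap.lineMap_apply_module', add_sub_cancel_right,
    smul_smul, inv_mul_cancel₀ h0, one_smul, sub_add_cancel] at h1

/-! ### Exposed faces -/

/-- The exposing functional is maximal at `x`, a point strictly between `y` and `x + ε • (x - y)`,
so it is maximal at `y` too. -/
theorem IsExposed.mem_of_add_smul_mem {d : ℕ} {C F : Set (Euc d)} (hF : IsExposed ℝ C F)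
    {x y : Euc d} (hx : x ∈ F) (hy : y ∈ C) {ε : ℝ} (hε : 0 < ε) (h : x + ε • (x - y) ∈ C) :
    y ∈ F := by
  obtain ⟨l, rfl⟩ := hF ⟨x, hx⟩
  refine ⟨hy, fun z hz => (hx.2 z hz).trans ?_⟩
  have := hx.2 _ h
  simp only [map_add, map_smul, map_sub, smul_eq_mul] at this
  nlinarith

theorem IsExposed.disjoint_interior {d : ℕ} {C F : Set (Euc d)} (hF : IsExposed ℝ C F)
    (hne : F ≠ C) : Disjoint F (interior C) := by
  rw [Set.disjoint_left]
  intro x hx hxi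
  refine hne (hF.subset.antisymm fun y hy => ?_)
  have h1 : Tendsto (fun ε : ℝ => x + ε • (x - y)) (𝓝[>] 0) (𝓝 x) := by
    have : Continuous fun ε : ℝ => x + ε • (x - y) := by fun_prop
    simpa using (this.tendsto 0).mono_left nhdsWithin_le_nhds
  obtain ⟨ε, h2, h3⟩ := ((h1.eventually (mem_interior_iff_mem_nhds.1 hxi)).and
    self_mem_nhdsWithin).exists
  exact hF.mem_of_add_smul_mem hx hy h3 h2

theorem Convex.finrank_vectorSpan_lt {d : ℕ} {C F : Set (Euc d)} (hF : Convex ℝ F)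
    (hne : F.Nonempty) (hFC : F ⊆ C) (hd : Disjoint F (interior C)) :
    Module.finrank ℝ (vectorSpan ℝ F) < d := by
  by_contra! h
  have h1 : vectorSpan ℝ F = ⊤ := by
    apply Submodule.eq_top_of_finrank_eq
    rw [finrank_euclideanSpace_fin]
    refine le_antisymm ?_ h
    simpa using Submodule.finrank_le (vectorSpan ℝ F)
  have h2 := (AffineSubspace.affineSpan_eq_top_iff_vectorSpan_eq_top_of_nonempty ℝ _ _ hne).2 h1
  obtain ⟨x, hx⟩ := hF.interior_nonempty_iff_affineSpan_eq_top.2 h2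
  exact Set.disjoint_left.1 hd (interior_subset hx) (interior_mono hFC hx)

/-- The face is cut out by a supporting hyperplane at `x`, strictly separated from the interior by
Hahn–Banach. -/
theorem Convex.exists_exposed_of_notMem_interior {d : ℕ} {C : Set (Euc d)} (hC : Convex ℝ C)
    (hi : (interior C).Nonempty) {x : Euc d} (hx : x ∈ C)
    (hxi : x ∉ interior C) : ∃ F, IsExposed ℝ C F ∧ x ∈ F ∧ Disjoint F (interior C) := by
  obtain ⟨f, hf⟩ := geometric_hahn_banach_open_point hC.interior isOpen_interior hxi
  have hle : ∀ y ∈ C, f y ≤ f x := by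
    intro y hy
    have h1 : y ∈ closure (interior C) := by
      rw [hC.closure_interior_eq_closure_of_nonempty_interior hi]; exact subset_closure hy
    exact closure_minimal (fun a ha => (hf a ha).le)
      (isClosed_le f.continuous continuous_const) h1
  refine ⟨{y ∈ C | ∀ z ∈ C, f z ≤ f y}, fun _ => ⟨f, rfl⟩, ⟨hx, hle⟩, ?_⟩
  rw [Set.disjoint_left]
  rintro y ⟨-, hy⟩ hyi
  exact absurd (hf y hyi) (not_lt.2 (hy x hx))

theorem IsPolytope.isCompact {d : ℕ} {C : Set (Euc d)} (h : IsPolytope C) : IsCompact C := by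
  obtain ⟨⟨S, hS, rfl⟩, -⟩ := h
  exact hS.isCompact_convexHull ℝ

theorem IsPolytope.convex {d : ℕ} {C : Set (Euc d)} (h : IsPolytope C) : Convex ℝ C := by
  obtain ⟨⟨S, hS, rfl⟩, -⟩ := h
  exact convex_convexHull ℝ S

theorem IsPolytope.isClosed {d : ℕ} {C : Set (Euc d)} (h : IsPolytope C) : IsClosed C :=
  h.isCompact.isClosed

theorem IsPolytope.closure_interior {d : ℕ} {C : Set (Euc d)} (h : IsPolytope C) :
    closure (interior C) = C := by
  rw [h.convex.closure_interior_eq_closure_of_nonempty_interior h.2, h.isClosed.closure_eq]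

theorem IsPolytope.vadd {d : ℕ} {C : Set (Euc d)} (h : IsPolytope C) (t : Euc d) :
    IsPolytope (t +ᵥ C) := by
  obtain ⟨⟨S, hS, rfl⟩, hi⟩ := h
  refine ⟨⟨t +ᵥ S, hS.vadd_set, ?_⟩, ?_⟩
  · exact (convexHull_vadd t S).symm
  · rw [interior_vadd]; exact hi.vadd_set

/-- An exposed face is recovered from its extreme points by Krein–Milman, and these lie in the
finite set spanning the polytope. -/
theorem IsPolytope.finite_exposed {d : ℕ} {C : Set (Euc d)} (h : IsPolytope C) :
    {F | IsExposed ℝ C F}.Finite := by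
  have hc := h.isCompact
  have hv := h.convex
  obtain ⟨⟨S, hS, hCS⟩, -⟩ := h
  refine Set.Finite.of_finite_image (f := fun F => F.extremePoints ℝ)
    (hS.finite_subsets.subset ?_) ?_
  · rintro _ ⟨F, hF, rfl⟩
    refine (hF.isExtreme.extremePoints_subset_extremePoints).trans ?_
    rw [hCS]
    exact extremePoints_convexHull_subset
  · intro F hF F' hF' heq
    rw [← closure_convexHull_extremePoints (IsExposed.isCompact hF hc) (IsExposed.convex hF hv),
      ← closure_convexHull_extremePoints (IsExposed.isCompact hF' hc) (IsExposed.convex hF' hv)]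
    exact congrArg (fun s => closure (convexHull ℝ s)) heq

/-! ### Facets and their normals -/

/-- `n` is the outward unit normal of the polytope `C` along its facet `F`. -/
structure IsFacetNormal {d : ℕ} (C F : Set (Euc d)) (n : Euc d) : Prop where
  norm_eq : ‖n‖ = 1
  orth : n ∈ (vectorSpan ℝ F)ᗮ
  le : ∀ f ∈ F, ∀ y ∈ C, ⟪n, y⟫ ≤ ⟪n, f⟫

theorem mem_orthogonal_vectorSpan {d : ℕ} {F : Set (Euc d)} {n : Euc d} :
    n ∈ (vectorSpan ℝ F)ᗮ ↔ ∀ x ∈ F, ∀ y ∈ F, ⟪n, x⟫ = ⟪n, y⟫ := by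
  rw [Submodule.mem_orthogonal']
  constructor
  · intro h x hx y hy
    have := h (x - y) (vsub_mem_vectorSpan ℝ hx hy)
    rwa [inner_sub_right, sub_eq_zero] at this
  · intro h u hu
    rw [vectorSpan_def] at hu
    induction hu using Submodule.span_induction with
    | mem u hu =>
      obtain ⟨x, hx, y, hy, rfl⟩ := Set.mem_vsub.1 hu
      rw [vsub_eq_sub, inner_sub_right, h x hx y hy, sub_self]
    | zero => simp
    | add u v _ _ hu hv => rw [inner_add_right, hu, hv, add_zero]
    | smul a u _ hu => rw [inner_smul_right, hu, mul_zero]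

theorem inner_lt_of_mem_interior {d : ℕ} {C : Set (Euc d)} {n y : Euc d} {b : ℝ} (hn : n ≠ 0)
    (h : ∀ z ∈ C, ⟪n, z⟫ ≤ b) (hy : y ∈ interior C) : ⟪n, y⟫ < b := by
  have h1 : Tendsto (fun ε : ℝ => y + ε • n) (𝓝[>] 0) (𝓝 y) := by
    have : Continuous fun ε : ℝ => y + ε • n := by fun_prop
    simpa using (this.tendsto 0).mono_left nhdsWithin_le_nhds
  obtain ⟨ε, h2, h3⟩ := ((h1.eventually (mem_interior_iff_mem_nhds.1 hy)).and
    self_mem_nhdsWithin).exists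
  have h4 := h _ h2
  rw [inner_add_right, inner_smul_right, real_inner_self_eq_norm_sq] at h4
  have : 0 < ε * ‖n‖ ^ 2 := mul_pos h3 (by positivity)
  linarith

theorem IsFacetNormal.ne_zero {d : ℕ} {C F : Set (Euc d)} {n : Euc d} (h : IsFacetNormal C F n) :
    n ≠ 0 := by
  rintro rfl
  simpa using h.norm_eq

theorem IsFacetNormal.lt {d : ℕ} {C F : Set (Euc d)} {n f y : Euc d} (h : IsFacetNormal C F n)
    (hf : f ∈ F) (hy : y ∈ interior C) : ⟪n, y⟫ < ⟪n, f⟫ :=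
  inner_lt_of_mem_interior h.ne_zero (h.le f hf) hy

theorem finrank_vectorSpan_of_interior {d : ℕ} {C : Set (Euc d)} (hi : (interior C).Nonempty) :
    Module.finrank ℝ (vectorSpan ℝ C) = d := by
  have h1 : affineSpan ℝ C = ⊤ := by
    refine top_le_iff.1 ?_
    rw [← isOpen_interior.affineSpan_eq_top hi]
    exact affineSpan_mono ℝ interior_subset
  rw [← direction_affineSpan, h1, AffineSubspace.direction_top, finrank_top,
    finrank_euclideanSpace_fin]

theorem IsFaceOfCodim.exists_normal {d : ℕ} {C F : Set (Euc d)} (hi : (interior C).Nonempty)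
    (hF : IsFaceOfCodim 1 C F) : ∃ n, IsFacetNormal C F n ∧
      ∀ f ∈ F, ∀ y ∈ C, ⟪n, y⟫ = ⟪n, f⟫ → y ∈ F := by
  obtain ⟨hexp, hne, hdim⟩ := hF
  obtain ⟨l, hl⟩ := hexp hne
  obtain ⟨v, rfl⟩ := (InnerProductSpace.toDual ℝ (Euc d)).surjective l
  simp only [InnerProductSpace.toDual_apply_apply] at hl
  -- A zero functional would expose all of `C`, which has codimension 0 and not 1.
  have hv : v ≠ 0 := by
    rintro rfl
    simp only [inner_zero_left, le_refl, implies_true, and_true] at hl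
    have hFC : F = C := hl
    rw [hFC, finrank_vectorSpan_of_interior hi] at hdim
    omega
  have hv' : 0 < ‖v‖⁻¹ := inv_pos.2 (norm_pos_iff.2 hv)
  have hle : ∀ f ∈ F, ∀ y ∈ C, ⟪v, y⟫ ≤ ⟪v, f⟫ := by
    intro f hf y hy
    rw [hl] at hf
    exact hf.2 y hy
  refine ⟨‖v‖⁻¹ • v, ⟨?_, ?_, ?_⟩, ?_⟩
  · rw [norm_smul, norm_inv, norm_norm, inv_mul_cancel₀ (norm_ne_zero_iff.2 hv)]
  · refine Submodule.smul_mem _ _ (mem_orthogonal_vectorSpan.2 fun x hx y hy => ?_)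
    exact le_antisymm (hle y hy x (hexp.subset hx)) (hle x hx y (hexp.subset hy))
  · intro f hf y hy
    rw [real_inner_smul_left, real_inner_smul_left]
    exact mul_le_mul_of_nonneg_left (hle f hf y hy) hv'.le
  · intro f hf y hy h
    rw [real_inner_smul_left, real_inner_smul_left, mul_right_inj' hv'.ne'] at h
    rw [hl]
    exact ⟨hy, fun z hz => h ▸ hle f hf z hz⟩

theorem eq_or_eq_neg_of_orthogonal {d : ℕ} {V : Submodule ℝ (Euc d)} {n n' : Euc d}
    (hV : Module.finrank ℝ V + 1 = d)
    (hn : ‖n‖ = 1) (hn' : ‖n'‖ = 1) (h : n ∈ Vᗮ) (h' : n' ∈ Vᗮ) : n' = n ∨ n' = -n := by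
  have h1 : Module.finrank ℝ Vᗮ = 1 := by
    have := Submodule.finrank_add_finrank_orthogonal V
    rw [finrank_euclideanSpace_fin] at this
    omega
  have h2 : (⟨n, h⟩ : Vᗮ) ≠ 0 := by
    intro h0
    have : n = 0 := congrArg Subtype.val h0
    simp [this] at hn
  obtain ⟨c, hc⟩ := (finrank_eq_one_iff_of_nonzero' _ h2).1 h1 ⟨n', h'⟩
  have hc' : c • n = n' := congrArg Subtype.val hc
  rw [← hc', norm_smul, hn, mul_one, Real.norm_eq_abs] at hn'
  rcases eq_or_eq_neg_of_abs_eq hn' with rfl | rfl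
  · left; rw [← hc', one_smul]
  · right; rw [← hc', neg_smul, one_smul]

theorem IsFacetNormal.eq {d : ℕ} {C F : Set (Euc d)} (hi : (interior C).Nonempty)
    (hF : IsFaceOfCodim 1 C F) {n n' : Euc d} (h : IsFacetNormal C F n)
    (h' : IsFacetNormal C F n') : n' = n := by
  rcases eq_or_eq_neg_of_orthogonal hF.2.2 h.norm_eq h'.norm_eq h.orth h'.orth with h1 | h1
  · exact h1
  · obtain ⟨y, hy⟩ := hi
    obtain ⟨f, hf⟩ := hF.2.1
    have h2 := h.lt hf hy
    have h3 := h'.lt hf hy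
    rw [h1, inner_neg_left, inner_neg_left] at h3
    linarith

theorem IsFacetNormal.mem_iff {d : ℕ} {C F : Set (Euc d)} (hi : (interior C).Nonempty)
    (hF : IsFaceOfCodim 1 C F) {n f y : Euc d} (h : IsFacetNormal C F n) (hf : f ∈ F)
    (hy : y ∈ C) : y ∈ F ↔ ⟪n, y⟫ = ⟪n, f⟫ := by
  obtain ⟨n', h1, h2⟩ := hF.exists_normal hi
  obtain rfl := h.eq hi hF h1
  exact ⟨fun hyF => mem_orthogonal_vectorSpan.1 h.orth y hyF f hf, fun he => h2 f hf y hy he⟩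

/-- The normal of the larger facet is also a normal of the smaller one, and a facet is the full set
where its normal functional is maximal. -/
theorem IsFaceOfCodim.eq_of_subset {d : ℕ} {C F F' : Set (Euc d)} (hi : (interior C).Nonempty)
    (hF : IsFaceOfCodim 1 C F) (hF' : IsFaceOfCodim 1 C F') (h : F ⊆ F') : F = F' := by
  obtain ⟨n, hn⟩ := hF'.exists_normal hi
  obtain ⟨f, hf⟩ := hF.2.1
  have h1 : IsFacetNormal C F n :=
    ⟨hn.1.norm_eq, mem_orthogonal_vectorSpan.2 fun x hx y hy =>
      mem_orthogonal_vectorSpan.1 hn.1.orth x (h hx) y (h hy), fun f hf => hn.1.le f (h hf)⟩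
  ext y
  constructor
  · exact fun hy => h hy
  · intro hy
    rw [h1.mem_iff hi hF hf (hF'.1.subset hy)]
    exact mem_orthogonal_vectorSpan.1 hn.1.orth _ hy _ (h hf)

/-- Walk from `x` to a generic interior point `o`. The first point in `C` lies on a proper face,
which by genericity has codimension 1, and its normal grows from `o` towards `x`. -/
theorem IsPolytope.exists_facet_of_notMem {d : ℕ} {C : Set (Euc d)} (hC : IsPolytope C)
    {x : Euc d} (hx : x ∉ C) : ∃ F n, IsFaceOfCodim 1 C F ∧ IsFacetNormal C F n ∧
      ∀ f ∈ F, ⟪n, f⟫ < ⟪n, x⟫ := by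
  have : Finite {F | IsExposed ℝ C F} := hC.finite_exposed
  -- Faces of codimension at least 2 span with `x` a proper subspace; avoiding these spans keeps the
  -- segment off such faces except possibly at `x`, which is outside `C`.
  obtain ⟨o, ho, hoF⟩ := exists_mem_open_forall_notMem isOpen_interior hC.2
    (fun F : {F : {F | IsExposed ℝ C F} // Module.finrank ℝ (vectorSpan ℝ F.1) + 2 ≤ d} =>
      insert x F.1.1) (fun F => by
        have h1 := finrank_vectorSpan_insert_le_set ℝ F.1.1 x
        have h2 := F.2
        omega)
  set K : Set ℝ := {t | t ∈ Icc (0 : ℝ) 1 ∧ AffineMap.lineMap x o t ∈ C} with hK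
  have hKc : IsCompact K := by
    refine isCompact_Icc.inter_right (hC.isClosed.preimage ?_)
    exact AffineMap.lineMap_continuous
  have hKne : K.Nonempty := ⟨1, by simp, by simpa using interior_subset ho⟩
  obtain ⟨t, ⟨⟨ht0, ht1⟩, htC⟩, hmin⟩ := hKc.exists_isLeast hKne
  have ht : t ≠ 0 := by
    rintro rfl
    simp at htC
    exact hx htC
  have htpos : 0 < t := lt_of_le_of_ne ht0 (Ne.symm ht)
  have hnint : AffineMap.lineMap x o t ∉ interior C := by
    intro hint
    have h1 : ∀ᶠ r in 𝓝[<] t, AffineMap.lineMap x o r ∈ interior C :=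
      nhdsWithin_le_nhds ((AffineMap.lineMap_continuous (p := x) (q := o)).continuousAt
        |>.eventually (isOpen_interior.mem_nhds hint))
    have h2 : ∀ᶠ r in 𝓝[<] t, 0 < r := nhdsWithin_le_nhds (lt_mem_nhds htpos)
    obtain ⟨r, ⟨hr1, hr2⟩, hr3⟩ := ((h1.and h2).and self_mem_nhdsWithin).exists
    have hr3 : r < t := hr3
    exact absurd (hmin ⟨⟨hr2.le, by linarith⟩, interior_subset hr1⟩) (not_le.2 hr3)
  obtain ⟨F, hFe, hpF, hFd⟩ := hC.convex.exists_exposed_of_notMem_interior hC.2 htC hnint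
  have hlt := (hFe.convex hC.convex).finrank_vectorSpan_lt ⟨_, hpF⟩ hFe.subset hFd
  have hnot : ¬ Module.finrank ℝ (vectorSpan ℝ F) + 2 ≤ d := by
    intro hle
    exact ht (eq_zero_of_lineMap_mem (hoF ⟨⟨F, hFe⟩, hle⟩) hpF)
  have hFcod : IsFaceOfCodim 1 C F := ⟨hFe, ⟨_, hpF⟩, by omega⟩
  obtain ⟨n, hn, -⟩ := hFcod.exists_normal hC.2
  refine ⟨F, n, hFcod, hn, fun f hf => ?_⟩
  have h1 := hn.lt hpF ho
  rw [mem_orthogonal_vectorSpan.1 hn.orth f hf _ hpF]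
  rw [AffineMap.lineMap_apply_module, inner_add_right, inner_smul_right, inner_smul_right] at h1 ⊢
  nlinarith

/-- Leaving a polytope along a segment one crosses a facet. -/
theorem IsPolytope.exists_facet_on_segment {d : ℕ} {C : Set (Euc d)} (hC : IsPolytope C)
    {y x : Euc d} (hy : y ∈ C) (hx : x ∉ C) : ∃ z ∈ segment ℝ y x, ∃ F n, z ∈ F ∧
      IsFaceOfCodim 1 C F ∧ IsFacetNormal C F n ∧ ⟪n, z⟫ < ⟪n, x⟫ := by
  classical
  have hfin : {F | IsFaceOfCodim 1 C F}.Finite := hC.finite_exposed.subset fun F hF => hF.1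
  have hex : ∀ F : Set (Euc d), ∃ (n f : Euc d), IsFaceOfCodim 1 C F →
      f ∈ F ∧ IsFacetNormal C F n := by
    intro F
    by_cases hF : IsFaceOfCodim 1 C F
    · obtain ⟨n, hn, -⟩ := hF.exists_normal hC.2
      exact ⟨n, hF.2.1.some, fun _ => ⟨hF.2.1.some_mem, hn⟩⟩
    · exact ⟨0, 0, fun h => absurd h hF⟩
  choose n f hnf using hex
  -- These are the facets whose inequality fails at `x`. The minimizer below is the one whose
  -- hyperplane the segment crosses first, at parameter `t`.
  set V : Set (Set (Euc d)) := {F | IsFaceOfCodim 1 C F ∧ ⟪n F, f F⟫ < ⟪n F, x⟫} with hV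
  have hVne : V.Nonempty := by
    obtain ⟨F, m, hF, hm, hlt⟩ := hC.exists_facet_of_notMem hx
    obtain rfl := (hnf F hF).2.eq hC.2 hF hm
    exact ⟨F, hF, hlt _ (hnf F hF).1⟩
  obtain ⟨F, ⟨hF, hFx⟩, hmin⟩ := Set.exists_min_image V
    (fun F => (⟪n F, f F⟫ - ⟪n F, y⟫) / (⟪n F, x⟫ - ⟪n F, y⟫))
    (hfin.subset fun F hF => hF.1) hVne
  have hle : ∀ F, IsFaceOfCodim 1 C F → ⟪n F, y⟫ ≤ ⟪n F, f F⟫ := fun F hF =>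
    (hnf F hF).2.le _ (hnf F hF).1 _ hy
  set t := (⟪n F, f F⟫ - ⟪n F, y⟫) / (⟪n F, x⟫ - ⟪n F, y⟫) with ht
  have hyF := hle F hF
  have hden : 0 < ⟪n F, x⟫ - ⟪n F, y⟫ := by linarith
  have ht0 : 0 ≤ t := div_nonneg (by linarith) hden.le
  have ht1 : t < 1 := by rw [ht, div_lt_one hden]; linarith
  have hval : ∀ m : Euc d, ⟪m, AffineMap.lineMap y x t⟫ = ⟪m, y⟫ + t * (⟪m, x⟫ - ⟪m, y⟫) := by
    intro m
    rw [AffineMap.lineMap_apply_module, inner_add_right, inner_smul_right, inner_smul_right]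
    ring
  -- If the crossing point were outside `C`, another facet inequality would already fail there, so
  -- its hyperplane would have been crossed at a smaller parameter.
  have hz : AffineMap.lineMap y x t ∈ C := by
    by_contra hzC
    obtain ⟨F', m, hF', hm, hlt⟩ := hC.exists_facet_of_notMem hzC
    obtain rfl := (hnf F' hF').2.eq hC.2 hF' hm
    have h1 := hlt _ (hnf F' hF').1
    have h2 := hle F' hF'
    rw [hval] at h1
    have h3 : 0 < ⟪n F', x⟫ - ⟪n F', y⟫ := by
      by_contra! h
      nlinarith
    have h4 : F' ∈ V := ⟨hF', by nlinarith⟩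
    have h5 := hmin F' h4
    rw [le_div_iff₀ h3] at h5
    linarith
  have heq : ⟪n F, AffineMap.lineMap y x t⟫ = ⟪n F, f F⟫ := by
    rw [hval, ht, div_mul_cancel₀ _ hden.ne']
    ring
  refine ⟨AffineMap.lineMap y x t, ?_, F, n F, ?_, hF, (hnf F hF).2, ?_⟩
  · rw [segment_eq_image_lineMap]
    exact ⟨t, ⟨ht0, ht1.le⟩, rfl⟩
  · rwa [(hnf F hF).2.mem_iff hC.2 hF (hnf F hF).1 hz]
  · rwa [heq]

/-- Near one of its points, a polytope is cut out by the facets through that point. -/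
theorem IsPolytope.eventually_mem_of_forall_facet {d : ℕ} {C : Set (Euc d)} (hC : IsPolytope C)
    {m : Euc d} (hm : m ∈ C) : ∀ᶠ y in 𝓝 m, (∀ F n, IsFaceOfCodim 1 C F → IsFacetNormal C F n →
      m ∈ F → ⟪n, y⟫ ≤ ⟪n, m⟫) → y ∈ C := by
  have hfin : {F | IsFaceOfCodim 1 C F}.Finite := hC.finite_exposed.subset fun F hF => hF.1
  -- The inequalities of the finitely many facets missing `m` are strict at `m` and persist nearby.
  have h1 : ∀ F' ∈ {F | IsFaceOfCodim 1 C F}, ∀ᶠ y in 𝓝 m, m ∉ F' → ∀ n', IsFacetNormal C F' n' →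
      ∀ f ∈ F', ⟪n', y⟫ ≤ ⟪n', f⟫ := by
    intro F' hF'
    by_cases hmem : m ∈ F'
    · simp [hmem]
    obtain ⟨n', hn', -⟩ := hF'.exists_normal hC.2
    obtain ⟨f, hf⟩ := hF'.2.1
    have hlt : ⟪n', m⟫ < ⟪n', f⟫ := lt_of_le_of_ne (hn'.le f hf m hm)
      fun h => hmem ((hn'.mem_iff hC.2 hF' hf hm).2 h)
    have hc : Continuous fun y : Euc d => ⟪n', y⟫ := by fun_prop
    filter_upwards [hc.continuousAt.eventually (gt_mem_nhds hlt)] with y hy _ n'' hn'' f' hf'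
    obtain rfl := hn'.eq hC.2 hF' hn''
    rw [mem_orthogonal_vectorSpan.1 hn''.orth f' hf' f hf]
    exact hy.le
  filter_upwards [(eventually_all_finite hfin).2 h1] with y hy hle
  by_contra hyC
  obtain ⟨F', n', hF', hn', hlt⟩ := hC.exists_facet_of_notMem hyC
  by_cases hmem : m ∈ F'
  · exact absurd (hlt m hmem) (not_lt.2 (hle F' n' hF' hn' hmem))
  · obtain ⟨f, hf⟩ := hF'.2.1
    exact absurd (hlt f hf) (not_lt.2 (hy F' hF' hmem n' hn' f hf))

/-- Near a point lying on a single facet, a polytope is a halfspace. -/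
theorem IsPolytope.eventually_mem_of_inner_le {d : ℕ} {C F : Set (Euc d)} (hC : IsPolytope C)
    {n m : Euc d} (hm : m ∈ C) (hmF : ∀ F', IsFaceOfCodim 1 C F' → m ∈ F' → F' = F)
    (hF : IsFaceOfCodim 1 C F) (hn : IsFacetNormal C F n) :
    ∀ᶠ y in 𝓝 m, ⟪n, y⟫ ≤ ⟪n, m⟫ → y ∈ C := by
  filter_upwards [hC.eventually_mem_of_forall_facet hm] with y hy hle
  refine hy fun F' n' hF' hn' hmF' => ?_
  obtain rfl := hmF F' hF' hmF'
  obtain rfl := hn.eq hC.2 hF hn'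
  exact hle

/-- The smallest exposed face through a point of a polytope has that point in its relative
interior. -/
theorem IsPolytope.exists_minimal_exposed {d : ℕ} {C : Set (Euc d)} (hC : IsPolytope C)
    {x : Euc d} (hx : x ∈ C) : ∃ G, IsExposed ℝ C G ∧ x ∈ G ∧
      (∀ E, IsExposed ℝ C E → x ∈ E → G ⊆ E) ∧ ∀ y ∈ G, ∃ ε : ℝ, 0 < ε ∧ x + ε • (x - y) ∈ G := by
  have hfin : {E | IsExposed ℝ C E ∧ x ∈ E}.Finite := hC.finite_exposed.subset fun E hE => hE.1
  have hne : hfin.toFinset.Nonempty := ⟨C, by simp [IsExposed.refl, hx]⟩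
  -- The minimal face is the intersection of the finitely many exposed faces through `x`.
  have hG := IsExposed.sInter hne (A := C) (𝕜 := ℝ) fun E hE => by simp at hE; exact hE.1
  have hmin : ∀ E, IsExposed ℝ C E → x ∈ E → ⋂₀ (hfin.toFinset : Set (Set (Euc d))) ⊆ E :=
    fun E hE hxE => sInter_subset_of_mem (by simp [hE, hxE])
  have hxG : x ∈ ⋂₀ (hfin.toFinset : Set (Set (Euc d))) := by
    intro E hE
    simp at hE
    exact hE.2
  refine ⟨_, hG, hxG, hmin, fun y hy => ?_⟩
  have h1 : Tendsto (fun ε : ℝ => x + ε • (x - y)) (𝓝[>] 0) (𝓝 x) := by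
    have : Continuous fun ε : ℝ => x + ε • (x - y) := by fun_prop
    simpa using (this.tendsto 0).mono_left nhdsWithin_le_nhds
  obtain ⟨ε, h2, h3⟩ := ((h1.eventually (hC.eventually_mem_of_forall_facet hx)).and
    self_mem_nhdsWithin).exists
  -- Every facet through `x` contains `y`, so its functional is constant on this line and the local
  -- description of `C` at `x` applies.
  have hmem : x + ε • (x - y) ∈ C := h2 fun F n hF hn hxF => by
    have := mem_orthogonal_vectorSpan.1 hn.orth x hxF y (hmin F hF.1 hxF hy)
    rw [inner_add_right, inner_smul_right, inner_sub_right, this]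
    simp
  refine ⟨ε, h3, fun E hE => ?_⟩
  simp at hE
  have hyE := hmin E hE.1 hE.2 hy
  obtain ⟨l, rfl⟩ := hE.1 ⟨x, hE.2⟩
  refine ⟨hmem, fun z hz => (hE.2.2 z hz).trans ?_⟩
  have h4 := hE.2.2 y hyE.1
  have h3 : 0 < ε := h3
  simp only [map_add, map_smul, map_sub, smul_eq_mul]
  nlinarith

/-! ### Tilings: local structure -/

/-- `x` lies on no face of codimension at least `k` of a cell of `T`. -/
def AvoidsCodim {d : ℕ} (T : Set (Set (Euc d))) (k : ℕ) (x : Euc d) : Prop :=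
  ∀ C ∈ T, ∀ E, IsExposed ℝ C E → Module.finrank ℝ (vectorSpan ℝ E) + k ≤ d → x ∉ E

/-- The faces of codimension at least `k` of the cells of `T`. -/
def codimFaces {d : ℕ} (T : Set (Set (Euc d))) (k : ℕ) : Set (Set (Euc d)) :=
  {E | Module.finrank ℝ (vectorSpan ℝ E) + k ≤ d ∧ ∃ C ∈ T, IsExposed ℝ C E}

theorem avoidsCodim_iff {d : ℕ} {T : Set (Set (Euc d))} {k : ℕ} {x : Euc d} :
    AvoidsCodim T k x ↔ ∀ E ∈ codimFaces T k, x ∉ E :=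
  ⟨fun h E hE => by obtain ⟨hd, C, hC, hE⟩ := hE; exact h C hC E hE hd,
    fun h C hC E hE hd => h E ⟨hd, C, hC, hE⟩⟩

theorem AdjacentCells.symm {d : ℕ} {C C' : Set (Euc d)} (h : AdjacentCells C C') :
    AdjacentCells C' C := by
  unfold AdjacentCells at *
  rw [inter_comm]
  exact ⟨h.2, h.1⟩

namespace IsParallelohedralTiling
variable {d : ℕ} {P : Set (Euc d)} {T : Set (Set (Euc d))}

theorem polytope_of_mem (hT : IsParallelohedralTiling P T) {C : Set (Euc d)} (hC : C ∈ T) :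
    IsPolytope C := by
  obtain ⟨t, rfl⟩ := hT.translate C hC
  exact hT.polytope.vadd t

/-- A cell is the closure of its interior, so a cell through an interior point of another one would
have interior points in common with it. -/
theorem eq_of_mem_interior (hT : IsParallelohedralTiling P T) {C C' : Set (Euc d)} (hC : C ∈ T)
    (hC' : C' ∈ T) {x : Euc d} (hx : x ∈ interior C) (hx' : x ∈ C') : C = C' := by
  by_contra hne
  rw [← (hT.polytope_of_mem hC').closure_interior] at hx'
  obtain ⟨y, hy, hy'⟩ := mem_closure_iff.1 hx' _ isOpen_interior hx
  exact Set.disjoint_left.1 (hT.disjoint C hC C' hC' hne) hy hy'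

/-- A packing argument: the cells have equal positive volume and disjoint interiors, and those
meeting a bounded set lie in a fixed ball. -/
theorem finite_meeting (hT : IsParallelohedralTiling P T) {R : Set (Euc d)}
    (hR : Bornology.IsBounded R) : {C | C ∈ T ∧ (C ∩ R).Nonempty}.Finite := by
  set I := {C | C ∈ T ∧ (C ∩ R).Nonempty} with hI
  obtain ⟨ρ, hρ⟩ := hT.polytope.isCompact.isBounded.subset_closedBall 0
  obtain ⟨R₀, hR₀⟩ := hR.subset_closedBall 0
  have hvol : ∀ C ∈ T, MeasureTheory.volume (interior C) =
      MeasureTheory.volume (interior P) := by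
    intro C hC
    obtain ⟨t, rfl⟩ := hT.translate C hC
    rw [interior_vadd]
    exact MeasureTheory.measure_vadd _ _ _
  have h := MeasureTheory.Measure.finite_const_le_meas_of_disjoint_iUnion
    (MeasureTheory.volume : MeasureTheory.Measure (Euc d))
    (ε := MeasureTheory.volume (interior P)) (isOpen_interior.measure_pos _ hT.polytope.2)
    (As := fun C : I => interior C.1) (fun C => isOpen_interior.measurableSet)
    (fun C C' hne => hT.disjoint C.1 C.2.1 C'.1 C'.2.1 fun h => hne (Subtype.ext h)) ?_
  · have h2 : {i : I | MeasureTheory.volume (interior P) ≤ MeasureTheory.volume (interior i.1)} =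
        univ := eq_univ_of_forall fun C => (hvol C.1 C.2.1).ge
    rw [h2] at h
    exact Set.finite_univ_iff.1 h
  -- A point of a cell is at distance at most `2 * ρ` from a point of the same cell in `R`, since
  -- `P` lies in the ball of radius `ρ` about the origin.
  · refine ((MeasureTheory.measure_mono (t := Metric.closedBall 0 (R₀ + 2 * ρ)) ?_).trans_lt
      (isCompact_closedBall _ _).measure_lt_top).ne
    refine iUnion_subset fun C z hz => ?_
    obtain ⟨hCT, y, hyC, hyR⟩ := C.2
    obtain ⟨t, ht⟩ := hT.translate C.1 hCT
    have hz' := interior_subset hz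
    rw [ht] at hz' hyC
    obtain ⟨p, hp, rfl⟩ := hz'
    obtain ⟨q, hq, rfl⟩ := hyC
    have h1 := hρ hp
    have h2 := hρ hq
    have h3 := hR₀ hyR
    simp only [mem_closedBall_zero_iff, vadd_eq_add] at h1 h2 h3 ⊢
    calc ‖t + p‖ = ‖(t + q) + (p - q)‖ := by congr 1; abel
      _ ≤ ‖t + q‖ + (‖p‖ + ‖q‖) := (norm_add_le _ _).trans (by gcongr; exact norm_sub_le _ _)
      _ ≤ R₀ + 2 * ρ := by linarith

theorem countable_cells (hT : IsParallelohedralTiling P T) : T.Countable := by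
  have h : T ⊆ ⋃ n : ℕ, {C | C ∈ T ∧ (C ∩ Metric.closedBall 0 n).Nonempty} := by
    intro C hC
    obtain ⟨x, hx⟩ := (hT.polytope_of_mem hC).2
    obtain ⟨n, hn⟩ := exists_nat_ge ‖x‖
    exact mem_iUnion.2 ⟨n, hC, x, interior_subset hx, by simpa using hn⟩
  exact (countable_iUnion fun n => (hT.finite_meeting Metric.isBounded_closedBall).countable).mono h

/-- Local finiteness and closedness of the cells. This semicontinuity drives every later induction
along a connected set. -/
theorem eventually_cells_subset (hT : IsParallelohedralTiling P T) (x : Euc d) :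
    ∀ᶠ y in 𝓝 x, ∀ C ∈ T, y ∈ C → x ∈ C := by
  have hfin := hT.finite_meeting (R := Metric.closedBall x 1) Metric.isBounded_closedBall
  have h1 : ∀ C ∈ {C | C ∈ T ∧ (C ∩ Metric.closedBall x 1).Nonempty}, ∀ᶠ y in 𝓝 x,
      y ∈ C → x ∈ C := by
    rintro C ⟨hC, -⟩
    by_cases hx : x ∈ C
    · simp [hx]
    · filter_upwards [(hT.polytope_of_mem hC).isClosed.isOpen_compl.mem_nhds hx] with y hy hyC
      exact absurd hyC hy
  filter_upwards [(eventually_all_finite hfin).2 h1, Metric.closedBall_mem_nhds x one_pos]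
    with y hy hyB C hC hyC
  exact hy C ⟨hC, y, hyC, hyB⟩ hyC

theorem countable_codimFaces (hT : IsParallelohedralTiling P T) (k : ℕ) :
    (codimFaces T k).Countable := by
  have h : codimFaces T k ⊆ ⋃ C ∈ T, {E | IsExposed ℝ C E} := by
    rintro E ⟨-, C, hC, hE⟩
    exact mem_biUnion hC hE
  exact (hT.countable_cells.biUnion fun C hC =>
    (hT.polytope_of_mem hC).finite_exposed.countable).mono h

theorem avoidsCodim_of_mem_interior (hT : IsParallelohedralTiling P T) {C : Set (Euc d)}
    (hC : C ∈ T) {x : Euc d} (hx : x ∈ interior C) {k : ℕ} (hk : 1 ≤ k) : AvoidsCodim T k x := by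
  intro C' hC' E hE hd hxE
  obtain rfl := hT.eq_of_mem_interior hC hC' hx (hE.subset hxE)
  refine Set.disjoint_left.1 (hE.disjoint_interior ?_) hxE hx
  rintro rfl
  rw [finrank_vectorSpan_of_interior ⟨x, hx⟩] at hd
  omega

theorem _root_.exists_mem_open_forall_notMem_affineSpan {V : Set (Euc d)} (hV : IsOpen V)
    (hne : V.Nonempty) (S : Set (Set (Euc d))) (hS : S.Countable)
    (hdim : ∀ E ∈ S, Module.finrank ℝ (vectorSpan ℝ E) < d) :
    ∃ x ∈ V, ∀ E ∈ S, x ∉ affineSpan ℝ E := by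
  have := hS.to_subtype
  obtain ⟨x, hx, h⟩ := exists_mem_open_forall_notMem hV hne (fun E : S => E.1)
    fun E => hdim E.1 E.2
  exact ⟨x, hx, fun E hE => h ⟨E, hE⟩⟩

/-- The intersection is a common face disjoint from the interiors, hence of codimension at least 1.
Since it contains `x`, its codimension is not 2 or more. -/
theorem adjacent_of_avoids (hT : IsParallelohedralTiling P T) {C C' : Set (Euc d)} (hC : C ∈ T)
    (hC' : C' ∈ T) (hne : C ≠ C') {x : Euc d} (hx : AvoidsCodim T 2 x) (hxC : x ∈ C)
    (hxC' : x ∈ C') : AdjacentCells C C' := by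
  have hdisj : ∀ A ∈ T, ∀ B ∈ T, A ≠ B → x ∈ A → x ∈ B → IsFaceOfCodim 1 A (A ∩ B) := by
    intro A hA B hB hAB hxA hxB
    have h1 := (hT.face_to_face A hA B hB).1
    have h2 : Disjoint (A ∩ B) (interior A) := Set.disjoint_left.2 fun y hy hyi =>
      hAB (hT.eq_of_mem_interior hA hB hyi hy.2)
    have h3 := (h1.convex (hT.polytope_of_mem hA).convex).finrank_vectorSpan_lt ⟨x, hxA, hxB⟩
      h1.subset h2
    have h4 : ¬ _ := fun h => hx A hA (A ∩ B) h1 h ⟨hxA, hxB⟩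
    exact ⟨h1, ⟨x, hxA, hxB⟩, by omega⟩
  refine ⟨hdisj C hC C' hC' hne hxC hxC', ?_⟩
  rw [inter_comm]
  exact hdisj C' hC' C hC hne.symm hxC' hxC

/-- The face `F ∩ F'` contains `x`, so it is again a facet, and a facet contained in a facet equals
it. -/
theorem facet_unique_of_avoids (hT : IsParallelohedralTiling P T) {C F F' : Set (Euc d)}
    (hC : C ∈ T) {x : Euc d} (hx : AvoidsCodim T 2 x) (hF : IsFaceOfCodim 1 C F)
    (hF' : IsFaceOfCodim 1 C F') (hxF : x ∈ F) (hxF' : x ∈ F') : F = F' := by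
  have hi := (hT.polytope_of_mem hC).2
  have h1 : IsExposed ℝ C (F ∩ F') := hF.1.inter hF'.1
  have h2 : IsFaceOfCodim 1 C (F ∩ F') := by
    refine ⟨h1, ⟨x, hxF, hxF'⟩, ?_⟩
    have h4 : ¬ _ := fun h => hx C hC (F ∩ F') h1 h ⟨hxF, hxF'⟩
    have h5 := Submodule.finrank_mono (vectorSpan_mono ℝ (inter_subset_left : F ∩ F' ⊆ F))
    have h6 := hF.2.2
    omega
  rw [← h2.eq_of_subset hi hF inter_subset_left]
  exact h2.eq_of_subset hi hF' inter_subset_right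

/-- Only finitely many faces of codimension at least 2 belong to cells meeting `C`, and their affine
spans are too small to contain or cover a facet. -/
theorem exists_avoids_of_facet (hT : IsParallelohedralTiling P T) {C F : Set (Euc d)}
    (hC : C ∈ T) (hF : IsFaceOfCodim 1 C F) : ∃ m ∈ F, AvoidsCodim T 2 m := by
  have hCp := hT.polytope_of_mem hC
  have hfin := hT.finite_meeting hCp.isCompact.isBounded
  have hfin2 : (⋃ D ∈ {D | D ∈ T ∧ (D ∩ C).Nonempty}, {E | IsExposed ℝ D E ∧
      Module.finrank ℝ (vectorSpan ℝ E) + 2 ≤ d}).Finite :=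
    hfin.biUnion fun D hD => (hT.polytope_of_mem hD.1).finite_exposed.subset fun E hE => hE.1
  obtain ⟨m, hmF, hm⟩ := (hF.1.convex hCp.convex).exists_forall_notMem_affineSubspace hF.2.1
    hfin2.toFinset (fun E => affineSpan ℝ E) (by
      intro E hE hsub
      simp only [Finite.mem_toFinset, mem_iUnion] at hE
      obtain ⟨D, hD, hE⟩ := hE
      have h1 : affineSpan ℝ F ≤ affineSpan ℝ E := affineSpan_le.2 hsub
      have h2 := AffineSubspace.direction_le h1
      rw [direction_affineSpan, direction_affineSpan] at h2
      have h3 := Submodule.finrank_mono h2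
      have := hF.2.2
      have := hE.2
      omega)
  refine ⟨m, hmF, fun D hD E hE hd hmE => hm E ?_ (mem_affineSpan ℝ hmE)⟩
  simp only [Finite.mem_toFinset, mem_iUnion]
  exact ⟨D, ⟨hD, m, hE.subset hmE, hF.1.subset hmF⟩, hE, hd⟩

theorem ne_of_adjacent (hT : IsParallelohedralTiling P T) {C C' : Set (Euc d)} (hC : C ∈ T)
    (h : AdjacentCells C C') : C ≠ C' := by
  rintro rfl
  have h1 := h.1.2.2
  rw [inter_self, finrank_vectorSpan_of_interior (hT.polytope_of_mem hC).2] at h1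
  omega

/-- The two outward normals agree up to sign. If they were equal, both cells would contain the same
half ball at a generic point of the facet, and their interiors would overlap. -/
theorem normal_neg (hT : IsParallelohedralTiling P T) {C C' : Set (Euc d)} (hC : C ∈ T)
    (hC' : C' ∈ T) (hadj : AdjacentCells C C') {n : Euc d} (hn : IsFacetNormal C (C ∩ C') n) :
    IsFacetNormal C' (C ∩ C') (-n) := by
  obtain ⟨n', hn', -⟩ := hadj.2.exists_normal (hT.polytope_of_mem hC').2
  rcases eq_or_eq_neg_of_orthogonal hadj.1.2.2 hn.norm_eq hn'.norm_eq hn.orth hn'.orth with h | h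
  swap
  · rwa [← h]
  exfalso
  subst h
  obtain ⟨m, hm, hmg⟩ := hT.exists_avoids_of_facet hC hadj.1
  have e1 := (hT.polytope_of_mem hC).eventually_mem_of_inner_le hm.1
    (fun F' hF' hmF' => hT.facet_unique_of_avoids hC hmg hF' hadj.1 hmF' hm) hadj.1 hn
  have e2 := (hT.polytope_of_mem hC').eventually_mem_of_inner_le hm.2
    (fun F' hF' hmF' => hT.facet_unique_of_avoids hC' hmg hF' hadj.2 hmF' hm) hadj.2 hn'
  have h1 : Tendsto (fun ε : ℝ => m - ε • n') (𝓝[>] 0) (𝓝 m) := by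
    have : Continuous fun ε : ℝ => m - ε • n' := by fun_prop
    simpa using (this.tendsto 0).mono_left nhdsWithin_le_nhds
  obtain ⟨ε, h2, h3⟩ := ((h1.eventually (eventually_eventually_nhds.2 (e1.and e2))).and
    self_mem_nhdsWithin).exists
  have h3 : 0 < ε := h3
  have h4 : ⟪n', m - ε • n'⟫ < ⟪n', m⟫ := by
    rw [inner_sub_right, inner_smul_right, real_inner_self_eq_norm_sq, hn'.norm_eq]
    linarith
  have hc : Continuous fun y : Euc d => ⟪n', y⟫ := by fun_prop
  have h5 : ∀ᶠ z in 𝓝 (m - ε • n'), z ∈ C ∧ z ∈ C' := by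
    filter_upwards [h2, hc.continuousAt.eventually (gt_mem_nhds h4)] with z hz hz'
    exact ⟨hz.1 hz'.le, hz.2 hz'.le⟩
  refine hT.ne_of_adjacent hC hadj (hT.eq_of_mem_interior hC hC' (x := m - ε • n') ?_
    h5.self_of_nhds.2)
  exact mem_interior_iff_mem_nhds.2 (h5.mono fun z hz => hz.1)

theorem isNormalFromTo_iff (hT : IsParallelohedralTiling P T) {C C' : Set (Euc d)} (hC : C ∈ T)
    (hC' : C' ∈ T) (hadj : AdjacentCells C C') {n : Euc d} :
    IsNormalFromTo C C' n ↔ IsFacetNormal C (C ∩ C') n := by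
  constructor
  · exact fun h => ⟨h.1, h.2.1, fun f hf y hy => h.2.2 y hy f hf.2⟩
  · intro h
    refine ⟨h.norm_eq, h.orth, fun x hx y hy => ?_⟩
    obtain ⟨f, hf⟩ := hadj.1.2.1
    have h1 := (hT.normal_neg hC hC' hadj h).le f hf y hy
    rw [inner_neg_left, inner_neg_left] at h1
    linarith [h.le f hf x hx]

/-- At such a point each cell is locally one of the two opposite half spaces bounded by the facet.
-/
theorem eventually_mem_union (hT : IsParallelohedralTiling P T) {C C' : Set (Euc d)} (hC : C ∈ T)
    (hC' : C' ∈ T) (hadj : AdjacentCells C C') {m : Euc d} (hm : m ∈ C ∩ C')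
    (hmg : AvoidsCodim T 2 m) : ∀ᶠ y in 𝓝 m, y ∈ C ∪ C' := by
  obtain ⟨n, hn, -⟩ := hadj.1.exists_normal (hT.polytope_of_mem hC).2
  have e1 := (hT.polytope_of_mem hC).eventually_mem_of_inner_le hm.1
    (fun F' hF' hmF' => hT.facet_unique_of_avoids hC hmg hF' hadj.1 hmF' hm) hadj.1 hn
  have e2 := (hT.polytope_of_mem hC').eventually_mem_of_inner_le hm.2
    (fun F' hF' hmF' => hT.facet_unique_of_avoids hC' hmg hF' hadj.2 hmF' hm) hadj.2
    (hT.normal_neg hC hC' hadj hn)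
  filter_upwards [e1, e2] with y h1 h2
  rcases le_total ⟪n, y⟫ ⟪n, m⟫ with h | h
  · exact Or.inl (h1 h)
  · refine Or.inr (h2 ?_)
    rw [inner_neg_left, inner_neg_left]
    linarith

/-- The interior of `D` accumulates at `m`, so it meets one of the two cells covering a
neighbourhood of `m`. -/
theorem eq_or_eq_of_eventually (hT : IsParallelohedralTiling P T) {C C' D : Set (Euc d)}
    (hC : C ∈ T) (hC' : C' ∈ T) (hD : D ∈ T) {m : Euc d} (h : ∀ᶠ y in 𝓝 m, y ∈ C ∪ C')
    (hm : m ∈ D) : D = C ∨ D = C' := by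
  rw [← (hT.polytope_of_mem hD).closure_interior] at hm
  obtain ⟨y, hy1, hy2⟩ := mem_closure_iff_nhds.1 hm _ h
  rcases hy1 with hy1 | hy1
  · exact Or.inl (hT.eq_of_mem_interior hD hC hy2 hy1)
  · exact Or.inr (hT.eq_of_mem_interior hD hC' hy2 hy1)

/-- Take a generic point of the facet. If no second cell contained it, nearby points would be
covered by `C` alone and it would be interior to `C`. -/
theorem exists_adjacent (hT : IsParallelohedralTiling P T) {C F : Set (Euc d)}
    (hC : C ∈ T) (hF : IsFaceOfCodim 1 C F) :
    ∃ C' ∈ T, AdjacentCells C C' ∧ C ∩ C' = F := by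
  obtain ⟨m, hmF, hmg⟩ := hT.exists_avoids_of_facet hC hF
  have hi := (hT.polytope_of_mem hC).2
  have hmC := hF.1.subset hmF
  have hnint : m ∉ interior C := by
    intro h
    obtain ⟨n, hn, -⟩ := hF.exists_normal hi
    exact lt_irrefl _ (hn.lt hmF h)
  obtain ⟨C', hC', hne, hmC'⟩ : ∃ C' ∈ T, C ≠ C' ∧ m ∈ C' := by
    by_contra! hcon
    refine hnint (mem_interior_iff_mem_nhds.2 ?_)
    filter_upwards [hT.eventually_cells_subset m] with y hy
    obtain ⟨D, hD, hyD⟩ := hT.cover y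
    by_contra hyC
    refine hcon D hD ?_ (hy D hD hyD)
    rintro rfl
    exact hyC hyD
  have hadj := hT.adjacent_of_avoids hC hC' hne hmg hmC hmC'
  exact ⟨C', hC', hadj, hT.facet_unique_of_avoids hC hmg hadj.1 hF ⟨hmC, hmC'⟩ hmF⟩

/-! ### Connectivity -/

theorem avoidsCodim_lineMap {k : ℕ} {x y : Euc d} (hx : AvoidsCodim T k x)
    (hy : ∀ E ∈ codimFaces T k, y ∉ affineSpan ℝ (insert x E)) (t : ℝ) :
    AvoidsCodim T k (AffineMap.lineMap x y t) := by
  rw [avoidsCodim_iff] at hx ⊢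
  intro E hE hmem
  obtain rfl := eq_zero_of_lineMap_mem (hy E hE) hmem
  rw [AffineMap.lineMap_apply_zero] at hmem
  exact hx E hE hmem

/-- Two cells meeting an open convex set are joined by a chain of cells, any two successive cells
sharing a facet which meets that set. -/
theorem reflTransGen_adjacent (hT : IsParallelohedralTiling P T) {B : Set (Euc d)}
    (hB : IsOpen B) (hBc : Convex ℝ B) {C D : Set (Euc d)} (hC : C ∈ T) (hD : D ∈ T)
    (hCB : (C ∩ B).Nonempty) (hDB : (D ∩ B).Nonempty) :
    Relation.ReflTransGen (fun C C' => C ∈ T ∧ C' ∈ T ∧ AdjacentCells C C' ∧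
      (C ∩ C' ∩ B).Nonempty) C D := by
  have hint : ∀ C ∈ T, (C ∩ B).Nonempty → (interior C ∩ B).Nonempty := by
    rintro C hC ⟨x, hx, hxB⟩
    rw [← (hT.polytope_of_mem hC).closure_interior] at hx
    obtain ⟨y, hy, hy'⟩ := mem_closure_iff.1 hx B hB hxB
    exact ⟨y, hy', hy⟩
  obtain ⟨x, hxC, hxB⟩ := hint C hC hCB
  -- The endpoint is chosen so that the whole segment misses the faces of codimension at least 2;
  -- then any two cells sharing a point of it are equal or adjacent.
  obtain ⟨y, ⟨hyD, hyB⟩, hy⟩ := exists_mem_open_forall_notMem_affineSpan (isOpen_interior.inter hB) (hint D hD hDB)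
    ((fun E => insert x E) '' codimFaces T 2) ((hT.countable_codimFaces 2).image _) (by
      rintro _ ⟨E, hE, rfl⟩
      have h1 := finrank_vectorSpan_insert_le_set ℝ E x
      have h2 := hE.1
      show Module.finrank ℝ (vectorSpan ℝ (insert x E)) < d
      omega)
  have hline := avoidsCodim_lineMap (hT.avoidsCodim_of_mem_interior hC hxC one_le_two)
    (fun E hE => hy _ ⟨E, hE, rfl⟩)
  have hgen : ∀ z ∈ segment ℝ x y, AvoidsCodim T 2 z := by
    intro z hz
    rw [segment_eq_image_lineMap] at hz
    obtain ⟨t, -, rfl⟩ := hz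
    exact hline t
  set r : Set (Euc d) → Set (Euc d) → Prop := fun C C' => C ∈ T ∧ C' ∈ T ∧ AdjacentCells C C' ∧
      (C ∩ C' ∩ B).Nonempty with hr
  have hrsymm : Std.Symm r := by
    constructor
    rintro A A' ⟨h1, h2, h3, h4⟩
    refine ⟨h2, h1, h3.symm, ?_⟩
    rwa [inter_comm A' A]
  -- Cells through a point near `p` also contain `p`, so one adjacency step suffices locally, and
  -- connectedness of the segment makes this global.
  have key := (convex_segment x y).isPreconnected.induction₂
    (fun p q => ∀ A ∈ T, ∀ A' ∈ T, p ∈ A → q ∈ A' → Relation.ReflTransGen r A A')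
    (by
      intro p hp
      filter_upwards [nhdsWithin_le_nhds (hT.eventually_cells_subset p)] with q hq A hA A' hA'
        hpA hqA'
      have hpA' := hq A' hA' hqA'
      by_cases hne : A = A'
      · rw [hne]
      · exact Relation.ReflTransGen.single ⟨hA, hA', hT.adjacent_of_avoids hA hA' hne (hgen p hp)
          hpA hpA', p, ⟨hpA, hpA'⟩, hBc.segment_subset hxB hyB hp⟩)
    (by
      intro p q u _ _ _ h1 h2 A hA A' hA' hp hu
      obtain ⟨A'', hA'', hq⟩ := hT.cover q
      exact (h1 A hA A'' hA'' hp hq).trans (h2 A'' hA'' A' hA' hq hu))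
    (by
      intro p q _ _ h A hA A' hA' hq hp
      exact Relation.ReflTransGen.stdSymm.symm _ _ (h A' hA' A hA hp hq))
    (left_mem_segment ℝ x y) (right_mem_segment ℝ x y)
  exact key C hC D hD (interior_subset hxC) (interior_subset hyD)

end IsParallelohedralTiling

/-! ### Jumps of the affine functions across facets -/

open Classical in
/-- The outward unit normal of `C` along its facet `C ∩ C'`. -/
noncomputable def facetNormal {d : ℕ} (C C' : Set (Euc d)) : Euc d :=
  if h : ∃ n, IsFacetNormal C (C ∩ C') n then h.choose else 0

open Classical in
/-- The affine function `y ↦ s(F) ⟪n, y - f⟫`, `f ∈ F = C ∩ C'`, as a pair (gradient, constant). -/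
noncomputable def jump {d : ℕ} (s : Set (Euc d) → ℝ) (C C' : Set (Euc d)) : Euc d × ℝ :=
  (s (C ∩ C') • facetNormal C C',
    -⟪s (C ∩ C') • facetNormal C C', if h : (C ∩ C').Nonempty then h.some else 0⟫)

/-- `u` assigns affine functions to the cells with the prescribed jumps at the facets through
`x`. -/
def IsSolutionAt {d : ℕ} (T : Set (Set (Euc d))) (s : Set (Euc d) → ℝ) (x : Euc d)
    (u : Set (Euc d) → Euc d × ℝ) : Prop :=
  ∀ C ∈ T, ∀ C' ∈ T, x ∈ C → x ∈ C' → AdjacentCells C C' → u C' - u C = jump s C C'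

theorem IsSolutionAt.sub_const {d : ℕ} {T : Set (Set (Euc d))} {s : Set (Euc d) → ℝ} {x : Euc d}
    {u : Set (Euc d) → Euc d × ℝ} (h : IsSolutionAt T s x u) (k : Euc d × ℝ) :
    IsSolutionAt T s x fun C => u C - k := by
  intro C hC C' hC' hx hx' hadj
  rw [← h C hC C' hC' hx hx' hadj]
  exact sub_sub_sub_cancel_right _ _ _

/-! ### Uniqueness of solutions and their integration to a global one -/

namespace IsParallelohedralTiling
variable {d : ℕ} {P : Set (Euc d)} {T : Set (Set (Euc d))} {s : Set (Euc d) → ℝ}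

theorem facetNormal_spec (hT : IsParallelohedralTiling P T) {C C' : Set (Euc d)} (hC : C ∈ T)
    (hadj : AdjacentCells C C') : IsFacetNormal C (C ∩ C') (facetNormal C C') := by
  have h : ∃ n, IsFacetNormal C (C ∩ C') n := by
    obtain ⟨n, hn, -⟩ := hadj.1.exists_normal (hT.polytope_of_mem hC).2
    exact ⟨n, hn⟩
  rw [facetNormal, dif_pos h]
  exact h.choose_spec

theorem jump_snd (hT : IsParallelohedralTiling P T) {C C' : Set (Euc d)} (hC : C ∈ T)
    (hadj : AdjacentCells C C') {x : Euc d} (hx : x ∈ C ∩ C') :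
    (jump s C C').2 = -⟪s (C ∩ C') • facetNormal C C', x⟫ := by
  have h : (C ∩ C').Nonempty := ⟨x, hx⟩
  rw [jump, dif_pos h, real_inner_smul_left, real_inner_smul_left,
    mem_orthogonal_vectorSpan.1 (hT.facetNormal_spec hC hadj).orth _ h.some_mem _ hx]

/-- In a ball whose cells all contain `x`, any two cells are joined by facet-adjacent ones, and a
difference of two solutions does not change across a facet. -/
theorem isSolutionAt_unique (hT : IsParallelohedralTiling P T) {x : Euc d}
    {u u' : Set (Euc d) → Euc d × ℝ} (hu : IsSolutionAt T s x u) (hu' : IsSolutionAt T s x u')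
    {C D : Set (Euc d)} (hC : C ∈ T) (hD : D ∈ T) (hxC : x ∈ C) (hxD : x ∈ D) :
    u C - u' C = u D - u' D := by
  obtain ⟨r, hr, hball⟩ := Metric.eventually_nhds_iff_ball.1 (hT.eventually_cells_subset x)
  have hch := hT.reflTransGen_adjacent Metric.isOpen_ball (convex_ball x r) hC hD
    ⟨x, hxC, Metric.mem_ball_self hr⟩ ⟨x, hxD, Metric.mem_ball_self hr⟩
  induction hch using Relation.ReflTransGen.head_induction_on with
  | refl => rfl
  | @head A A' h _ ih =>
    obtain ⟨hA, hA', hadj, y, ⟨hyA, hyA'⟩, hyB⟩ := h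
    have hxA := hball y hyB A hA hyA
    have hxA' := hball y hyB A' hA' hyA'
    rw [← ih hA' hxA']
    have h1 := hu A hA A' hA' hxA hxA' hadj
    have h2 := hu' A hA A' hA' hxA hxA' hadj
    rw [← h2] at h1
    have h3 : u A - u' A = u A' - u' A' - ((u A' - u A) - (u' A' - u' A)) := by abel
    rw [h3, h1, sub_self, sub_zero]

theorem isSolutionAt_unique_on (hT : IsParallelohedralTiling P T) {K : Set (Euc d)}
    (hK : Convex ℝ K) {u u' : Set (Euc d) → Euc d × ℝ} (hu : ∀ x ∈ K, IsSolutionAt T s x u)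
    (hu' : ∀ x ∈ K, IsSolutionAt T s x u') {C D : Set (Euc d)} (hC : C ∈ T) (hD : D ∈ T)
    {x y : Euc d} (hx : x ∈ K) (hy : y ∈ K) (hxC : x ∈ C) (hyD : y ∈ D) :
    u C - u' C = u D - u' D := by
  refine hK.isPreconnected.induction₂
    (fun p q => ∀ A ∈ T, ∀ A' ∈ T, p ∈ A → q ∈ A' → u A - u' A = u A' - u' A') ?_ ?_ ?_ hx hy
    C hC D hD hxC hyD
  · intro p hp
    filter_upwards [nhdsWithin_le_nhds (hT.eventually_cells_subset p)] with q hq A hA A' hA'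
      hpA hqA'
    exact hT.isSolutionAt_unique (hu p hp) (hu' p hp) hA hA' hpA (hq A' hA' hqA')
  · intro p q r _ _ _ h1 h2 A hA A' hA' hp hr
    obtain ⟨A'', hA'', hq⟩ := hT.cover q
    exact (h1 A hA A'' hA'' hp hq).trans (h2 A'' hA'' A' hA' hq hr)
  · intro p q _ _ h A hA A' hA' hq hp
    exact (h A' hA' A hA hp hq).symm

/-- Local solutions along an affinely parametrized plane patch together. -/
theorem exists_solution_on_plane (hT : IsParallelohedralTiling P T)
    (σ : (ℝ × ℝ) →ᵃ[ℝ] Euc d) (hσ : ∀ p, ∃ u, IsSolutionAt T s (σ p) u) :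
    ∃ w, ∀ p, IsSolutionAt T s (σ p) w := by
  classical
  choose u hu using hσ
  choose D hD hσD using fun p => hT.cover (σ p)
  have hcont : Continuous σ := AffineMap.continuous_of_finiteDimensional σ
  have hnear : ∀ p, ∀ᶠ q in 𝓝 p, ∀ C ∈ T, σ q ∈ C → σ p ∈ C := fun p =>
    hcont.continuousAt.eventually (hT.eventually_cells_subset (σ p))
  have hsub : ∀ p q, (∀ C ∈ T, σ q ∈ C → σ p ∈ C) → IsSolutionAt T s (σ q) (u p) := by
    intro p q h C hC C' hC' hq hq' hadj
    exact hu p C hC C' hC' (h C hC hq) (h C' hC' hq') hadj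
  -- The cocycle measures the constant by which the local solutions at `p` and `q` differ; by
  -- uniqueness it can be read off at any cell common to both, here `D q`. The primitive `h` removes
  -- the discrepancy.
  obtain ⟨h, hh⟩ := exists_primitive_of_cocycle (fun p q => u p (D q) - u q (D q)) (by
    intro p
    filter_upwards [hnear p] with q hq
    filter_upwards [hnear q] with r hr
    rw [hT.isSolutionAt_unique (hsub p q hq) (hu q) (hD q) (hD r) (hσD q) (hr _ (hD r) (hσD r))]
    abel)
  -- The corrected value on a cell is locally constant along its preimage, which is convex and hence
  -- connected.
  have hconst : ∀ C ∈ T, ∀ p q, σ p ∈ C → σ q ∈ C → u p C + h p = u q C + h q := by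
    intro C hC p q hp hq
    have hconv : Convex ℝ (σ ⁻¹' C) := (hT.polytope_of_mem hC).convex.affine_preimage σ
    refine hconv.isPreconnected.induction₂ (fun p q => u p C + h p = u q C + h q) ?_
      (fun _ _ _ _ _ _ h1 h2 => h1.trans h2) (fun _ _ _ _ h1 => h1.symm) hp hq
    intro p hp
    filter_upwards [nhdsWithin_le_nhds (hnear p), nhdsWithin_le_nhds (hh p), self_mem_nhdsWithin]
      with q h1 h2 h3
    rw [h2, hT.isSolutionAt_unique (hsub p q h1) (hu q) (hD q) hC (hσD q) h3]
    abel
  refine ⟨fun C => if hC : ∃ p, σ p ∈ C then u hC.choose C + h hC.choose else 0, ?_⟩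
  intro p C hC C' hC' hp hp' hadj
  have e1 : ∃ p, σ p ∈ C := ⟨p, hp⟩
  have e2 : ∃ p, σ p ∈ C' := ⟨p, hp'⟩
  simp only [dif_pos e1, dif_pos e2]
  rw [hconst C hC _ p e1.choose_spec hp, hconst C' hC' _ p e2.choose_spec hp',
    ← hu p C hC C' hC' hp hp' hadj]
  abel

/-- By the genericity of `y` and `z` the plane through `x₀`, `y`, `z` misses all faces of
codimension at least 3, so local solutions exist along it and patch. Normalization at `P` makes
solutions on different planes comparable. -/
theorem exists_solution_on_generic_plane (hT : IsParallelohedralTiling P T)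
    (hloc : ∀ x, AvoidsCodim T 3 x → ∃ u, IsSolutionAt T s x u) {x₀ y z : Euc d}
    (hx₀ : x₀ ∈ interior P) (hy : ∀ E ∈ codimFaces T 3, y ∉ affineSpan ℝ (insert x₀ E))
    (hz : ∀ E ∈ codimFaces T 3, z ∉ affineSpan ℝ (insert y (insert x₀ E))) :
    ∃ w, w P = 0 ∧ ∀ a b : ℝ, IsSolutionAt T s (x₀ + a • (y - x₀) + b • (z - x₀)) w := by
  set σ : (ℝ × ℝ) →ᵃ[ℝ] Euc d := ((LinearMap.fst ℝ ℝ ℝ).smulRight (y - x₀) +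
    (LinearMap.snd ℝ ℝ ℝ).smulRight (z - x₀)).toAffineMap + AffineMap.const ℝ (ℝ × ℝ) x₀ with hσ
  have hσ' : ∀ a b : ℝ, σ (a, b) = x₀ + a • (y - x₀) + b • (z - x₀) := by
    intro a b
    simp only [hσ, AffineMap.coe_add, LinearMap.coe_toAffineMap, AffineMap.coe_const, Pi.add_apply,
      LinearMap.add_apply, LinearMap.smulRight_apply, LinearMap.fst_apply, LinearMap.snd_apply,
      Function.const_apply]
    abel
  have hav : ∀ p, AvoidsCodim T 3 (σ p) := by
    rintro ⟨a, b⟩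
    rw [hσ']
    by_cases hb : b = 0
    · have := avoidsCodim_lineMap (hT.avoidsCodim_of_mem_interior hT.self_mem hx₀
        (by norm_num : 1 ≤ 3)) hy a
      rw [AffineMap.lineMap_apply_module', add_comm] at this
      simpa [hb] using this
    -- For $b\ne0$ the equation of the point can be solved for `z`, contradicting the genericity of
    -- `z`.
    · rw [avoidsCodim_iff]
      intro E hE hmem
      apply hz E hE
      have m0 : x₀ ∈ affineSpan ℝ (insert y (insert x₀ E)) :=
        mem_affineSpan ℝ (mem_insert_of_mem _ (mem_insert _ _))
      have m1 : y ∈ affineSpan ℝ (insert y (insert x₀ E)) := mem_affineSpan ℝ (mem_insert _ _)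
      have m2 := mem_affineSpan ℝ (mem_insert_of_mem y (mem_insert_of_mem x₀ hmem))
      have m3 := AffineSubspace.smul_vsub_vadd_mem _ b⁻¹ m2 m0 m0
      have m4 := AffineSubspace.smul_vsub_vadd_mem _ (-(b⁻¹ * a)) m1 m0 m3
      convert m4 using 1
      simp only [vsub_eq_sub, vadd_eq_add, add_sub_cancel_left, add_assoc, smul_add, smul_smul,
        inv_mul_cancel₀ hb, neg_smul, one_smul]
      abel
  obtain ⟨w, hw⟩ := hT.exists_solution_on_plane σ fun p => hloc _ (hav p)
  refine ⟨fun C => w C - w P, sub_self _, fun a b => ?_⟩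
  rw [← hσ']
  exact (hw _).sub_const _

/-- The value at `C` is transported from `P` along the segment from `x₀` to a generic point `y C` of
its interior. For adjacent cells, choose generic `z`, `z'` on the two sides of a facet point and
compare along the planes `(x₀, y C, z)`, `(x₀, z, z')`, `(x₀, y C', z')`; consecutive planes share a
segment from `x₀`, where normalized solutions agree. -/
theorem exists_global_solution (hT : IsParallelohedralTiling P T)
    (hloc : ∀ x, AvoidsCodim T 3 x → ∃ u, IsSolutionAt T s x u) :
    ∃ u : Set (Euc d) → Euc d × ℝ, u P = 0 ∧
      ∀ C ∈ T, ∀ C' ∈ T, AdjacentCells C C' → u C' - u C = jump s C C' := by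
  obtain ⟨x₀, hx₀⟩ := hT.polytope.2
  have hx₀P := interior_subset hx₀
  -- Two reference points are allowed because `z'` below must be generic relative to both `z` and `y
  -- C'`.
  have hgood : ∀ V : Set (Euc d), IsOpen V → V.Nonempty → ∀ y y' : Euc d, ∃ z ∈ V,
      (∀ E ∈ codimFaces T 3, z ∉ affineSpan ℝ (insert y (insert x₀ E))) ∧
      (∀ E ∈ codimFaces T 3, z ∉ affineSpan ℝ (insert y' (insert x₀ E))) := by
    intro V hV hne y y'
    have hdim : ∀ y, ∀ E ∈ codimFaces T 3,
        Module.finrank ℝ (vectorSpan ℝ (insert y (insert x₀ E))) < d := by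
      intro y E hE
      have h1 := finrank_vectorSpan_insert_le_set ℝ E x₀
      have h2 := finrank_vectorSpan_insert_le_set ℝ (insert x₀ E) y
      have h3 := hE.1
      omega
    obtain ⟨z, hz, h⟩ := exists_mem_open_forall_notMem_affineSpan hV hne
      (((fun E => insert y (insert x₀ E)) '' codimFaces T 3) ∪
        ((fun E => insert y' (insert x₀ E)) '' codimFaces T 3))
      (((hT.countable_codimFaces 3).image _).union ((hT.countable_codimFaces 3).image _)) (by
        rintro _ (⟨E, hE, rfl⟩ | ⟨E, hE, rfl⟩)
        · exact hdim y E hE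
        · exact hdim y' E hE)
    exact ⟨z, hz, fun E hE => h _ (Or.inl ⟨E, hE, rfl⟩), fun E hE => h _ (Or.inr ⟨E, hE, rfl⟩)⟩
  have hweak : ∀ y z : Euc d, (∀ E ∈ codimFaces T 3, z ∉ affineSpan ℝ (insert y (insert x₀ E))) →
      ∀ E ∈ codimFaces T 3, z ∉ affineSpan ℝ (insert x₀ E) := fun y z h E hE hmem =>
    h E hE (affineSpan_mono ℝ (subset_insert _ _) hmem)
  have hseg : ∀ {y : Euc d} {w : Set (Euc d) → Euc d × ℝ},
      (∀ a : ℝ, IsSolutionAt T s (x₀ + a • (y - x₀)) w) →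
        ∀ x ∈ segment ℝ x₀ y, IsSolutionAt T s x w := by
    intro y w h x hx
    rw [segment_eq_image'] at hx
    obtain ⟨a, -, rfl⟩ := hx
    exact h a
  have hseg₁ : ∀ {y z : Euc d} {w : Set (Euc d) → Euc d × ℝ},
      (∀ a b : ℝ, IsSolutionAt T s (x₀ + a • (y - x₀) + b • (z - x₀)) w) →
        ∀ x ∈ segment ℝ x₀ y, IsSolutionAt T s x w :=
    fun h => hseg fun a => by simpa using h a 0
  have hseg₂ : ∀ {y z : Euc d} {w : Set (Euc d) → Euc d × ℝ},
      (∀ a b : ℝ, IsSolutionAt T s (x₀ + a • (y - x₀) + b • (z - x₀)) w) →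
        ∀ x ∈ segment ℝ x₀ z, IsSolutionAt T s x w :=
    fun h => hseg fun a => by simpa using h 0 a
  have hun : ∀ {y : Euc d} {w w' : Set (Euc d) → Euc d × ℝ} {C : Set (Euc d)}, C ∈ T → y ∈ C →
      w P = 0 → w' P = 0 → (∀ x ∈ segment ℝ x₀ y, IsSolutionAt T s x w) →
      (∀ x ∈ segment ℝ x₀ y, IsSolutionAt T s x w') → w C = w' C := by
    intro y w w' C hC hy h0 h0' hw hw'
    have := hT.isSolutionAt_unique_on (convex_segment x₀ y) hw hw' hT.self_mem hC
      (left_mem_segment ℝ x₀ y) (right_mem_segment ℝ x₀ y) hx₀P hy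
    rw [h0, h0', sub_self] at this
    exact (sub_eq_zero.1 this.symm)
  -- The value `k` depends only on the segment from `x₀` to `y`, not on the plane used to produce a
  -- solution along it.
  have hex : ∀ C : Set (Euc d), ∃ (y : Euc d) (k : Euc d × ℝ), C ∈ T → y ∈ interior C ∧
      (∀ E ∈ codimFaces T 3, y ∉ affineSpan ℝ (insert x₀ E)) ∧
      ∀ w : Set (Euc d) → Euc d × ℝ, w P = 0 → (∀ x ∈ segment ℝ x₀ y, IsSolutionAt T s x w) →
        w C = k := by
    intro C
    by_cases hC : C ∈ T
    swap
    · exact ⟨0, 0, fun h => absurd h hC⟩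
    obtain ⟨y, hyC, hy, -⟩ := hgood _ isOpen_interior (hT.polytope_of_mem hC).2 x₀ x₀
    have hy := hweak x₀ y hy
    obtain ⟨z, -, hz, -⟩ := hgood univ isOpen_univ univ_nonempty y y
    obtain ⟨w, hw0, hw⟩ := hT.exists_solution_on_generic_plane hloc hx₀ hy hz
    exact ⟨y, w C, fun _ => ⟨hyC, hy, fun w' hw'0 hw' =>
      hun hC (interior_subset hyC) hw'0 hw0 hw' (hseg₁ hw)⟩⟩
  choose y u hyu using hex
  refine ⟨u, ?_, ?_⟩
  · obtain ⟨hyP, hy, huP⟩ := hyu P hT.self_mem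
    obtain ⟨z, -, hz, -⟩ := hgood univ isOpen_univ univ_nonempty (y P) (y P)
    obtain ⟨w, hw0, hw⟩ := hT.exists_solution_on_generic_plane hloc hx₀ hy hz
    rw [← huP w hw0 (hseg₁ hw), hw0]
  intro C hC C' hC' hadj
  obtain ⟨hyC, hyg, hu⟩ := hyu C hC
  obtain ⟨hyC', hyg', hu'⟩ := hyu C' hC'
  obtain ⟨m, hm, hmg⟩ := hT.exists_avoids_of_facet hC hadj.1
  obtain ⟨r, hr, hball⟩ := Metric.eventually_nhds_iff_ball.1
    (hT.eventually_mem_union hC hC' hadj hm hmg)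
  have hmeet : ∀ A ∈ T, m ∈ A → (interior A ∩ Metric.ball m r).Nonempty := by
    intro A hA hmA
    rw [← (hT.polytope_of_mem hA).closure_interior] at hmA
    obtain ⟨q, hq, hq'⟩ := mem_closure_iff.1 hmA _ Metric.isOpen_ball (Metric.mem_ball_self hr)
    exact ⟨q, hq', hq⟩
  obtain ⟨z, ⟨hzC, hzB⟩, hz, -⟩ := hgood _ (isOpen_interior.inter Metric.isOpen_ball)
    (hmeet C hC hm.1) (y C) (y C)
  obtain ⟨z', ⟨hzC', hzB'⟩, hz', hz''⟩ := hgood _ (isOpen_interior.inter Metric.isOpen_ball)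
    (hmeet C' hC' hm.2) z (y C')
  obtain ⟨w₁, h10, h1⟩ := hT.exists_solution_on_generic_plane hloc hx₀ hyg hz
  obtain ⟨w₂, h20, h2⟩ := hT.exists_solution_on_generic_plane hloc hx₀ (hweak _ _ hz) hz'
  obtain ⟨w₃, h30, h3⟩ := hT.exists_solution_on_generic_plane hloc hx₀ hyg' hz''
  rw [← hu w₁ h10 (hseg₁ h1), ← hu' w₃ h30 (hseg₁ h3),
    hun hC (interior_subset hzC) h10 h20 (hseg₂ h1) (hseg₁ h2),
    hun hC' (interior_subset hzC') h30 h20 (hseg₂ h3) (hseg₂ h2)]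
  -- The segment from `z` to `z'` stays in the two cells, so it crosses their common facet at a
  -- point `q` of the middle plane, where the jump condition can be read off.
  obtain ⟨q, hqs, hqC, hqC'⟩ := isPreconnected_closed_iff.1 (convex_segment z z').isPreconnected
    C C' (hT.polytope_of_mem hC).isClosed (hT.polytope_of_mem hC').isClosed
    (fun x hx => hball x ((convex_ball m r).segment_subset hzB hzB' hx))
    ⟨z, left_mem_segment ℝ z z', interior_subset hzC⟩
    ⟨z', right_mem_segment ℝ z z', interior_subset hzC'⟩
  refine (?_ : IsSolutionAt T s q w₂) C hC C' hC' hqC hqC' hadj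
  obtain ⟨a, b, -, -, hab, rfl⟩ := hqs
  convert h2 a b using 1
  rw [← eq_sub_iff_add_eq] at hab
  subst hab
  simp only [sub_smul, smul_sub, one_smul]
  abel

end IsParallelohedralTiling

/-! ### Local solutions at facet points -/

namespace IsParallelohedralTiling
variable {d : ℕ} {P : Set (Euc d)} {T : Set (Set (Euc d))} {s : Set (Euc d) → ℝ}

theorem facetNormal_symm (hT : IsParallelohedralTiling P T) {C C' : Set (Euc d)} (hC : C ∈ T)
    (hC' : C' ∈ T) (hadj : AdjacentCells C C') : facetNormal C' C = -facetNormal C C' := by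
  have h1 := hT.normal_neg hC hC' hadj (hT.facetNormal_spec hC hadj)
  have h2 := hT.facetNormal_spec hC' hadj.symm
  rw [inter_comm] at h2
  exact h1.eq (hT.polytope_of_mem hC').2 hadj.2 h2

theorem jump_symm (hT : IsParallelohedralTiling P T) {C C' : Set (Euc d)} (hC : C ∈ T)
    (hC' : C' ∈ T) (hadj : AdjacentCells C C') : jump s C' C = -jump s C C' := by
  obtain ⟨x, hx⟩ := hadj.1.2.1
  refine Prod.ext ?_ ?_
  · simp [jump, hT.facetNormal_symm hC hC' hadj, inter_comm C' C]
  · rw [Prod.snd_neg, hT.jump_snd hC hadj hx, hT.jump_snd hC' hadj.symm ⟨hx.2, hx.1⟩,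
      hT.facetNormal_symm hC hC' hadj, inter_comm C' C, smul_neg, inner_neg_left]

/-- When two adjacent cells meet at `x`, they are the only cells there, so prescribing one jump is
enough; otherwise the condition is empty. -/
theorem exists_isSolutionAt_of_avoids_two (hT : IsParallelohedralTiling P T) {x : Euc d}
    (hx : AvoidsCodim T 2 x) : ∃ u, IsSolutionAt T s x u := by
  classical
  by_cases h : ∃ C₁ ∈ T, ∃ C₂ ∈ T, x ∈ C₁ ∧ x ∈ C₂ ∧ AdjacentCells C₁ C₂
  swap
  · exact ⟨0, fun C hC C' hC' hx hx' hadj => absurd ⟨C, hC, C', hC', hx, hx', hadj⟩ h⟩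
  obtain ⟨C₁, h₁, C₂, h₂, hx₁, hx₂, hadj⟩ := h
  have hne := hT.ne_of_adjacent h₁ hadj
  have hcells : ∀ D ∈ T, x ∈ D → D = C₁ ∨ D = C₂ := fun D hD hxD =>
    hT.eq_or_eq_of_eventually h₁ h₂ hD (hT.eventually_mem_union h₁ h₂ hadj ⟨hx₁, hx₂⟩ hx) hxD
  refine ⟨fun C => if C = C₂ then jump s C₁ C₂ else 0, ?_⟩
  intro C hC C' hC' hxC hxC' hadj'
  have hne' := hT.ne_of_adjacent hC hadj'
  rcases hcells C hC hxC with rfl | rfl <;> rcases hcells C' hC' hxC' with rfl | rfl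
  · exact absurd rfl hne'
  · simp [hne]
  · simp [hne, hT.jump_symm h₁ h₂ hadj]
  · exact absurd rfl hne'

end IsParallelohedralTiling

/-! ### The plane orthogonal to a ridge -/

/-- `b₀, b₁` is an orthonormal basis of the plane `W`. -/
structure IsPlaneFrame {d : ℕ} (W : Submodule ℝ (Euc d)) (b₀ b₁ : Euc d) : Prop where
  mem₀ : b₀ ∈ W
  mem₁ : b₁ ∈ W
  norm₀ : ⟪b₀, b₀⟫ = 1
  norm₁ : ⟪b₁, b₁⟫ = 1
  orth : ⟪b₀, b₁⟫ = 0
  expand : ∀ v ∈ W, v = ⟪b₀, v⟫ • b₀ + ⟪b₁, v⟫ • b₁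

/-- The quarter turn of the plane with orthonormal basis `b₀, b₁`. -/
noncomputable def frameTurn {d : ℕ} (b₀ b₁ : Euc d) : Euc d →ₗ[ℝ] Euc d :=
  (innerSL ℝ b₀).toLinearMap.smulRight b₁ - (innerSL ℝ b₁).toLinearMap.smulRight b₀

theorem frameTurn_apply {d : ℕ} (b₀ b₁ v : Euc d) :
    frameTurn b₀ b₁ v = ⟪b₀, v⟫ • b₁ - ⟪b₁, v⟫ • b₀ := by
  simp [frameTurn]

theorem inner_frameTurn {d : ℕ} (b₀ b₁ v w : Euc d) :
    ⟪frameTurn b₀ b₁ v, w⟫ = ⟪b₀, v⟫ * ⟪b₁, w⟫ - ⟪b₁, v⟫ * ⟪b₀, w⟫ := by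
  rw [frameTurn_apply, inner_sub_left, real_inner_smul_left, real_inner_smul_left]

theorem exists_isPlaneFrame {d : ℕ} (W : Submodule ℝ (Euc d)) (hW : Module.finrank ℝ W = 2) :
    ∃ b₀ b₁, IsPlaneFrame W b₀ b₁ := by
  let b := (stdOrthonormalBasis ℝ W).reindex (finCongr hW)
  refine ⟨b 0, b 1, (b 0).2, (b 1).2, ?_, ?_, ?_, ?_⟩
  · rw [← Submodule.coe_inner, real_inner_self_eq_norm_sq, b.orthonormal.1 0, one_pow]
  · rw [← Submodule.coe_inner, real_inner_self_eq_norm_sq, b.orthonormal.1 1, one_pow]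
  · rw [← Submodule.coe_inner]
    exact b.orthonormal.2 (by decide)
  · intro v hv
    have h := b.sum_repr' ⟨v, hv⟩
    rw [Fin.sum_univ_two] at h
    have h' := congrArg Subtype.val h
    simpa [Submodule.coe_inner] using h'.symm

namespace IsPlaneFrame
variable {d : ℕ} {W : Submodule ℝ (Euc d)} {b₀ b₁ : Euc d}

theorem inner_eq (h : IsPlaneFrame W b₀ b₁) {v : Euc d} (hv : v ∈ W) (w : Euc d) :
    ⟪v, w⟫ = ⟪b₀, v⟫ * ⟪b₀, w⟫ + ⟪b₁, v⟫ * ⟪b₁, w⟫ := by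
  conv_lhs => rw [h.expand v hv]
  rw [inner_add_left, real_inner_smul_left, real_inner_smul_left]

theorem turn_mem (h : IsPlaneFrame W b₀ b₁) (v : Euc d) : frameTurn b₀ b₁ v ∈ W := by
  rw [frameTurn_apply]
  exact W.sub_mem (W.smul_mem _ h.mem₁) (W.smul_mem _ h.mem₀)

theorem inner_turn₀ (h : IsPlaneFrame W b₀ b₁) (v : Euc d) :
    ⟪b₀, frameTurn b₀ b₁ v⟫ = -⟪b₁, v⟫ := by
  rw [frameTurn_apply, inner_sub_right, inner_smul_right, inner_smul_right, h.orth, h.norm₀]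
  ring

theorem inner_turn₁ (h : IsPlaneFrame W b₀ b₁) (v : Euc d) :
    ⟪b₁, frameTurn b₀ b₁ v⟫ = ⟪b₀, v⟫ := by
  rw [frameTurn_apply, inner_sub_right, inner_smul_right, inner_smul_right, h.norm₁,
    real_inner_comm b₀ b₁, h.orth]
  ring

theorem isQuarterTurn (h : IsPlaneFrame W b₀ b₁) : IsQuarterTurn W (frameTurn b₀ b₁) := by
  refine ⟨fun x _ => h.turn_mem x, fun x hx => ?_, fun x _ => ?_⟩
  · rw [← sq_eq_sq₀ (norm_nonneg _) (norm_nonneg _), ← real_inner_self_eq_norm_sq,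
      ← real_inner_self_eq_norm_sq, h.inner_eq hx, inner_frameTurn, h.inner_turn₀, h.inner_turn₁]
    ring
  · rw [inner_frameTurn]; ring

theorem sq_add_sq (h : IsPlaneFrame W b₀ b₁) {e : Euc d} (he : e ∈ W) (he1 : ‖e‖ = 1) :
    ⟪b₀, e⟫ * ⟪b₀, e⟫ + ⟪b₁, e⟫ * ⟪b₁, e⟫ = 1 := by
  rw [← h.inner_eq he, real_inner_self_eq_norm_sq, he1, one_pow]

theorem ext (h : IsPlaneFrame W b₀ b₁) {v w : Euc d} (hv : v ∈ W) (hw : w ∈ W)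
    (h0 : ⟪b₀, v⟫ = ⟪b₀, w⟫) (h1 : ⟪b₁, v⟫ = ⟪b₁, w⟫) : v = w := by
  rw [h.expand v hv, h.expand w hw, h0, h1]

theorem inner_turn_self (h : IsPlaneFrame W b₀ b₁) {e : Euc d} (he : e ∈ W) (he1 : ‖e‖ = 1) :
    ⟪frameTurn b₀ b₁ e, frameTurn b₀ b₁ e⟫ = 1 := by
  rw [inner_frameTurn, h.inner_turn₀, h.inner_turn₁, ← h.sq_add_sq he he1]
  ring

/-- In a plane the unit vectors orthogonal to `e` are the two quarter turns of `e`. It identifies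
facet normals with turned inward directions. -/
theorem eq_turn_or (h : IsPlaneFrame W b₀ b₁) {e n : Euc d} (he : e ∈ W) (he1 : ‖e‖ = 1)
    (hn : n ∈ W) (hn1 : ‖n‖ = 1) (hen : ⟪n, e⟫ = 0) :
    n = frameTurn b₀ b₁ e ∨ n = -frameTurn b₀ b₁ e := by
  have h1 := h.sq_add_sq he he1
  have h2 := h.sq_add_sq hn hn1
  rw [h.inner_eq hn] at hen
  set p := ⟪b₀, e⟫ with hp
  set q := ⟪b₁, e⟫ with hq
  set a := ⟪b₀, n⟫ with ha
  set b := ⟪b₁, n⟫ with hb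
  -- The number `b * p - a * q` is the inner product of `n` with the turned vector, whose
  -- coordinates are `(-q, p)`; its square turns out to be 1.
  have ea : a = -q * (b * p - a * q) := by linear_combination (-a) * h1 + p * hen
  have eb : b = p * (b * p - a * q) := by linear_combination (-b) * h1 + q * hen
  have hc : (b * p - a * q) ^ 2 = 1 := by
    linear_combination (a * a + b * b) * h1 + h2 - (a * p + b * q) * hen
  rcases eq_or_eq_neg_of_sq_eq_sq _ 1 (hc.trans (one_pow 2).symm) with hc | hc
  · left
    refine h.ext hn (h.turn_mem e) ?_ ?_
    · rw [h.inner_turn₀, ← ha, ea, hc, mul_one]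
    · rw [h.inner_turn₁, ← hb, eb, hc, mul_one]
  · right
    refine h.ext hn (W.neg_mem (h.turn_mem e)) ?_ ?_
    · rw [inner_neg_right, h.inner_turn₀, ← ha, ea, hc]; ring
    · rw [inner_neg_right, h.inner_turn₁, ← hb, eb, hc]; ring

/-- The projection of `v` to the plane has no component along the turned vector, so it is a multiple
of `e`. -/
theorem sub_smul_mem (h : IsPlaneFrame W b₀ b₁) {e v : Euc d} (he : e ∈ W) (he1 : ‖e‖ = 1)
    (hv : ⟪frameTurn b₀ b₁ e, v⟫ = 0) : v - ⟪e, v⟫ • e ∈ Wᗮ := by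
  have h1 := h.sq_add_sq he he1
  rw [inner_frameTurn] at hv
  have e0 : ⟪b₀, v - ⟪e, v⟫ • e⟫ = 0 := by
    rw [inner_sub_right, inner_smul_right, h.inner_eq he]
    linear_combination (-⟪b₀, v⟫) * h1 - ⟪b₁, e⟫ * hv
  have e1 : ⟪b₁, v - ⟪e, v⟫ • e⟫ = 0 := by
    rw [inner_sub_right, inner_smul_right, h.inner_eq he]
    linear_combination (-⟪b₁, v⟫) * h1 + ⟪b₀, e⟫ * hv
  rw [Submodule.mem_orthogonal]
  intro w hw
  rw [h.inner_eq hw, e0, e1]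
  ring

end IsPlaneFrame

/-! ### The star of a ridge -/

theorem Convex.exists_add_smul_add_mem {d : ℕ} {K : Set (Euc d)} (hK : Convex ℝ K) {x v w : Euc d}
    (hv : ∃ δ : ℝ, 0 < δ ∧ x + δ • v ∈ K) (hw : ∃ δ : ℝ, 0 < δ ∧ x + δ • w ∈ K) :
    ∃ δ : ℝ, 0 < δ ∧ x + δ • (v + w) ∈ K := by
  obtain ⟨a, ha, hv⟩ := hv
  obtain ⟨b, hb, hw⟩ := hw
  have hab : 0 < a + b := by positivity
  -- Weights `b / (a + b)` and `a / (a + b)` on `x + a • v` and `x + b • w` give both directions the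
  -- same length.
  refine ⟨a * b / (a + b), by positivity, ?_⟩
  have := hK hv hw (a := b / (a + b)) (b := a / (a + b)) (by positivity) (by positivity)
    (by field_simp; ring)
  convert this using 1
  have h1 : x = (b / (a + b)) • x + (a / (a + b)) • x := by
    rw [← add_smul, ← add_div, add_comm b a, div_self hab.ne', one_smul]
  rw [smul_add, smul_add, smul_add, smul_smul, smul_smul]
  nth_rewrite 1 [h1]
  rw [show a * b / (a + b) = b / (a + b) * a by ring]
  nth_rewrite 2 [show b / (a + b) * a = a / (a + b) * b by ring]
  abel

theorem exists_add_smul_smul_mem {d : ℕ} {K : Set (Euc d)} {x v : Euc d} {c : ℝ} (hc : 0 < c)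
    (hv : ∃ δ : ℝ, 0 < δ ∧ x + δ • v ∈ K) : ∃ δ : ℝ, 0 < δ ∧ x + δ • (c • v) ∈ K := by
  obtain ⟨a, ha, hv⟩ := hv
  exact ⟨a / c, by positivity, by rwa [smul_smul, div_mul_cancel₀ _ hc.ne']⟩

/-- Directions pointing from `x` into `G` form a convex cone, and at a relative interior point the
cone is closed under negation. The induction therefore carries `v` and `-v` together. -/
theorem Convex.exists_add_smul_mem_of_mem_vectorSpan {d : ℕ} {G : Set (Euc d)} (hG : Convex ℝ G)
    {x : Euc d} (hx : x ∈ G) (hri : ∀ y ∈ G, ∃ ε : ℝ, 0 < ε ∧ x + ε • (x - y) ∈ G) {v : Euc d}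
    (hv : v ∈ vectorSpan ℝ G) : ∃ δ : ℝ, 0 < δ ∧ x + δ • v ∈ G := by
  rw [vectorSpan_eq_span_vsub_set_right ℝ hx] at hv
  suffices h : (∃ δ : ℝ, 0 < δ ∧ x + δ • v ∈ G) ∧ ∃ δ : ℝ, 0 < δ ∧ x + δ • (-v) ∈ G from h.1
  induction hv using Submodule.span_induction with
  | mem u hu =>
    obtain ⟨y, hy, rfl⟩ := hu
    refine ⟨⟨1, one_pos, by simpa using hy⟩, ?_⟩
    simpa using hri y hy
  | zero => exact ⟨⟨1, one_pos, by simpa using hx⟩, ⟨1, one_pos, by simpa using hx⟩⟩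
  | add u v _ _ hu hv =>
    refine ⟨hG.exists_add_smul_add_mem hu.1 hv.1, ?_⟩
    rw [neg_add]
    exact hG.exists_add_smul_add_mem hu.2 hv.2
  | smul a u _ hu =>
    rcases lt_trichotomy a 0 with ha | rfl | ha
    · have ha' : 0 < -a := by linarith
      refine ⟨?_, ?_⟩
      · simpa using exists_add_smul_smul_mem ha' hu.2
      · simpa using exists_add_smul_smul_mem ha' hu.1
    · exact ⟨⟨1, one_pos, by simpa using hx⟩, ⟨1, one_pos, by simpa using hx⟩⟩
    · refine ⟨exists_add_smul_smul_mem ha hu.1, ?_⟩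
      rw [← smul_neg]
      exact exists_add_smul_smul_mem ha hu.2

/-- The cells of `T` around the ridge `G`, seen from the point `x` in the relative interior of `G`:
`S` is the set of the facets through `x` and `e F` is the direction of the facet `F`. -/
structure IsRidgeStar {d : ℕ} (T : Set (Set (Euc d))) (x : Euc d) (G : Set (Euc d)) (b₀ b₁ : Euc d)
    (S : Finset (Set (Euc d))) (e : Set (Euc d) → Euc d) : Prop where
  frame : IsPlaneFrame (vectorSpan ℝ G)ᗮ b₀ b₁
  convex : Convex ℝ G
  mem : x ∈ G
  relint : ∀ y ∈ G, ∃ ε : ℝ, 0 < ε ∧ x + ε • (x - y) ∈ G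
  disjoint : ∀ C ∈ T, Disjoint G (interior C)
  mem_iff : ∀ F, F ∈ S ↔ F ∈ tilingFaces 1 T ∧ x ∈ F
  subset : ∀ F ∈ S, G ⊆ F
  dir : ∀ F ∈ S, IsInwardDirection G F (e F)

namespace IsRidgeStar
variable {d : ℕ} {P : Set (Euc d)} {T : Set (Set (Euc d))} {x : Euc d} {G : Set (Euc d)}
  {b₀ b₁ : Euc d} {S : Finset (Set (Euc d))} {e : Set (Euc d) → Euc d}

theorem exists_cell (h : IsRidgeStar T x G b₀ b₁ S e) {F : Set (Euc d)} (hF : F ∈ S) :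
    ∃ C ∈ T, IsFaceOfCodim 1 C F := ((h.mem_iff F).1 hF).1

/-- The normal of `F` is a unit vector of the plane orthogonal to `e F`, so the turned vector is
that normal up to sign. -/
theorem turn_orth (hT : IsParallelohedralTiling P T) (h : IsRidgeStar T x G b₀ b₁ S e)
    {F : Set (Euc d)} (hF : F ∈ S) {v : Euc d} (hv : v ∈ vectorSpan ℝ F) :
    ⟪frameTurn b₀ b₁ (e F), v⟫ = 0 := by
  obtain ⟨C, hC, hFC⟩ := h.exists_cell hF
  obtain ⟨n, hn, -⟩ := hFC.exists_normal (hT.polytope_of_mem hC).2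
  obtain ⟨he1, heG, heF, -⟩ := h.dir F hF
  have hnG : n ∈ (vectorSpan ℝ G)ᗮ :=
    Submodule.orthogonal_le (vectorSpan_mono ℝ (h.subset F hF)) hn.orth
  have hnv := (Submodule.mem_orthogonal' _ _).1 hn.orth
  rcases h.frame.eq_turn_or heG he1 hnG hn.norm_eq (hnv _ heF) with h1 | h1
  · rw [← h1]; exact hnv v hv
  · rw [← neg_eq_zero, ← inner_neg_left, ← h1]; exact hnv v hv

theorem sub_smul_mem (h : IsRidgeStar T x G b₀ b₁ S e) {F : Set (Euc d)} (hF : F ∈ S)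
    {v : Euc d} (hv : ⟪frameTurn b₀ b₁ (e F), v⟫ = 0) :
    v - ⟪e F, v⟫ • e F ∈ vectorSpan ℝ G := by
  have := h.frame.sub_smul_mem (h.dir F hF).2.1 (h.dir F hF).1 hv
  rwa [Submodule.orthogonal_orthogonal] at this

/-- Otherwise `e F` would be orthogonal to the direction space of `F`, to which it belongs. -/
theorem exists_pos (h : IsRidgeStar T x G b₀ b₁ S e) {F : Set (Euc d)} (hF : F ∈ S) :
    ∃ f ∈ F, 0 < ⟪e F, f - x⟫ := by
  by_contra! hcon
  obtain ⟨he1, heG, heF, hle⟩ := h.dir F hF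
  have h0 : ∀ f ∈ F, ⟪e F, f⟫ = ⟪e F, x⟫ := by
    intro f hf
    have := le_antisymm (hcon f hf) (hle x h.mem f hf)
    rwa [inner_sub_right, sub_eq_zero] at this
  have h1 : e F ∈ (vectorSpan ℝ F)ᗮ :=
    mem_orthogonal_vectorSpan.2 fun a ha b hb => (h0 a ha).trans (h0 b hb).symm
  have h2 := (Submodule.mem_orthogonal' _ _).1 h1 _ heF
  rw [real_inner_self_eq_norm_sq, he1] at h2
  norm_num at h2

/-- A vector lying, modulo the directions of the ridge, on the ray of the facet `F`, points from
`x` into `F`. -/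
theorem exists_add_smul_mem (hT : IsParallelohedralTiling P T)
    (h : IsRidgeStar T x G b₀ b₁ S e) {F : Set (Euc d)} (hF : F ∈ S) {w : Euc d}
    (hw : ⟪frameTurn b₀ b₁ (e F), w⟫ = 0) (hpos : 0 < ⟪e F, w⟫) :
    ∃ t : ℝ, 0 < t ∧ t ≤ 1 ∧ x + t • w ∈ F := by
  obtain ⟨f, hf, hκ⟩ := h.exists_pos hF
  obtain ⟨C, hC, hFC⟩ := h.exists_cell hF
  have hconv : Convex ℝ F := hFC.1.convex (hT.polytope_of_mem hC).convex
  have hxF := ((h.mem_iff F).1 hF).2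
  have hv := h.turn_orth hT hF (vsub_mem_vectorSpan ℝ hf hxF)
  rw [vsub_eq_sub] at hv
  have h1 := h.sub_smul_mem hF hv
  have h2 := h.sub_smul_mem hF hw
  set κ := ⟪e F, f - x⟫ with hκdef
  set μ := ⟪e F, w⟫ with hμdef
  -- Subtracting the multiple of `f - x` with the same `e F`-component leaves a ridge direction,
  -- along which one can move inside `G`.
  have h3 := Submodule.sub_mem _ h2 (Submodule.smul_mem _ (μ / κ) h1)
  obtain ⟨δ, hδ, hδF⟩ := h.convex.exists_add_smul_mem_of_mem_vectorSpan h.mem h.relint h3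
  have h4 : ∃ δ : ℝ, 0 < δ ∧ x + δ • ((μ / κ) • (f - x)) ∈ F :=
    exists_add_smul_smul_mem (div_pos hpos hκ) ⟨1, one_pos, by simpa using hf⟩
  obtain ⟨t, ht, htF⟩ := hconv.exists_add_smul_add_mem h4 ⟨δ, hδ, h.subset F hF hδF⟩
  have h5 : (μ / κ) • (f - x) + (w - μ • e F - (μ / κ) • (f - x - κ • e F)) = w := by
    rw [smul_sub (μ / κ) (f - x), smul_smul, div_mul_cancel₀ _ hκ.ne']
    abel
  rw [h5] at htF
  refine ⟨min t 1, lt_min ht one_pos, min_le_right _ _, ?_⟩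
  have h6 : x + min t 1 • w = AffineMap.lineMap x (x + t • w) (min t 1 / t) := by
    rw [AffineMap.lineMap_apply_module', add_sub_cancel_left, smul_smul, div_mul_cancel₀ _ ht.ne',
      add_comm]
  rw [h6]
  refine hconv.lineMap_mem hxF htF ⟨by positivity, ?_⟩
  rw [div_le_one ht]
  exact min_le_left _ _

theorem add_smul_mem_interior (hT : IsParallelohedralTiling P T) {C : Set (Euc d)} (hC : C ∈ T)
    (hx : x ∈ C) {y : Euc d} (hy : y ∈ interior C) {t : ℝ} (ht : 0 < t) (ht1 : t ≤ 1) :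
    x + t • (y - x) ∈ interior C :=
  (hT.polytope_of_mem hC).convex.add_smul_sub_mem_interior hx hy ⟨ht, ht1⟩

/-- If `y - x` lay on the ray of `F` modulo the ridge, a point between `x` and `y` would be interior
to `C` and lie on `F`, or on `G` when the ray component vanishes. -/
theorem not_mem_ray (hT : IsParallelohedralTiling P T)
    (h : IsRidgeStar T x G b₀ b₁ S e) {F : Set (Euc d)} (hF : F ∈ S) {C : Set (Euc d)}
    (hC : C ∈ T) (hx : x ∈ C) {y : Euc d} (hy : y ∈ interior C)
    (hw : ⟪frameTurn b₀ b₁ (e F), y - x⟫ = 0) : ⟪e F, y - x⟫ < 0 := by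
  by_contra! hge
  rcases hge.eq_or_lt with h0 | hpos
  · have h1 := h.sub_smul_mem hF hw
    rw [← h0, zero_smul, sub_zero] at h1
    obtain ⟨δ, hδ, hδG⟩ := h.convex.exists_add_smul_mem_of_mem_vectorSpan h.mem h.relint h1
    have h2 : x + min δ 1 • (y - x) = AffineMap.lineMap x (x + δ • (y - x)) (min δ 1 / δ) := by
      rw [AffineMap.lineMap_apply_module', add_sub_cancel_left, smul_smul,
        div_mul_cancel₀ _ hδ.ne', add_comm]
    refine Set.disjoint_left.1 (h.disjoint C hC) (?_ : x + min δ 1 • (y - x) ∈ G)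
      (add_smul_mem_interior hT hC hx hy (lt_min hδ one_pos) (min_le_right _ _))
    rw [h2]
    refine h.convex.lineMap_mem h.mem hδG ⟨by positivity, ?_⟩
    rw [div_le_one hδ]
    exact min_le_left _ _
  · obtain ⟨t, ht, ht1, htF⟩ := h.exists_add_smul_mem hT hF hw hpos
    have hint := add_smul_mem_interior hT hC hx hy ht ht1
    obtain ⟨C', hC', hFC'⟩ := h.exists_cell hF
    obtain rfl := hT.eq_of_mem_interior hC hC' hint (hFC'.1.subset htF)
    obtain ⟨n, hn, -⟩ := hFC'.exists_normal (hT.polytope_of_mem hC).2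
    exact lt_irrefl _ (hn.lt htF hint)

end IsRidgeStar

theorem Convex.pos_iff_pos_of_ne_zero {E : Type*} [AddCommGroup E] [Module ℝ E]
    [TopologicalSpace E] [ContinuousAdd E] [ContinuousSMul ℝ E] {K : Set E} (hK : Convex ℝ K)
    {f : E → ℝ} (hf : Continuous f) (h0 : ∀ y ∈ K, f y ≠ 0) {y y' : E} (hy : y ∈ K)
    (hy' : y' ∈ K) : 0 < f y ↔ 0 < f y' := by
  have key : ∀ y ∈ K, ∀ y' ∈ K, 0 < f y → 0 < f y' := by
    intro y hy y' hy' hpos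
    by_contra! hle
    obtain ⟨z, hz, hz0⟩ := hK.isPreconnected.intermediate_value hy' hy hf.continuousOn
      ⟨hle, hpos.le⟩
    exact h0 z hz hz0
  exact ⟨key y hy y' hy', key y' hy' y hy⟩

/-! ### Summing the jumps while turning around a ridge -/

namespace IsRidgeStar
variable {d : ℕ} {P : Set (Euc d)} {T : Set (Set (Euc d))} {x : Euc d} {G : Set (Euc d)}
  {b₀ b₁ : Euc d} {S : Finset (Set (Euc d))} {e : Set (Euc d) → Euc d}

/-- The plane is not covered by the finitely many lines spanned by the facet directions; `w₀` serves
as the starting direction for turning. -/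
theorem exists_generic_dir (h : IsRidgeStar T x G b₀ b₁ S e) : ∃ w₀ ∈ (vectorSpan ℝ G)ᗮ,
    ∀ F ∈ S, ⟪frameTurn b₀ b₁ (e F), w₀⟫ ≠ 0 := by
  obtain ⟨w, hw, hwS⟩ := ((vectorSpan ℝ G)ᗮ.convex).exists_forall_notMem_affineSubspace
    ⟨0, Submodule.zero_mem _⟩ S
    (fun F => ((Submodule.span ℝ {frameTurn b₀ b₁ (e F)})ᗮ).toAffineSubspace) (by
      intro F hF hsub
      have h1 : frameTurn b₀ b₁ (e F) ∈ (Submodule.span ℝ {frameTurn b₀ b₁ (e F)})ᗮ :=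
        hsub (h.frame.turn_mem _)
      have h2 := Submodule.mem_orthogonal_singleton_iff_inner_right.1 h1
      rw [h.frame.inner_turn_self (h.dir F hF).2.1 (h.dir F hF).1] at h2
      exact one_ne_zero h2)
  refine ⟨w, hw, fun F hF h0 => hwS F hF ?_⟩
  exact Submodule.mem_orthogonal_singleton_iff_inner_right.2 h0

/-- Gradient of the local solution on the half plane to the left of `w₀`. -/
noncomputable def leftGrad (s : Set (Euc d) → ℝ) (x b₀ b₁ : Euc d) (S : Finset (Set (Euc d)))
    (e : Set (Euc d) → Euc d) (w₀ y : Euc d) : Euc d :=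
  -- The first condition selects the facet rays to the left of `w₀`; the second, those already
  -- passed when turning from `w₀` in the positive sense to `y - x`.
  open Classical in ∑ F ∈ S, if ⟪frameTurn b₀ b₁ (e F), w₀⟫ < 0 ∧
    0 < ⟪frameTurn b₀ b₁ (e F), y - x⟫ then s F • frameTurn b₀ b₁ (e F) else 0

/-- Gradient of the local solution on the half plane to the right of `w₀`. -/
noncomputable def rightGrad (s : Set (Euc d) → ℝ) (x b₀ b₁ : Euc d) (S : Finset (Set (Euc d)))
    (e : Set (Euc d) → Euc d) (w₀ y : Euc d) : Euc d :=
  -- The mirror image: rays to the right of `w₀` are passed in the negative sense, so their jumps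
  -- enter with a minus sign.
  open Classical in -∑ F ∈ S, if 0 < ⟪frameTurn b₀ b₁ (e F), w₀⟫ ∧
    0 < -⟪frameTurn b₀ b₁ (e F), y - x⟫ then s F • frameTurn b₀ b₁ (e F) else 0

open Classical in
/-- Gradient of the local solution in the direction `y - x`. -/
noncomputable def starGrad (s : Set (Euc d) → ℝ) (x b₀ b₁ : Euc d) (S : Finset (Set (Euc d)))
    (e : Set (Euc d) → Euc d) (w₀ y : Euc d) : Euc d :=
  if 0 < ⟪frameTurn b₀ b₁ w₀, y - x⟫ then leftGrad s x b₀ b₁ S e w₀ y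
  else rightGrad s x b₀ b₁ S e w₀ y

/-- Modulo the ridge `v` is the multiple `⟪e F, v⟫` of `e F`, and the quarter turn is antisymmetric.
This decides on which side of `w₀` the vector lies. -/
theorem inner_turn_mul (h : IsRidgeStar T x G b₀ b₁ S e) {F : Set (Euc d)} (hF : F ∈ S)
    (w₀ : Euc d) {v : Euc d} (hv : ⟪frameTurn b₀ b₁ (e F), v⟫ = 0) :
    ⟪frameTurn b₀ b₁ w₀, v⟫ = -(⟪e F, v⟫ * ⟪frameTurn b₀ b₁ (e F), w₀⟫) := by
  have h1 := h.frame.sq_add_sq (h.dir F hF).2.1 (h.dir F hF).1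
  rw [h.frame.inner_eq (h.dir F hF).2.1]
  rw [inner_frameTurn] at hv ⊢
  rw [inner_frameTurn]
  linear_combination (-(⟪b₀, w₀⟫ * ⟪b₁, v⟫ - ⟪b₁, w₀⟫ * ⟪b₀, v⟫)) * h1 +
    (⟪b₀, w₀⟫ * ⟪b₀, e F⟫ + ⟪b₁, w₀⟫ * ⟪b₁, e F⟫) * hv

end IsRidgeStar

namespace IsRidgeStar
variable {d : ℕ} {P : Set (Euc d)} {T : Set (Set (Euc d))} {x : Euc d} {G : Set (Euc d)}
  {b₀ b₁ : Euc d} {S : Finset (Set (Euc d))} {e : Set (Euc d) → Euc d} {w₀ : Euc d}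
  {s : Set (Euc d) → ℝ}

theorem leftGrad_congr (hT : IsParallelohedralTiling P T) (h : IsRidgeStar T x G b₀ b₁ S e)
    {C : Set (Euc d)} (hC : C ∈ T) (hx : x ∈ C) {y y' : Euc d} (hy : y ∈ interior C)
    (hy' : y' ∈ interior C) (hL : 0 ≤ ⟪frameTurn b₀ b₁ w₀, y - x⟫)
    (hL' : 0 ≤ ⟪frameTurn b₀ b₁ w₀, y' - x⟫) :
    leftGrad s x b₀ b₁ S e w₀ y = leftGrad s x b₀ b₁ S e w₀ y' := by
  unfold leftGrad
  refine Finset.sum_congr rfl fun F hF => ?_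
  by_cases ha : ⟪frameTurn b₀ b₁ (e F), w₀⟫ < 0
  swap
  · simp [ha]
  have hconv : Convex ℝ (interior C ∩ {y | 0 ≤ ⟪frameTurn b₀ b₁ w₀, y - x⟫}) := by
    refine (hT.polytope_of_mem hC).convex.interior.inter ?_
    simp only [inner_sub_right, sub_nonneg]
    exact convex_halfSpace_ge (innerSL ℝ (frameTurn b₀ b₁ w₀)).toLinearMap.isLinear _
  -- A sign change would put an interior point on the line of `F`, hence on the ray opposite to `F`.
  -- For the facets counted here that ray is to the right of `w₀`.
  have := hconv.pos_iff_pos_of_ne_zero (f := fun y => ⟪frameTurn b₀ b₁ (e F), y - x⟫)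
    (by fun_prop) (by
      rintro z ⟨hz, hzL⟩ hz0
      have h1 := h.not_mem_ray hT hF hC hx hz hz0
      have h2 := h.inner_turn_mul hF w₀ hz0
      have h3 : 0 ≤ ⟪frameTurn b₀ b₁ w₀, z - x⟫ := hzL
      nlinarith) ⟨hy, hL⟩ ⟨hy', hL'⟩
  simp only [ha, this]

theorem rightGrad_congr (hT : IsParallelohedralTiling P T) (h : IsRidgeStar T x G b₀ b₁ S e)
    {C : Set (Euc d)} (hC : C ∈ T) (hx : x ∈ C) {y y' : Euc d} (hy : y ∈ interior C)
    (hy' : y' ∈ interior C) (hL : ⟪frameTurn b₀ b₁ w₀, y - x⟫ ≤ 0)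
    (hL' : ⟪frameTurn b₀ b₁ w₀, y' - x⟫ ≤ 0) :
    rightGrad s x b₀ b₁ S e w₀ y = rightGrad s x b₀ b₁ S e w₀ y' := by
  unfold rightGrad
  refine congrArg _ (Finset.sum_congr rfl fun F hF => ?_)
  by_cases ha : 0 < ⟪frameTurn b₀ b₁ (e F), w₀⟫
  swap
  · simp [ha]
  have hconv : Convex ℝ (interior C ∩ {y | ⟪frameTurn b₀ b₁ w₀, y - x⟫ ≤ 0}) := by
    refine (hT.polytope_of_mem hC).convex.interior.inter ?_
    simp only [inner_sub_right, sub_nonpos]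
    exact convex_halfSpace_le (innerSL ℝ (frameTurn b₀ b₁ w₀)).toLinearMap.isLinear _
  have := hconv.pos_iff_pos_of_ne_zero (f := fun y => -⟪frameTurn b₀ b₁ (e F), y - x⟫)
    (by fun_prop) (by
      rintro z ⟨hz, hzL⟩ hz0
      have hz0 := neg_eq_zero.1 hz0
      have h1 := h.not_mem_ray hT hF hC hx hz hz0
      have h2 := h.inner_turn_mul hF w₀ hz0
      have h3 : ⟪frameTurn b₀ b₁ w₀, z - x⟫ ≤ 0 := hzL
      nlinarith) ⟨hy, hL⟩ ⟨hy', hL'⟩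
  simp only [ha, this]

/-- On the line through `w₀` both formulas agree, by vanishing of the torsion. -/
theorem leftGrad_eq_rightGrad (h : IsRidgeStar T x G b₀ b₁ S e)
    (hw₀ : w₀ ∈ (vectorSpan ℝ G)ᗮ) (hgen : ∀ F ∈ S, ⟪frameTurn b₀ b₁ (e F), w₀⟫ ≠ 0)
    (htor : ∑ F ∈ S, s F • frameTurn b₀ b₁ (e F) = 0) {y : Euc d}
    (hy : ⟪frameTurn b₀ b₁ w₀, y - x⟫ = 0) :
    leftGrad s x b₀ b₁ S e w₀ y = rightGrad s x b₀ b₁ S e w₀ y := by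
  -- The projection of `y - x` to the plane is $\mu w_0$.
  obtain ⟨μ, hμ⟩ : ∃ μ : ℝ, ∀ F ∈ S, ⟪frameTurn b₀ b₁ (e F), y - x⟫ =
      μ * ⟪frameTurn b₀ b₁ (e F), w₀⟫ := by
    set c := ⟪b₀, w₀⟫ * ⟪b₀, w₀⟫ + ⟪b₁, w₀⟫ * ⟪b₁, w₀⟫ with hc
    by_cases hc0 : c = 0
    · refine ⟨0, fun F hF => absurd ?_ (hgen F hF)⟩
      have h0 : w₀ = 0 := by
        rw [← inner_self_eq_zero (𝕜 := ℝ), h.frame.inner_eq hw₀, ← hc, hc0]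
      rw [h0, inner_zero_right]
    · refine ⟨(⟪b₀, w₀⟫ * ⟪b₀, y - x⟫ + ⟪b₁, w₀⟫ * ⟪b₁, y - x⟫) / c, fun F hF => ?_⟩
      rw [div_mul_eq_mul_div, eq_div_iff hc0, hc, inner_frameTurn, inner_frameTurn]
      rw [inner_frameTurn] at hy
      linear_combination (⟪b₀, e F⟫ * ⟪b₀, w₀⟫ + ⟪b₁, e F⟫ * ⟪b₁, w₀⟫) * hy
  unfold leftGrad rightGrad
  rw [eq_neg_iff_add_eq_zero, ← Finset.sum_add_distrib]
  -- For negative `μ` the two half turns together pass every facet once, and the sum is the torsion;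
  -- for nonnegative `μ` no facet is counted.
  rcases lt_or_ge μ 0 with hneg | hpos
  · refine (Finset.sum_congr rfl fun F hF => ?_).trans htor
    rw [hμ F hF]
    rcases (hgen F hF).lt_or_gt with ha | ha
    · simp [ha, not_lt.2 ha.le, mul_pos_of_neg_of_neg hneg ha]
    · simp [ha, not_lt.2 ha.le, mul_neg_of_neg_of_pos hneg ha]
  · refine Finset.sum_eq_zero fun F hF => ?_
    rw [hμ F hF]
    rcases (hgen F hF).lt_or_gt with ha | ha
    · simp [ha, not_lt.2 ha.le, not_lt.2 (mul_nonpos_of_nonneg_of_nonpos hpos ha.le)]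
    · simp [ha, not_lt.2 ha.le, not_lt.2 (mul_nonneg hpos ha.le)]

/-- A cell reaching both sides of the line of `w₀` has by connectedness an interior point over that
line, where the two formulas agree. -/
theorem starGrad_congr (hT : IsParallelohedralTiling P T) (h : IsRidgeStar T x G b₀ b₁ S e)
    (hw₀ : w₀ ∈ (vectorSpan ℝ G)ᗮ) (hgen : ∀ F ∈ S, ⟪frameTurn b₀ b₁ (e F), w₀⟫ ≠ 0)
    (htor : ∑ F ∈ S, s F • frameTurn b₀ b₁ (e F) = 0)
    {C : Set (Euc d)} (hC : C ∈ T) (hx : x ∈ C) {y y' : Euc d} (hy : y ∈ interior C)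
    (hy' : y' ∈ interior C) :
    starGrad s x b₀ b₁ S e w₀ y = starGrad s x b₀ b₁ S e w₀ y' := by
  have key : ∀ y ∈ interior C, ∀ y' ∈ interior C, 0 < ⟪frameTurn b₀ b₁ w₀, y - x⟫ →
      ⟪frameTurn b₀ b₁ w₀, y' - x⟫ ≤ 0 →
      leftGrad s x b₀ b₁ S e w₀ y = rightGrad s x b₀ b₁ S e w₀ y' := by
    intro y hy y' hy' hL hL'
    have hc : Continuous fun y : Euc d => ⟪frameTurn b₀ b₁ w₀, y - x⟫ := by fun_prop
    obtain ⟨z, hz, hz0⟩ := (hT.polytope_of_mem hC).convex.interior.isPreconnected.intermediate_value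
      hy' hy hc.continuousOn ⟨hL', hL.le⟩
    have hz0 : ⟪frameTurn b₀ b₁ w₀, z - x⟫ = 0 := hz0
    rw [h.leftGrad_congr hT hC hx hy hz hL.le hz0.ge, h.leftGrad_eq_rightGrad hw₀ hgen htor hz0,
      h.rightGrad_congr hT hC hx hz hy' hz0.le hL']
  unfold starGrad
  split_ifs with h1 h2 h2
  · exact h.leftGrad_congr hT hC hx hy hy' h1.le h2.le
  · exact key y hy y' hy' h1 (not_lt.1 h2)
  · exact (key y' hy' y hy h2 (not_lt.1 h1)).symm
  · exact h.rightGrad_congr hT hC hx hy hy' (not_lt.1 h1) (not_lt.1 h2)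

end IsRidgeStar

/-! ### Crossing a facet at a relative interior point -/

namespace IsParallelohedralTiling
variable {d : ℕ} {P : Set (Euc d)} {T : Set (Set (Euc d))} {s : Set (Euc d) → ℝ}

/-- A point with a neighbourhood covered by two adjacent cells lies in the relative interior of
their common facet. -/
theorem relint_of_eventually (hT : IsParallelohedralTiling P T) {C C' : Set (Euc d)} (hC : C ∈ T)
    (hC' : C' ∈ T) (hadj : AdjacentCells C C') {m : Euc d} (hm : m ∈ C ∩ C')
    (hev : ∀ᶠ y in 𝓝 m, y ∈ C ∪ C') {f : Euc d} (hf : f ∈ C ∩ C') :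
    ∃ ε : ℝ, 0 < ε ∧ m + ε • (m - f) ∈ C ∩ C' := by
  have hn := hT.facetNormal_spec hC hadj
  have hn' := hT.normal_neg hC hC' hadj hn
  have h1 : Tendsto (fun ε : ℝ => m + ε • (m - f)) (𝓝[>] 0) (𝓝 m) := by
    have : Continuous fun ε : ℝ => m + ε • (m - f) := by fun_prop
    simpa using (this.tendsto 0).mono_left nhdsWithin_le_nhds
  obtain ⟨ε, h2, h3⟩ := ((h1.eventually hev).and self_mem_nhdsWithin).exists
  have h4 : ⟪facetNormal C C', m + ε • (m - f)⟫ = ⟪facetNormal C C', m⟫ := by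
    rw [inner_add_right, inner_smul_right, inner_sub_right,
      mem_orthogonal_vectorSpan.1 hn.orth f hf m hm]
    ring
  refine ⟨ε, h3, ?_⟩
  rcases h2 with h2 | h2
  · exact (hn.mem_iff (hT.polytope_of_mem hC).2 hadj.1 hm h2).2 h4
  · exact (hn'.mem_iff (hT.polytope_of_mem hC').2 hadj.2 hm h2).2
      (by rw [inner_neg_left, inner_neg_left, h4])

/-- Moving from a relative interior point of a common facet along the normal one enters the
interiors of the two cells. -/
theorem eventually_mem_interior (hT : IsParallelohedralTiling P T) {C C' : Set (Euc d)}
    (hC : C ∈ T) (hC' : C' ∈ T) (hadj : AdjacentCells C C') {m : Euc d} (hm : m ∈ C ∩ C')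
    (hev : ∀ᶠ y in 𝓝 m, y ∈ C ∪ C') :
    ∀ᶠ ε : ℝ in 𝓝[>] 0, m - ε • facetNormal C C' ∈ interior C := by
  have hn := hT.facetNormal_spec hC hadj
  have hn' := hT.normal_neg hC hC' hadj hn
  have h1 : Tendsto (fun ε : ℝ => m - ε • facetNormal C C') (𝓝[>] 0) (𝓝 m) := by
    have : Continuous fun ε : ℝ => m - ε • facetNormal C C' := by fun_prop
    simpa using (this.tendsto 0).mono_left nhdsWithin_le_nhds
  filter_upwards [h1.eventually (eventually_eventually_nhds.2 hev), self_mem_nhdsWithin]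
    with ε h2 h3
  have h3 : 0 < ε := h3
  have h4 : ⟪facetNormal C C', m - ε • facetNormal C C'⟫ < ⟪facetNormal C C', m⟫ := by
    rw [inner_sub_right, inner_smul_right, real_inner_self_eq_norm_sq, hn.norm_eq]
    linarith
  have hc : Continuous fun y : Euc d => ⟪facetNormal C C', y⟫ := by fun_prop
  rw [mem_interior_iff_mem_nhds]
  filter_upwards [h2, hc.continuousAt.eventually (gt_mem_nhds h4)] with z hz hz'
  rcases hz with hz | hz
  · exact hz
  · have := hn'.le m hm z hz
    rw [inner_neg_left, inner_neg_left] at this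
    linarith

end IsParallelohedralTiling

namespace IsRidgeStar
variable {d : ℕ} {P : Set (Euc d)} {T : Set (Set (Euc d))} {x : Euc d} {G : Set (Euc d)}
  {b₀ b₁ : Euc d} {S : Finset (Set (Euc d))} {e : Set (Euc d) → Euc d} {w₀ : Euc d}
  {s : Set (Euc d) → ℝ}

/-- Contracting towards `x` moves `m` to a point of `F` while a neighbourhood stays covered by `C ∪
C'`. The cell having `F` as a facet is then `C` or `C'`, and extremality at a relative interior
point puts the common facet inside `F`. -/
theorem eq_of_dir_eq (hT : IsParallelohedralTiling P T) (h : IsRidgeStar T x G b₀ b₁ S e)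
    {C C' F : Set (Euc d)} (hC : C ∈ T) (hC' : C' ∈ T) (hadj : AdjacentCells C C')
    (hx : x ∈ C ∩ C') (hF : F ∈ S) {m : Euc d} (hm : m ∈ C ∩ C')
    (hev : ∀ᶠ y in 𝓝 m, y ∈ C ∪ C') (h0 : ⟪frameTurn b₀ b₁ (e F), m - x⟫ = 0)
    (hpos : 0 < ⟪e F, m - x⟫) : F = C ∩ C' := by
  obtain ⟨t, ht, ht1, htF⟩ := h.exists_add_smul_mem hT hF h0 hpos
  set q := x + t • (m - x) with hq
  have hcv : ∀ A ∈ T, x ∈ A → ∀ z ∈ A, x + t • (z - x) ∈ A := by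
    intro A hA hxA z hz
    have := (hT.polytope_of_mem hA).convex.lineMap_mem hxA hz ⟨ht.le, ht1⟩
    rwa [AffineMap.lineMap_apply_module', add_comm] at this
  have hqm : q ∈ C ∩ C' := ⟨hcv C hC hx.1 m hm.1, hcv C' hC' hx.2 m hm.2⟩
  have hqev : ∀ᶠ y in 𝓝 q, y ∈ C ∪ C' := by
    have hc : Continuous fun y : Euc d => x + t⁻¹ • (y - x) := by fun_prop
    have hval : x + t⁻¹ • (q - x) = m := by
      rw [hq, add_sub_cancel_left, smul_smul, inv_mul_cancel₀ ht.ne', one_smul]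
      abel
    have hval' : ∀ y : Euc d, x + t • (x + t⁻¹ • (y - x) - x) = y := by
      intro y
      rw [add_sub_cancel_left, smul_smul, mul_inv_cancel₀ ht.ne', one_smul]
      abel
    have h1 := hc.tendsto q
    rw [hval] at h1
    filter_upwards [h1.eventually hev] with y hy
    rw [← hval' y]
    rcases hy with hy | hy
    · exact Or.inl (hcv C hC hx.1 _ hy)
    · exact Or.inr (hcv C' hC' hx.2 _ hy)
  obtain ⟨D, hD, hFD⟩ := h.exists_cell hF
  have hsub : ∀ D ∈ T, IsFaceOfCodim 1 D F → C ∩ C' ⊆ D → C ∩ C' ⊆ F := by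
    intro D hD hFD hsub f hf
    obtain ⟨ε, hε, hmem⟩ := hT.relint_of_eventually hC hC' hadj hqm hqev hf
    exact hFD.1.mem_of_add_smul_mem htF (hsub hf) hε (hsub hmem)
  rcases hT.eq_or_eq_of_eventually hC hC' hD hqev (hFD.1.subset htF) with rfl | rfl
  · exact (hadj.1.eq_of_subset (hT.polytope_of_mem hC).2 hFD
      (hsub _ hC hFD inter_subset_left)).symm
  · exact (hadj.2.eq_of_subset (hT.polytope_of_mem hC').2 hFD
      (hsub _ hC' hFD inter_subset_right)).symm

/-- Compare two points on the normal line at a generic facet point `m`, on opposite sides and close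
to `m`. Both use the same half-plane formula, and only the summand of the crossed facet changes. -/
theorem exists_starGrad_sub (hT : IsParallelohedralTiling P T) (h : IsRidgeStar T x G b₀ b₁ S e)
    (hgen : ∀ F ∈ S, ⟪frameTurn b₀ b₁ (e F), w₀⟫ ≠ 0) {C C' : Set (Euc d)} (hC : C ∈ T)
    (hC' : C' ∈ T) (hadj : AdjacentCells C C') (hx : x ∈ C ∩ C')
    (hn : facetNormal C C' = frameTurn b₀ b₁ (e (C ∩ C'))) :
    ∃ y ∈ interior C, ∃ y' ∈ interior C', starGrad s x b₀ b₁ S e w₀ y' -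
      starGrad s x b₀ b₁ S e w₀ y = s (C ∩ C') • facetNormal C C' := by
  set F := C ∩ C' with hFdef
  have hF : F ∈ S := (h.mem_iff F).2 ⟨⟨C, hC, hadj.1⟩, hx⟩
  obtain ⟨m, hm, hmg⟩ := hT.exists_avoids_of_facet hC hadj.1
  have hev := hT.eventually_mem_union hC hC' hadj hm hmg
  have hmx : ⟪frameTurn b₀ b₁ (e F), m - x⟫ = 0 :=
    h.turn_orth hT hF (vsub_mem_vectorSpan ℝ hm hx)
  have hdir := h.dir F hF
  -- The facet extends beyond `m` away from `f`; if `m` had zero component along `e F`, that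
  -- extension would have a negative one.
  have hκ : 0 < ⟪e F, m - x⟫ := by
    obtain ⟨f, hf, hfpos⟩ := h.exists_pos hF
    obtain ⟨ε, hε, hmem⟩ := hT.relint_of_eventually hC hC' hadj hm hev hf
    have h1 := hdir.2.2.2 x h.mem _ hmem
    have h2 : m + ε • (m - f) - x = (m - x) + ε • ((m - x) - (f - x)) := by
      rw [sub_sub_sub_cancel_right]; abel
    rw [h2, inner_add_right, inner_smul_right, inner_sub_right _ (m - x)] at h1
    have h3 := hdir.2.2.2 x h.mem m hm
    by_contra! hle
    have h4 : ⟪e F, m - x⟫ = 0 := le_antisymm hle h3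
    rw [h4] at h1
    nlinarith
  have hL := h.inner_turn_mul hF w₀ hmx
  set n := facetNormal C C' with hndef
  have hnn : ⟪n, n⟫ = 1 := by
    rw [hn]; exact h.frame.inner_turn_self hdir.2.1 hdir.1
  -- Positivity of the product says that `F'` lies on the same side of `w₀` as `F`. If its line
  -- passed through `m`, its ray would be that of `F`, and the facets would coincide.
  have hother : ∀ F' ∈ S, F' ≠ F → 0 < ⟪frameTurn b₀ b₁ (e F), w₀⟫ *
      ⟪frameTurn b₀ b₁ (e F'), w₀⟫ → ⟪frameTurn b₀ b₁ (e F'), m - x⟫ ≠ 0 := by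
    intro F' hF' hne hprod h0
    refine hne (h.eq_of_dir_eq hT hC hC' hadj hx hF' hm hev h0 ?_)
    have h1 := h.inner_turn_mul hF' w₀ h0
    rw [hL] at h1
    by_contra! hle
    set a := ⟪frameTurn b₀ b₁ (e F), w₀⟫
    set a' := ⟪frameTurn b₀ b₁ (e F'), w₀⟫
    have h2 : ⟪e F, m - x⟫ * a * a = ⟪e F', m - x⟫ * (a * a') := by linear_combination (-a) * h1
    have ha : a ≠ 0 := hgen F hF
    have h3 : 0 < ⟪e F, m - x⟫ * a * a := by
      rw [mul_assoc]; exact mul_pos hκ (mul_self_pos.2 ha)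
    nlinarith
  have ht : ∀ σ : ℝ, Tendsto (fun ε : ℝ => m + (σ * ε) • n) (𝓝[>] 0) (𝓝 m) := by
    intro σ
    have : Continuous fun ε : ℝ => m + (σ * ε) • n := by fun_prop
    simpa using (this.tendsto 0).mono_left nhdsWithin_le_nhds
  have hsign : ∀ v : Euc d, ⟪v, m - x⟫ ≠ 0 → ∀ σ : ℝ, ∀ᶠ ε : ℝ in 𝓝[>] 0,
      (0 < ⟪v, m + (σ * ε) • n - x⟫ ↔ 0 < ⟪v, m - x⟫) ∧
      (0 < -⟪v, m + (σ * ε) • n - x⟫ ↔ 0 < -⟪v, m - x⟫) := by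
    intro v hv σ
    have hc : Continuous fun y : Euc d => ⟪v, y - x⟫ := by fun_prop
    have h1 := (hc.tendsto m).comp (ht σ)
    rcases hv.lt_or_gt with hv | hv
    · filter_upwards [h1.eventually (gt_mem_nhds hv)] with ε hε
      have hε : ⟪v, m + (σ * ε) • n - x⟫ < 0 := hε
      constructor <;> constructor <;> intro <;> linarith
    · filter_upwards [h1.eventually (lt_mem_nhds hv)] with ε hε
      have hε : 0 < ⟪v, m + (σ * ε) • n - x⟫ := hε
      constructor <;> constructor <;> intro <;> linarith
  have hall : ∀ σ : ℝ, ∀ᶠ ε : ℝ in 𝓝[>] 0, ∀ F' ∈ S, F' ≠ F →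
      0 < ⟪frameTurn b₀ b₁ (e F), w₀⟫ * ⟪frameTurn b₀ b₁ (e F'), w₀⟫ →
      (0 < ⟪frameTurn b₀ b₁ (e F'), m + (σ * ε) • n - x⟫ ↔
        0 < ⟪frameTurn b₀ b₁ (e F'), m - x⟫) ∧
      (0 < -⟪frameTurn b₀ b₁ (e F'), m + (σ * ε) • n - x⟫ ↔
        0 < -⟪frameTurn b₀ b₁ (e F'), m - x⟫) := by
    intro σ
    rw [Finset.eventually_all]
    intro F' hF'
    by_cases hcond : F' ≠ F ∧ 0 < ⟪frameTurn b₀ b₁ (e F), w₀⟫ * ⟪frameTurn b₀ b₁ (e F'), w₀⟫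
    · filter_upwards [hsign _ (hother F' hF' hcond.1 hcond.2) σ] with ε hε _ _ using hε
    · exact Eventually.of_forall fun ε h1 h2 => absurd ⟨h1, h2⟩ hcond
  have hint := hT.eventually_mem_interior hC hC' hadj hm hev
  have hint' := hT.eventually_mem_interior hC' hC hadj.symm ⟨hm.2, hm.1⟩
    (hev.mono fun y hy => hy.symm)
  rw [hT.facetNormal_symm hC hC' hadj] at hint'
  have hLne : ⟪frameTurn b₀ b₁ w₀, m - x⟫ ≠ 0 := by
    rw [hL]
    exact neg_ne_zero.2 (mul_ne_zero hκ.ne' (hgen F hF))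
  obtain ⟨ε, ⟨⟨⟨⟨⟨⟨h1, h2⟩, h3⟩, h4⟩, h5⟩, h6⟩, h7⟩⟩ := ((((((hall 1).and (hall (-1))).and hint).and
    hint').and (hsign _ hLne 1)).and (hsign _ hLne (-1)) |>.and self_mem_nhdsWithin).exists
  have h7 : 0 < ε := h7
  simp only [one_mul, neg_mul, neg_smul, ← sub_eq_add_neg, smul_neg, sub_neg_eq_add]
    at h1 h2 h3 h4 h5 h6
  have hplus : ⟪frameTurn b₀ b₁ (e F), m + ε • n - x⟫ = ε := by
    rw [show m + ε • n - x = (m - x) + ε • n by abel, inner_add_right, hmx, inner_smul_right,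
      ← hn, hnn]
    ring
  have hminus : ⟪frameTurn b₀ b₁ (e F), m - ε • n - x⟫ = -ε := by
    rw [show m - ε • n - x = (m - x) - ε • n by abel, inner_sub_right, hmx, inner_smul_right,
      ← hn, hnn]
    ring
  refine ⟨m - ε • n, h3, m + ε • n, h4, ?_⟩
  unfold starGrad
  rcases (hgen F hF).lt_or_gt with ha | ha
  · have hLpos : 0 < ⟪frameTurn b₀ b₁ w₀, m - x⟫ := by rw [hL]; nlinarith
    rw [if_pos (h5.1.2 hLpos), if_pos (h6.1.2 hLpos)]
    unfold leftGrad
    rw [← Finset.sum_sub_distrib, Finset.sum_eq_single_of_mem F hF]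
    · rw [hplus, hminus]
      simp [ha, h7, h7.le, hn]
    · intro F' hF' hne
      by_cases ha' : ⟪frameTurn b₀ b₁ (e F'), w₀⟫ < 0
      · have hp := mul_pos_of_neg_of_neg ha ha'
        simp only [(h1 F' hF' hne hp).1, (h2 F' hF' hne hp).1, sub_self]
      · simp [ha']
  · have hLneg : ¬ 0 < ⟪frameTurn b₀ b₁ w₀, m - x⟫ := by rw [hL]; nlinarith
    rw [if_neg (fun hc => hLneg (h5.1.1 hc)), if_neg (fun hc => hLneg (h6.1.1 hc))]
    unfold rightGrad
    rw [neg_sub_neg, ← Finset.sum_sub_distrib, Finset.sum_eq_single_of_mem F hF]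
    · rw [hplus, hminus]
      simp [ha, h7, h7.le, hn]
    · intro F' hF' hne
      by_cases ha' : 0 < ⟪frameTurn b₀ b₁ (e F'), w₀⟫
      · have hp := mul_pos ha ha'
        simp only [(h1 F' hF' hne hp).2, (h2 F' hF' hne hp).2, sub_self]
      · simp [ha']

end IsRidgeStar

/-! ### Local solutions at ridge points -/

namespace IsRidgeStar
variable {d : ℕ} {P : Set (Euc d)} {T : Set (Set (Euc d))} {x : Euc d} {G : Set (Euc d)}
  {b₀ b₁ : Euc d} {S : Finset (Set (Euc d))} {e : Set (Euc d) → Euc d} {s : Set (Euc d) → ℝ}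

theorem exists_isSolutionAt (hT : IsParallelohedralTiling P T) (h : IsRidgeStar T x G b₀ b₁ S e)
    (htor : ∑ F ∈ S, s F • frameTurn b₀ b₁ (e F) = 0) : ∃ u, IsSolutionAt T s x u := by
  obtain ⟨w₀, hw₀, hgen⟩ := h.exists_generic_dir
  have hex : ∀ C : Set (Euc d), ∃ y, C ∈ T → y ∈ interior C := by
    intro C
    by_cases hC : C ∈ T
    · obtain ⟨y, hy⟩ := (hT.polytope_of_mem hC).2
      exact ⟨y, fun _ => hy⟩
    · exact ⟨0, fun h => absurd h hC⟩
  choose y hy using hex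
  have key : ∀ C ∈ T, ∀ C' ∈ T, x ∈ C ∩ C' → AdjacentCells C C' →
      facetNormal C C' = frameTurn b₀ b₁ (e (C ∩ C')) →
      starGrad s x b₀ b₁ S e w₀ (y C') - starGrad s x b₀ b₁ S e w₀ (y C) =
        s (C ∩ C') • facetNormal C C' := by
    intro C hC C' hC' hx hadj hn
    obtain ⟨z, hz, z', hz', heq⟩ := h.exists_starGrad_sub (s := s) hT hgen hC hC' hadj hx hn
    rw [← heq, h.starGrad_congr hT hw₀ hgen htor hC hx.1 (hy C hC) hz,
      h.starGrad_congr hT hw₀ hgen htor hC' hx.2 (hy C' hC') hz']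
  have key' : ∀ C ∈ T, ∀ C' ∈ T, x ∈ C ∩ C' → AdjacentCells C C' →
      starGrad s x b₀ b₁ S e w₀ (y C') - starGrad s x b₀ b₁ S e w₀ (y C) =
        s (C ∩ C') • facetNormal C C' := by
    intro C hC C' hC' hx hadj
    have hF : C ∩ C' ∈ S := (h.mem_iff _).2 ⟨⟨C, hC, hadj.1⟩, hx⟩
    obtain ⟨he1, heG, heF, -⟩ := h.dir _ hF
    have hn := hT.facetNormal_spec hC hadj
    have hnG : facetNormal C C' ∈ (vectorSpan ℝ G)ᗮ :=
      Submodule.orthogonal_le (vectorSpan_mono ℝ (h.subset _ hF)) hn.orth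
    rcases h.frame.eq_turn_or heG he1 hnG hn.norm_eq
      ((Submodule.mem_orthogonal' _ _).1 hn.orth _ heF) with h1 | h1
    · exact key C hC C' hC' hx hadj h1
    -- If the normal points against the direction of turning, the facet is crossed from the other
    -- side.
    · have h2 := key C' hC' C hC ⟨hx.2, hx.1⟩ hadj.symm (by
        rw [hT.facetNormal_symm hC hC' hadj, h1, neg_neg, inter_comm])
      rw [hT.facetNormal_symm hC hC' hadj, inter_comm, smul_neg] at h2
      rw [← neg_sub, h2, neg_neg]
  -- The constants make every affine function vanish at `x`, which lies on all facets involved, so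
  -- the constant part of the jump follows from the gradients.
  refine ⟨fun C => (starGrad s x b₀ b₁ S e w₀ (y C), -⟪starGrad s x b₀ b₁ S e w₀ (y C), x⟫), ?_⟩
  intro C hC C' hC' hx hx' hadj
  have h1 := key' C hC C' hC' ⟨hx, hx'⟩ hadj
  refine Prod.ext h1 ?_
  rw [hT.jump_snd hC hadj ⟨hx, hx'⟩, ← h1, inner_sub_left]
  simp only [Prod.snd_sub]
  ring

end IsRidgeStar

namespace IsParallelohedralTiling
variable {d : ℕ} {P : Set (Euc d)} {T : Set (Set (Euc d))} {s : Set (Euc d) → ℝ}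

/-- A point on a face of codimension 2 but on none of codimension 3 is in the relative interior of a
ridge, namely the minimal face through it. The vanishing torsion there supplies the solution. -/
theorem exists_isSolutionAt (hT : IsParallelohedralTiling P T) (hs : IsCanonicalScaling T s)
    {x : Euc d} (hx : AvoidsCodim T 3 x) : ∃ u, IsSolutionAt T s x u := by
  by_cases hx2 : AvoidsCodim T 2 x
  · exact hT.exists_isSolutionAt_of_avoids_two hx2
  unfold AvoidsCodim at hx2
  push Not at hx2
  obtain ⟨C₀, hC₀, E, hE, hEd, hxE⟩ := hx2
  have hP₀ := hT.polytope_of_mem hC₀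
  obtain ⟨G, hG, hxG, hmin, hri⟩ := hP₀.exists_minimal_exposed (hE.subset hxE)
  have hGd : Module.finrank ℝ (vectorSpan ℝ G) + 2 = d := by
    have h1 := Submodule.finrank_mono (vectorSpan_mono ℝ (hmin E hE hxE))
    have h2 : ¬ _ := fun h => hx C₀ hC₀ G hG h hxG
    omega
  have hW : Module.finrank ℝ (vectorSpan ℝ G)ᗮ = 2 := by
    have := Submodule.finrank_add_finrank_orthogonal (vectorSpan ℝ G)
    rw [finrank_euclideanSpace_fin] at this
    omega
  obtain ⟨b₀, b₁, hb⟩ := exists_isPlaneFrame _ hW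
  obtain ⟨S, n, hS, hn, h0⟩ := hs.2 G ⟨C₀, hC₀, hG, ⟨x, hxG⟩, hGd⟩ _ hb.isQuarterTurn
  choose! e he hne using hn
  -- By the face-to-face property `C₀ ∩ C` is a face of `C₀` through `x`, so it contains the minimal
  -- one.
  have hsub : ∀ C ∈ T, x ∈ C → G ⊆ C := fun C hC hxC =>
    (hmin _ (hT.face_to_face C₀ hC₀ C hC).1 ⟨hG.subset hxG, hxC⟩).trans inter_subset_right
  have hstar : IsRidgeStar T x G b₀ b₁ S e := by
    refine ⟨hb, hG.convex hP₀.convex, hxG, hri, ?_, ?_, fun F hF => ((hS F).1 hF).2, he⟩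
    · intro C hC
      rw [Set.disjoint_left]
      intro y hy hyi
      obtain rfl := hT.eq_of_mem_interior hC hC₀ hyi (hG.subset hy)
      refine Set.disjoint_left.1 (hG.disjoint_interior ?_) hy hyi
      rintro rfl
      rw [finrank_vectorSpan_of_interior hP₀.2] at hGd
      omega
    · intro F
      rw [hS]
      refine and_congr_right fun hF => ⟨fun h => h hxG, fun hxF y hy => ?_⟩
      obtain ⟨C, hC, hFC⟩ := hF
      have hGC := hsub C hC (hFC.1.subset hxF)
      obtain ⟨ε, hε, hmem⟩ := hri y hy
      exact hFC.1.mem_of_add_smul_mem hxF (hGC hy) hε (hGC hmem)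
  refine hstar.exists_isSolutionAt hT ?_
  rw [h0]
  exact Finset.sum_congr rfl fun F hF => by rw [hne F hF]

end IsParallelohedralTiling

/-! ### Translations -/

theorem IsExposed.vadd {d : ℕ} {C F : Set (Euc d)} (h : IsExposed ℝ C F) (t : Euc d) :
    IsExposed ℝ (t +ᵥ C) (t +ᵥ F) := by
  rintro ⟨_, y, hy, rfl⟩
  obtain ⟨l, rfl⟩ := h ⟨y, hy⟩
  refine ⟨l, ?_⟩
  ext z
  simp only [mem_vadd_set, mem_ofPred_eq]
  constructor
  · rintro ⟨y, ⟨hy, hmax⟩, rfl⟩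
    refine ⟨⟨y, hy, rfl⟩, ?_⟩
    rintro _ ⟨u, hu, rfl⟩
    simpa using hmax u hu
  · rintro ⟨⟨y, hy, rfl⟩, hmax⟩
    refine ⟨y, ⟨hy, fun u hu => ?_⟩, rfl⟩
    simpa using hmax _ ⟨u, hu, rfl⟩

theorem vectorSpan_vadd_set {d : ℕ} (F : Set (Euc d)) (t : Euc d) :
    vectorSpan ℝ (t +ᵥ F) = vectorSpan ℝ F := by
  rw [vectorSpan_def, vectorSpan_def]
  congr 1
  ext z
  simp only [Set.mem_vsub, mem_vadd_set]
  constructor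
  · rintro ⟨_, ⟨a, ha, rfl⟩, _, ⟨b, hb, rfl⟩, rfl⟩
    exact ⟨a, ha, b, hb, by simp⟩
  · rintro ⟨a, ha, b, hb, rfl⟩
    exact ⟨_, ⟨a, ha, rfl⟩, _, ⟨b, hb, rfl⟩, by simp⟩

theorem IsFaceOfCodim.vadd {d k : ℕ} {C F : Set (Euc d)} (h : IsFaceOfCodim k C F) (t : Euc d) :
    IsFaceOfCodim k (t +ᵥ C) (t +ᵥ F) :=
  ⟨h.1.vadd t, h.2.1.vadd_set, by rw [vectorSpan_vadd_set]; exact h.2.2⟩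

theorem IsFacetNormal.vadd {d : ℕ} {C F : Set (Euc d)} {n : Euc d} (h : IsFacetNormal C F n)
    (t : Euc d) : IsFacetNormal (t +ᵥ C) (t +ᵥ F) n := by
  refine ⟨h.norm_eq, by rw [vectorSpan_vadd_set]; exact h.orth, ?_⟩
  rintro _ ⟨f, hf, rfl⟩ _ ⟨y, hy, rfl⟩
  simpa [inner_add_right] using h.le f hf y hy

theorem IsFacetNormal.facet_eq {d : ℕ} {C F F' : Set (Euc d)} (hi : (interior C).Nonempty)
    (hF : IsFaceOfCodim 1 C F) (hF' : IsFaceOfCodim 1 C F') {n : Euc d} (h : IsFacetNormal C F n)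
    (h' : IsFacetNormal C F' n) : F = F' := by
  obtain ⟨f, hf⟩ := hF.2.1
  obtain ⟨f', hf'⟩ := hF'.2.1
  have hle : ⟪n, f⟫ = ⟪n, f'⟫ :=
    le_antisymm (h'.le f' hf' f (hF.1.subset hf)) (h.le f hf f' (hF'.1.subset hf'))
  ext y
  constructor
  · intro hy
    rw [h'.mem_iff hi hF' hf' (hF.1.subset hy), ← hle]
    exact (h.mem_iff hi hF hf (hF.1.subset hy)).1 hy
  · intro hy
    rw [h.mem_iff hi hF hf (hF'.1.subset hy), hle]
    exact (h'.mem_iff hi hF' hf' (hF'.1.subset hy)).1 hy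

/-- At a maximum of `⟪v, ·⟫` on `K`, translating by `v` would raise the value by $\|v\|^2$. -/
theorem eq_zero_of_vadd_subset {d : ℕ} {K : Set (Euc d)} (hK : IsCompact K) (hne : K.Nonempty)
    {v : Euc d} (h : v +ᵥ K ⊆ K) : v = 0 := by
  have hc : Continuous fun y : Euc d => ⟪v, y⟫ := by fun_prop
  obtain ⟨y, hy, hmax⟩ := hK.exists_isMaxOn hne hc.continuousOn
  have h1 : ⟪v, v + y⟫ ≤ ⟪v, y⟫ := hmax (h ⟨y, hy, rfl⟩)
  rw [inner_add_right, real_inner_self_eq_norm_sq] at h1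
  have h2 : ‖v‖ ^ 2 = 0 := le_antisymm (by linarith) (by positivity)
  exact norm_eq_zero.1 (pow_eq_zero_iff two_ne_zero |>.1 h2)

theorem eq_of_vadd_eq {d : ℕ} {K : Set (Euc d)} (hK : IsCompact K) (hne : K.Nonempty)
    {v w : Euc d} (h : v +ᵥ K = w +ᵥ K) : v = w := by
  rw [← sub_eq_zero]
  refine eq_zero_of_vadd_subset hK hne (v := v - w) ?_
  rw [sub_eq_neg_add, ← vadd_vadd, h, neg_vadd_vadd]

/-- The facet vectors of `P`. -/
def facetVectors {d : ℕ} (P : Set (Euc d)) (T : Set (Set (Euc d))) : Set (Euc d) :=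
  {p | p +ᵥ P ∈ T ∧ AdjacentCells P (p +ᵥ P)}

namespace IsParallelohedralTiling
variable {d : ℕ} {P : Set (Euc d)} {T : Set (Set (Euc d))} {s : Set (Euc d) → ℝ}

theorem vadd_inj (hT : IsParallelohedralTiling P T) {v w : Euc d} (h : v +ᵥ P = w +ᵥ P) :
    v = w :=
  eq_of_vadd_eq hT.polytope.isCompact (hT.polytope.2.mono interior_subset) h

/-- The neighbour across a facet is determined by the facet, up to translation. -/
theorem neighbour_vadd (hT : IsParallelohedralTiling P T) {C C' D D' : Set (Euc d)} (hC : C ∈ T)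
    (hC' : C' ∈ T) (hD : D ∈ T) (hD' : D' ∈ T) (hadj : AdjacentCells C C')
    (hadj' : AdjacentCells D D') {v : Euc d} (hv : D = v +ᵥ C) (hF : D ∩ D' = v +ᵥ (C ∩ C')) :
    D' = v +ᵥ C' := by
  have hn := hT.facetNormal_spec hC hadj
  have h1 := hT.normal_neg hC hC' hadj hn
  have h2 := hn.vadd v
  rw [← hv, ← hF] at h2
  have h3 := hT.normal_neg hD hD' hadj' h2
  obtain ⟨t, ht⟩ := hT.translate C' hC'
  obtain ⟨t', ht'⟩ := hT.translate D' hD'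
  have hr : D' = (t' - t) +ᵥ C' := by rw [ht', ht, vadd_vadd, sub_add_cancel]
  -- The translate of the facet of `C'` and the facet `D ∩ D'` are facets of `D'` with the same
  -- normal, so they coincide and force `t' - t = v`.
  have h4 := h1.vadd (t' - t)
  have h5 := hadj.2.vadd (t' - t)
  rw [← hr] at h4 h5
  have h6 := h4.facet_eq (hT.polytope_of_mem hD').2 h5 hadj'.2 h3
  rw [hF] at h6
  have h7 := eq_of_vadd_eq (hadj.1.1.isCompact (hT.polytope_of_mem hC).isCompact) hadj.1.2.1 h6
  rw [hr, h7]

theorem facetVector_step (hT : IsParallelohedralTiling P T) {C C' D : Set (Euc d)} (hC : C ∈ T)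
    (hC' : C' ∈ T) (hD : D ∈ T) (hadj : AdjacentCells C C') {v : Euc d} (hv : D = v +ᵥ C) :
    v +ᵥ C' ∈ T ∧ AdjacentCells D (v +ᵥ C') := by
  have h1 := hadj.1.vadd v
  rw [← hv] at h1
  obtain ⟨D', hD', hadj', hF⟩ := hT.exists_adjacent hD h1
  rw [← hT.neighbour_vadd hC hC' hD hD' hadj hadj' hv hF]
  exact ⟨hD', hadj'⟩

theorem add_mem_of_facetVector (hT : IsParallelohedralTiling P T) {p t : Euc d}
    (hp : p ∈ facetVectors P T) (ht : t +ᵥ P ∈ T) :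
    (t + p) +ᵥ P ∈ T ∧ AdjacentCells (t +ᵥ P) ((t + p) +ᵥ P) := by
  have := hT.facetVector_step hT.self_mem hp.1 ht hp.2 rfl
  rwa [vadd_vadd] at this

theorem neg_facetVector (hT : IsParallelohedralTiling P T) {p : Euc d}
    (hp : p ∈ facetVectors P T) : -p ∈ facetVectors P T :=
  hT.facetVector_step hp.1 hT.self_mem hT.self_mem hp.2.symm (by rw [neg_vadd_vadd])

theorem exists_facetVector (hT : IsParallelohedralTiling P T) {t : Euc d} {C' : Set (Euc d)}
    (ht : t +ᵥ P ∈ T) (hC' : C' ∈ T) (hadj : AdjacentCells (t +ᵥ P) C') :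
    ∃ p ∈ facetVectors P T, C' = (t + p) +ᵥ P := by
  have h := hT.facetVector_step ht hC' hT.self_mem hadj (neg_vadd_vadd t P).symm
  obtain ⟨p, hp⟩ := hT.translate _ h.1
  refine ⟨p, ⟨hp ▸ h.1, hp ▸ h.2⟩, ?_⟩
  rw [← vadd_vadd, ← hp, vadd_neg_vadd]

/-- The translation vectors of the cells form the group generated by the facet vectors. -/
theorem mem_iff_mem_closure (hT : IsParallelohedralTiling P T) (t : Euc d) :
    t +ᵥ P ∈ T ↔ t ∈ AddSubgroup.closure (facetVectors P T) := by
  constructor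
  · intro ht
    have hch := hT.reflTransGen_adjacent isOpen_univ convex_univ hT.self_mem ht
      (by simpa using hT.polytope.2.mono interior_subset)
      (by simpa using (hT.polytope_of_mem ht).2.mono interior_subset)
    have key : ∀ D, Relation.ReflTransGen (fun C C' => C ∈ T ∧ C' ∈ T ∧ AdjacentCells C C' ∧
        (C ∩ C' ∩ univ).Nonempty) P D →
        ∃ u ∈ AddSubgroup.closure (facetVectors P T), D = u +ᵥ P := by
      intro D hD
      induction hD with
      | refl => exact ⟨0, zero_mem _, (zero_vadd _ _).symm⟩
      | tail _ h ih =>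
        obtain ⟨u, hu, rfl⟩ := ih
        obtain ⟨p, hp, rfl⟩ := hT.exists_facetVector h.1 h.2.1 h.2.2.1
        exact ⟨u + p, add_mem hu (AddSubgroup.subset_closure hp), rfl⟩
    obtain ⟨u, hu, h⟩ := key _ hch
    rwa [hT.vadd_inj h]
  · intro ht
    have key : (∀ u : Euc d, u +ᵥ P ∈ T → (u + t) +ᵥ P ∈ T) ∧
        ∀ u : Euc d, u +ᵥ P ∈ T → (u - t) +ᵥ P ∈ T := by
      induction ht using AddSubgroup.closure_induction with
      | mem p hp =>
        refine ⟨fun u hu => (hT.add_mem_of_facetVector hp hu).1, fun u hu => ?_⟩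
        rw [sub_eq_add_neg]
        exact (hT.add_mem_of_facetVector (hT.neg_facetVector hp) hu).1
      | zero => simp
      | add a b _ _ ha hb =>
        refine ⟨fun u hu => ?_, fun u hu => ?_⟩
        · rw [← add_assoc]; exact hb.1 _ (ha.1 _ hu)
        · rw [← sub_sub]; exact hb.2 _ (ha.2 _ hu)
      | neg a _ ha =>
        refine ⟨fun u hu => ?_, fun u hu => ?_⟩
        · rw [← sub_eq_add_neg]; exact ha.2 _ hu
        · rw [sub_neg_eq_add]; exact ha.1 _ hu
    simpa using key.1 0 (by simpa using hT.self_mem)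

theorem vadd_mem_iff (hT : IsParallelohedralTiling P T) {v : Euc d}
    (hv : v ∈ AddSubgroup.closure (facetVectors P T)) (C : Set (Euc d)) :
    v +ᵥ C ∈ T ↔ C ∈ T := by
  have key : ∀ v ∈ AddSubgroup.closure (facetVectors P T), ∀ C ∈ T, v +ᵥ C ∈ T := by
    intro v hv C hC
    obtain ⟨t, rfl⟩ := hT.translate C hC
    rw [vadd_vadd, hT.mem_iff_mem_closure]
    exact add_mem hv ((hT.mem_iff_mem_closure t).1 hC)
  refine ⟨fun h => ?_, key v hv C⟩
  rw [← neg_vadd_vadd v C]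
  exact key _ (neg_mem hv) _ h

/-- If `v` were nonzero and orthogonal to all translation vectors, the cells would cover only a slab
on which `⟪v, ·⟫` is bounded. -/
theorem span_closure_facetVectors (hT : IsParallelohedralTiling P T) :
    Submodule.span ℝ (AddSubgroup.closure (facetVectors P T) : Set (Euc d)) = ⊤ := by
  set V := Submodule.span ℝ (AddSubgroup.closure (facetVectors P T) : Set (Euc d)) with hV
  rw [← Submodule.orthogonal_eq_bot_iff, Submodule.eq_bot_iff]
  intro v hv
  by_contra hv0
  obtain ⟨R, hR⟩ := hT.polytope.isCompact.isBounded.exists_norm_le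
  have hvpos : 0 < ‖v‖ := norm_pos_iff.2 hv0
  obtain ⟨C, hC, hx⟩ := hT.cover (((|R| + 1) / ‖v‖) • v)
  obtain ⟨t, rfl⟩ := hT.translate C hC
  obtain ⟨y, hy, heq⟩ := hx
  have ht : t ∈ V := Submodule.subset_span ((hT.mem_iff_mem_closure t).1 hC)
  have h1 : ⟪v, t⟫ = 0 := (Submodule.mem_orthogonal' _ _).1 hv t ht
  have h2 := congrArg (fun z => ⟪v, z⟫) heq
  simp only [vadd_eq_add, inner_add_right, inner_smul_right, h1, zero_add,
    real_inner_self_eq_norm_sq] at h2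
  have h3 : ⟪v, y⟫ ≤ ‖v‖ * R := (real_inner_le_norm v y).trans (by gcongr; exact hR y hy)
  have h4 : (|R| + 1) / ‖v‖ * ‖v‖ ^ 2 = (|R| + 1) * ‖v‖ := by field_simp
  rw [h2, h4] at h3
  nlinarith [le_abs_self R]

/-- The group is discrete: a short translation keeps some interior point of `P` inside `P`, so the
translated cell is `P` itself. It also spans the space, so it is a full lattice. -/
theorem exists_basis (hT : IsParallelohedralTiling P T) : ∃ b : Module.Basis (Fin d) ℝ (Euc d),
    ∀ v, v ∈ Submodule.span ℤ (Set.range b) ↔ v ∈ AddSubgroup.closure (facetVectors P T) := by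
  set L : Submodule ℤ (Euc d) := (AddSubgroup.closure (facetVectors P T)).toIntSubmodule with hL
  have hmem : ∀ v, v ∈ L ↔ v ∈ AddSubgroup.closure (facetVectors P T) := fun v => Iff.rfl
  have hdisc : DiscreteTopology L := by
    obtain ⟨x, hx⟩ := hT.polytope.2
    obtain ⟨r, hr, hball⟩ := Metric.isOpen_iff.1 isOpen_interior x hx
    have h0 : ∀ v ∈ L, ‖v‖ < r → v = 0 := by
      intro v hv hvr
      have hvT : v +ᵥ P ∈ T := (hT.mem_iff_mem_closure v).2 hv
      have h1 : v + x ∈ interior P := hball (by simpa [dist_eq_norm] using hvr)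
      have h2 := hT.eq_of_mem_interior hT.self_mem hvT h1 ⟨x, interior_subset hx, rfl⟩
      exact hT.vadd_inj (by rw [zero_vadd]; exact h2.symm)
    rw [discreteTopology_iff_isOpen_singleton_zero, Metric.isOpen_iff]
    rintro _ rfl
    refine ⟨r, hr, fun v hv => ?_⟩
    rw [mem_ball_zero_iff] at hv
    exact Subtype.ext (h0 v v.2 hv)
  have hlat : IsZLattice ℝ L := ⟨hT.span_closure_facetVectors⟩
  have := ZLattice.module_free ℝ L
  have := ZLattice.module_finite ℝ L
  have hrank : Module.finrank ℤ L = d := by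
    rw [ZLattice.rank ℝ L, finrank_euclideanSpace_fin]
  let b := (Module.finBasisOfFinrankEq ℤ L hrank).ofZLatticeBasis ℝ L
  refine ⟨b, fun v => ?_⟩
  rw [(Module.finBasisOfFinrankEq ℤ L hrank).ofZLatticeBasis_span ℝ, hmem]

end IsParallelohedralTiling

/-! ### The quadratic form -/

theorem map_add_of_mem_closure {E F : Type*} [AddCommGroup E] [AddCommGroup F] {D : Set E}
    {f : E → F} (h0 : f 0 = 0) (h : ∀ x ∈ AddSubgroup.closure D, ∀ p ∈ D, f (x + p) = f x + f p)
    {x y : E} (hx : x ∈ AddSubgroup.closure D) (hy : y ∈ AddSubgroup.closure D) :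
    f (x + y) = f x + f y := by
  induction hy using AddSubgroup.closure_induction generalizing x with
  | mem p hp => exact h x hx p hp
  | zero => simp [h0]
  | add a b ha hb iha ihb =>
    rw [← add_assoc, ihb (add_mem hx ha), iha hx, ihb ha, add_assoc]
  | neg a ha iha =>
    have h1 := iha (add_mem hx (neg_mem ha))
    have h2 := iha (neg_mem ha)
    rw [neg_add_cancel_right] at h1
    rw [neg_add_cancel, h0] at h2
    rw [h1, add_assoc, add_comm (f a), ← h2, add_zero]

namespace IsParallelohedralTiling
variable {d : ℕ} {P : Set (Euc d)} {T : Set (Set (Euc d))} {s : Set (Euc d) → ℝ}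

theorem span_facetVectors (hT : IsParallelohedralTiling P T) :
    Submodule.span ℝ (facetVectors P T) = ⊤ := by
  rw [← top_le_iff, ← hT.span_closure_facetVectors, Submodule.span_le]
  exact (AddSubgroup.closure_le (Submodule.span ℝ (facetVectors P T)).toAddSubgroup).2
    Submodule.subset_span

theorem ext_facetVectors (hT : IsParallelohedralTiling P T) {F : Type*} [AddCommGroup F]
    [Module ℝ F] {f g : Euc d →ₗ[ℝ] F} (h : ∀ p ∈ facetVectors P T, f p = g p) : f = g :=
  LinearMap.ext_on hT.span_facetVectors h

/-- Additivity against the generators gives additivity on the whole lattice, and a lattice basis is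
a basis of the space. -/
theorem exists_linear_extension (hT : IsParallelohedralTiling P T) {F : Type*} [AddCommGroup F]
    [Module ℝ F] {f : Euc d → F} (h0 : f 0 = 0)
    (h : ∀ x ∈ AddSubgroup.closure (facetVectors P T), ∀ p ∈ facetVectors P T,
      f (x + p) = f x + f p) :
    ∃ L : Euc d →ₗ[ℝ] F, ∀ x ∈ AddSubgroup.closure (facetVectors P T), L x = f x := by
  obtain ⟨b, hb⟩ := hT.exists_basis
  let g : AddSubgroup.closure (facetVectors P T) →+ F :=
    { toFun := fun x => f x
      map_zero' := h0
      map_add' := fun x y => map_add_of_mem_closure h0 h x.2 y.2 }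
  refine ⟨b.constr ℝ fun i => f (b i), fun x hx => ?_⟩
  have key : ∀ x (hx : x ∈ Submodule.span ℤ (range b)),
      b.constr ℝ (fun i => f (b i)) x = g ⟨x, (hb x).1 hx⟩ := by
    intro x hx
    induction hx using Submodule.span_induction with
    | mem x hx =>
      obtain ⟨i, rfl⟩ := hx
      exact b.constr_basis ℝ _ i
    | zero => rw [map_zero]; exact h0.symm
    | add x y hx hy ihx ihy =>
      rw [map_add, ihx, ihy, ← map_add]
      rfl
    | smul n x hx ih =>
      rw [map_zsmul, ih, ← map_zsmul]
      rfl
  exact key x ((hb x).2 hx)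

theorem exists_facetVector_of_facet (hT : IsParallelohedralTiling P T) {F : Set (Euc d)}
    (hF : IsFaceOfCodim 1 P F) : ∃ p ∈ facetVectors P T, P ∩ (p +ᵥ P) = F := by
  obtain ⟨C', hC', hadj, rfl⟩ := hT.exists_adjacent hT.self_mem hF
  obtain ⟨p, rfl⟩ := hT.translate C' hC'
  exact ⟨p, ⟨hC', hadj⟩, rfl⟩

/-- Invariance of `s` and of normals fixes the gradient; only the constant changes, since the facet
on which the jump vanishes has moved by `v`. -/
theorem jump_vadd (hT : IsParallelohedralTiling P T) (hinv : IsTranslationInvariant T s)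
    {v p : Euc d} (hv : v ∈ AddSubgroup.closure (facetVectors P T)) (hp : p ∈ facetVectors P T) :
    jump s (v +ᵥ P) ((v + p) +ᵥ P) =
      ((jump s P (p +ᵥ P)).1, (jump s P (p +ᵥ P)).2 - ⟪(jump s P (p +ᵥ P)).1, v⟫) := by
  have hvT := (hT.mem_iff_mem_closure v).2 hv
  have hadj := (hT.add_mem_of_facetVector hp hvT).2
  have hinter : (v +ᵥ P) ∩ ((v + p) +ᵥ P) = v +ᵥ (P ∩ (p +ᵥ P)) := by
    rw [vadd_set_inter, vadd_vadd]
  have hs : s ((v +ᵥ P) ∩ ((v + p) +ᵥ P)) = s (P ∩ (p +ᵥ P)) := by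
    rw [hinter]
    exact hinv v (hT.vadd_mem_iff hv) _ ⟨P, hT.self_mem, hp.2.1⟩
  have hn : facetNormal (v +ᵥ P) ((v + p) +ᵥ P) = facetNormal P (p +ᵥ P) := by
    have h1 := (hT.facetNormal_spec hT.self_mem hp.2).vadd v
    rw [← hinter] at h1
    exact h1.eq (hT.polytope_of_mem hvT).2 hadj.1 (hT.facetNormal_spec hvT hadj)
  obtain ⟨x, hx⟩ := hp.2.1.2.1
  have hx' : v + x ∈ (v +ᵥ P) ∩ ((v + p) +ᵥ P) := by
    rw [hinter]
    exact ⟨x, hx, rfl⟩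
  have h1 : (jump s (v +ᵥ P) ((v + p) +ᵥ P)).1 = (jump s P (p +ᵥ P)).1 := by
    change s _ • facetNormal _ _ = s _ • facetNormal _ _
    rw [hs, hn]
  refine Prod.ext h1 ?_
  change _ = (jump s P (p +ᵥ P)).2 - ⟪(jump s P (p +ᵥ P)).1, v⟫
  rw [hT.jump_snd hvT hadj hx', hT.jump_snd hT.self_mem hp.2 hx]
  change -⟪(jump s (v +ᵥ P) ((v + p) +ᵥ P)).1, v + x⟫ = _
  rw [h1, inner_add_right]
  change -(⟪(jump s P (p +ᵥ P)).1, v⟫ + ⟪(jump s P (p +ᵥ P)).1, x⟫) =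
    -⟪(jump s P (p +ᵥ P)).1, x⟫ - _
  ring

/-- Such a `v` changes none of the facet inequalities, so translation by it maps the compact set `P`
into itself. -/
theorem eq_zero_of_orthogonal_normals (hT : IsParallelohedralTiling P T) {v : Euc d}
    (h : ∀ p ∈ facetVectors P T, ⟪facetNormal P (p +ᵥ P), v⟫ = 0) : v = 0 := by
  have hP := hT.polytope
  refine eq_zero_of_vadd_subset hP.isCompact (hP.2.mono interior_subset) (v := v) ?_
  rintro _ ⟨y, hy, rfl⟩
  by_contra hvy
  obtain ⟨F, n, hF, hn, hlt⟩ := hP.exists_facet_of_notMem hvy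
  obtain ⟨p, hp, rfl⟩ := hT.exists_facetVector_of_facet hF
  obtain ⟨f, hf⟩ := hF.2.1
  have h1 := hlt f hf
  have h2 := h p hp
  rw [hn.eq hP.2 hF (hT.facetNormal_spec hT.self_mem hp.2)] at h2
  have h3 := hn.le f hf y hy
  simp only [vadd_eq_add, inner_add_right, h2] at h1
  linarith

theorem jump_fst_eq_zero_iff (hT : IsParallelohedralTiling P T) (hs : IsCanonicalScaling T s)
    {p v : Euc d} (hp : p ∈ facetVectors P T) :
    ⟪(jump s P (p +ᵥ P)).1, v⟫ = 0 ↔ ⟪facetNormal P (p +ᵥ P), v⟫ = 0 := by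
  have : 0 < s (P ∩ (p +ᵥ P)) := hs.1 _ ⟨P, hT.self_mem, hp.2.1⟩
  change ⟪s (P ∩ (p +ᵥ P)) • facetNormal P (p +ᵥ P), v⟫ = 0 ↔ _
  rw [real_inner_smul_left]
  simp [this.ne']

/-- The affine functions of a global solution depend quadratically on the cell. -/
theorem exists_quadratic (hT : IsParallelohedralTiling P T) (hs : IsCanonicalScaling T s)
    (hinv : IsTranslationInvariant T s) {u : Set (Euc d) → Euc d × ℝ} (h0 : u P = 0)
    (hu : ∀ C ∈ T, ∀ C' ∈ T, AdjacentCells C C' → u C' - u C = jump s C C') :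
    ∃ (L : Euc d →ₗ[ℝ] Euc d) (c : Euc d), (∀ x y, ⟪L x, y⟫ = ⟪L y, x⟫) ∧
      Function.Injective L ∧ (∀ p ∈ facetVectors P T, L p = (jump s P (p +ᵥ P)).1) ∧
      ∀ v ∈ AddSubgroup.closure (facetVectors P T),
        u (v +ᵥ P) = (L v, -⟪L v, c⟫ - ⟪L v, v⟫ / 2) := by
  have hstep : ∀ v ∈ AddSubgroup.closure (facetVectors P T), ∀ p ∈ facetVectors P T,
      u ((v + p) +ᵥ P) = u (v +ᵥ P) + jump s (v +ᵥ P) ((v + p) +ᵥ P) := by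
    intro v hv p hp
    have hvT := (hT.mem_iff_mem_closure v).2 hv
    have h1 := hT.add_mem_of_facetVector hp hvT
    rw [← hu _ hvT _ h1.1 h1.2]
    abel
  have hp0 : ∀ p ∈ facetVectors P T, u (p +ᵥ P) = jump s P (p +ᵥ P) := by
    intro p hp
    rw [← hu _ hT.self_mem _ hp.1 hp.2, h0, sub_zero]
  have hstep1 : ∀ v ∈ AddSubgroup.closure (facetVectors P T), ∀ p ∈ facetVectors P T,
      (u ((v + p) +ᵥ P)).1 = (u (v +ᵥ P)).1 + (u (p +ᵥ P)).1 := by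
    intro v hv p hp
    rw [hstep v hv p hp, hT.jump_vadd hinv hv hp, hp0 p hp]
    rfl
  obtain ⟨L, hL⟩ := hT.exists_linear_extension (f := fun v => (u (v +ᵥ P)).1)
    (by simp [h0]) hstep1
  have hstep2 : ∀ v ∈ AddSubgroup.closure (facetVectors P T), ∀ p ∈ facetVectors P T,
      (u ((v + p) +ᵥ P)).2 = (u (v +ᵥ P)).2 + (u (p +ᵥ P)).2 - ⟪L p, v⟫ := by
    intro v hv p hp
    rw [hL p (AddSubgroup.subset_closure hp), hstep v hv p hp, hT.jump_vadd hinv hv hp, hp0 p hp]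
    change (u (v +ᵥ P)).2 + ((jump s P (p +ᵥ P)).2 - _) = _
    ring
  -- The cell of `p + q` is reached in two orders; equating the constant terms gives symmetry on the
  -- facet vectors.
  have hsymm0 : ∀ p ∈ facetVectors P T, ∀ q ∈ facetVectors P T, ⟪L q, p⟫ = ⟪L p, q⟫ := by
    intro p hp q hq
    have h1 := hstep2 p (AddSubgroup.subset_closure hp) q hq
    have h2 := hstep2 q (AddSubgroup.subset_closure hq) p hp
    rw [add_comm q p] at h2
    linarith
  have hsymm1 : ∀ p ∈ facetVectors P T, ∀ x, ⟪L x, p⟫ = ⟪L p, x⟫ := by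
    intro p hp x
    have : (innerₛₗ ℝ p).comp L = innerₛₗ ℝ (L p) :=
      hT.ext_facetVectors fun q hq => by
        simpa [real_inner_comm] using hsymm0 p hp q hq
    have := LinearMap.congr_fun this x
    simpa [real_inner_comm] using this
  have hsymm : ∀ x y, ⟪L x, y⟫ = ⟪L y, x⟫ := by
    intro x y
    have : (innerₛₗ ℝ x).comp L = innerₛₗ ℝ (L x) :=
      hT.ext_facetVectors fun q hq => by
        simpa [real_inner_comm] using (hsymm1 q hq x).symm
    have := LinearMap.congr_fun this y
    simpa [real_inner_comm] using this.symm
  have hLp : ∀ p ∈ facetVectors P T, L p = (jump s P (p +ᵥ P)).1 := by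
    intro p hp
    rw [hL p (AddSubgroup.subset_closure hp), hp0 p hp]
  -- By symmetry a kernel vector is orthogonal to every `L p`, that is, to every facet normal.
  have hinj : Function.Injective L := by
    rw [injective_iff_map_eq_zero]
    intro v hv
    refine hT.eq_zero_of_orthogonal_normals fun p hp => ?_
    rw [← hT.jump_fst_eq_zero_iff hs hp, ← hLp p hp, hsymm, hv, inner_zero_left]
  -- Adding half the quadratic form cancels the cross term in the recursion for the constants,
  -- leaving an additive function.
  obtain ⟨B, hB⟩ := hT.exists_linear_extension
    (f := fun v => (u (v +ᵥ P)).2 + ⟪L v, v⟫ / 2) (by simp [h0]) (by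
      intro v hv p hp
      rw [hstep2 v hv p hp, map_add, inner_add_left, inner_add_right, inner_add_right, hsymm v p]
      ring)
  obtain ⟨w, hw⟩ : ∃ w : Euc d, ∀ v, B v = ⟪w, v⟫ := by
    refine ⟨(InnerProductSpace.toDual ℝ (Euc d)).symm (LinearMap.toContinuousLinearMap B), ?_⟩
    intro v
    rw [InnerProductSpace.toDual_symm_apply]
    rfl
  -- Completing the square: the linear part is represented as `L c`, and the centre is `-c` by the
  -- sign convention of the conclusion.
  obtain ⟨c, rfl⟩ := (LinearMap.injective_iff_surjective.1 hinj) w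
  refine ⟨L, -c, hsymm, hinj, hLp, fun v hv => Prod.ext (hL v hv).symm ?_⟩
  have h1 := hB v hv
  rw [hw, hsymm] at h1
  rw [inner_neg_right, neg_neg]
  linarith

end IsParallelohedralTiling

/-! ### Convexity of the generatrix -/

/-- The value at `x` of the affine function with gradient `w.1` and constant term `w.2`. -/
noncomputable def affineValue {d : ℕ} (w : Euc d × ℝ) (x : Euc d) : ℝ := ⟪w.1, x⟫ + w.2

theorem continuous_affineValue {d : ℕ} (w : Euc d × ℝ) : Continuous (affineValue w) := by
  unfold affineValue
  fun_prop

namespace IsParallelohedralTiling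
variable {d : ℕ} {P : Set (Euc d)} {T : Set (Set (Euc d))} {s : Set (Euc d) → ℝ}
  {u : Set (Euc d) → Euc d × ℝ}

theorem affineValue_sub (hT : IsParallelohedralTiling P T)
    (hu : ∀ C ∈ T, ∀ C' ∈ T, AdjacentCells C C' → u C' - u C = jump s C C')
    {C C' : Set (Euc d)} (hC : C ∈ T) (hC' : C' ∈ T) (hadj : AdjacentCells C C') {z : Euc d}
    (hz : z ∈ C ∩ C') (x : Euc d) :
    affineValue (u C') x - affineValue (u C) x =
      s (C ∩ C') * (⟪facetNormal C C', x⟫ - ⟪facetNormal C C', z⟫) := by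
  have h := hu C hC C' hC' hadj
  have h1 : (u C').1 - (u C).1 = s (C ∩ C') • facetNormal C C' := congrArg Prod.fst h
  have h2 : (u C').2 - (u C).2 = -⟪s (C ∩ C') • facetNormal C C', z⟫ :=
    (congrArg Prod.snd h).trans (hT.jump_snd hC hadj hz)
  have h3 := congrArg (fun w => ⟪w, x⟫) h1
  simp only [inner_sub_left, real_inner_smul_left] at h2 h3
  unfold affineValue
  linear_combination h3 + h2

/-- Cross the facet through which the segment leaves `C`: as `s` is positive, the neighbour's
function is larger beyond that facet, in particular at `x`. -/
theorem exists_affineValue_lt (hT : IsParallelohedralTiling P T) (hs : IsCanonicalScaling T s)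
    (hu : ∀ C ∈ T, ∀ C' ∈ T, AdjacentCells C C' → u C' - u C = jump s C C')
    {C : Set (Euc d)} (hC : C ∈ T) {x y : Euc d} (hy : y ∈ C) (hx : x ∉ C) :
    ∃ C' ∈ T, (C' ∩ segment ℝ y x).Nonempty ∧ affineValue (u C) x < affineValue (u C') x := by
  have hCp := hT.polytope_of_mem hC
  obtain ⟨z, hz, F, n, hzF, hF, hn, hlt⟩ := hCp.exists_facet_on_segment hy hx
  obtain ⟨C', hC', hadj, rfl⟩ := hT.exists_adjacent hC hF
  refine ⟨C', hC', ⟨z, hzF.2, hz⟩, ?_⟩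
  have h1 := hT.affineValue_sub hu hC hC' hadj hzF x
  rw [← hn.eq hCp.2 hF (hT.facetNormal_spec hC hadj)] at hlt
  have h2 : 0 < s (C ∩ C') := hs.1 _ ⟨C, hC, hF⟩
  have h3 := mul_pos h2 (sub_pos.2 hlt)
  linarith

/-- Among the finitely many cells meeting the segment from `y` to `x`, one with the largest value at
`x` must contain `x`, since otherwise a neighbour along the segment does better. Boundary points
follow by closure. -/
theorem affineValue_le (hT : IsParallelohedralTiling P T) (hs : IsCanonicalScaling T s)
    (hu : ∀ C ∈ T, ∀ C' ∈ T, AdjacentCells C C' → u C' - u C = jump s C C')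
    {C D : Set (Euc d)} (hC : C ∈ T) (hD : D ∈ T) {x : Euc d} (hx : x ∈ D) :
    affineValue (u C) x ≤ affineValue (u D) x := by
  have hDp := hT.polytope_of_mem hD
  obtain ⟨y, hy⟩ := (hT.polytope_of_mem hC).2.mono interior_subset
  have key : interior D ⊆ {x | affineValue (u C) x ≤ affineValue (u D) x} := by
    intro x hx
    have hfin := hT.finite_meeting (R := segment ℝ y x)
      ((convexHull_pair (𝕜 := ℝ) y x) ▸ ((toFinite {y, x}).isCompact_convexHull ℝ).isBounded)
    obtain ⟨E, hE, hmax⟩ := exists_max_image _ (fun E => affineValue (u E) x) hfin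
      ⟨C, hC, y, hy, left_mem_segment ℝ y x⟩
    have hED : E = D := by
      by_contra hne
      have hxE : x ∉ E := fun h => hne (hT.eq_of_mem_interior hD hE.1 hx h).symm
      obtain ⟨z, hzE, hz⟩ := hE.2
      obtain ⟨E', hE', ⟨w, hwE', hw⟩, hlt⟩ := hT.exists_affineValue_lt hs hu hE.1 hzE hxE
      have hw' := (convex_segment y x).segment_subset hz (right_mem_segment ℝ y x) hw
      exact absurd (hmax E' ⟨hE', w, hwE', hw'⟩) (not_le.2 hlt)
    rw [← hED]
    exact hmax C ⟨hC, y, hy, left_mem_segment ℝ y x⟩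
  have hcl : IsClosed {x | affineValue (u C) x ≤ affineValue (u D) x} :=
    isClosed_le (continuous_affineValue _) (continuous_affineValue _)
  exact closure_minimal key hcl (by rwa [hDp.closure_interior])

theorem mem_iff_affineValue_le (hT : IsParallelohedralTiling P T) (hs : IsCanonicalScaling T s)
    (hu : ∀ C ∈ T, ∀ C' ∈ T, AdjacentCells C C' → u C' - u C = jump s C C')
    {D : Set (Euc d)} (hD : D ∈ T) (x : Euc d) :
    x ∈ D ↔ ∀ C ∈ T, affineValue (u C) x ≤ affineValue (u D) x := by
  refine ⟨fun hx C hC => hT.affineValue_le hs hu hC hD hx, fun h => ?_⟩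
  by_contra hx
  obtain ⟨y, hy⟩ := (hT.polytope_of_mem hD).2.mono interior_subset
  obtain ⟨C, hC, -, hlt⟩ := hT.exists_affineValue_lt hs hu hD hy hx
  exact absurd (h C hC) (not_le.2 hlt)

theorem eq_of_affineValue_eq (hT : IsParallelohedralTiling P T) (hs : IsCanonicalScaling T s)
    (hu : ∀ C ∈ T, ∀ C' ∈ T, AdjacentCells C C' → u C' - u C = jump s C C')
    {C D : Set (Euc d)} (hC : C ∈ T) (hD : D ∈ T) (h : affineValue (u C) = affineValue (u D)) :
    C = D := by
  ext x
  rw [hT.mem_iff_affineValue_le hs hu hC, hT.mem_iff_affineValue_le hs hu hD, h]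

end IsParallelohedralTiling

/-! ### The quadratic lift: central symmetry and positivity -/

/-- The affine functions `u` with the jumps prescribed by `s` are given by the bilinear form of `L`
and the centre `c`. -/
structure IsQuadraticLift {d : ℕ} (P : Set (Euc d)) (T : Set (Set (Euc d)))
    (s : Set (Euc d) → ℝ) (u : Set (Euc d) → Euc d × ℝ) (L : Euc d →ₗ[ℝ] Euc d) (c : Euc d) :
    Prop where
  tiling : IsParallelohedralTiling P T
  scaling : IsCanonicalScaling T s
  map_self : u P = 0
  sub_eq : ∀ C ∈ T, ∀ C' ∈ T, AdjacentCells C C' → u C' - u C = jump s C C'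
  symm : ∀ x y, ⟪L x, y⟫ = ⟪L y, x⟫
  injective : Function.Injective L
  map_facetVector : ∀ p ∈ facetVectors P T, L p = (jump s P (p +ᵥ P)).1
  map_vadd : ∀ v ∈ AddSubgroup.closure (facetVectors P T),
    u (v +ᵥ P) = (L v, -⟪L v, c⟫ - ⟪L v, v⟫ / 2)

theorem IsParallelohedralTiling.exists_isQuadraticLift {d : ℕ} {P : Set (Euc d)}
    {T : Set (Set (Euc d))} {s : Set (Euc d) → ℝ} (hT : IsParallelohedralTiling P T)
    (hs : IsCanonicalScaling T s) (hinv : IsTranslationInvariant T s) :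
    ∃ u L c, IsQuadraticLift P T s u L c := by
  obtain ⟨u, h0, hu⟩ := hT.exists_global_solution fun x hx => hT.exists_isSolutionAt hs hx
  obtain ⟨L, c, h1, h2, h3, h4⟩ := hT.exists_quadratic hs hinv h0 hu
  exact ⟨u, L, c, hT, hs, h0, hu, h1, h2, h3, h4⟩

namespace IsQuadraticLift
variable {d : ℕ} {P : Set (Euc d)} {T : Set (Set (Euc d))} {s : Set (Euc d) → ℝ}
  {u : Set (Euc d) → Euc d × ℝ} {L : Euc d →ₗ[ℝ] Euc d} {c : Euc d}

theorem affineValue_vadd (h : IsQuadraticLift P T s u L c) {v : Euc d}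
    (hv : v ∈ AddSubgroup.closure (facetVectors P T)) (x : Euc d) :
    affineValue (u (v +ᵥ P)) x = ⟪L v, x - c⟫ - ⟪L v, v⟫ / 2 := by
  rw [h.map_vadd v hv, affineValue, inner_sub_right]
  ring

theorem mem_iff (h : IsQuadraticLift P T s u L c) {v : Euc d}
    (hv : v ∈ AddSubgroup.closure (facetVectors P T)) (x : Euc d) :
    x ∈ v +ᵥ P ↔ ∀ w ∈ AddSubgroup.closure (facetVectors P T),
      ⟪L w, x - c⟫ - ⟪L w, w⟫ / 2 ≤ ⟪L v, x - c⟫ - ⟪L v, v⟫ / 2 := by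
  rw [h.tiling.mem_iff_affineValue_le h.scaling h.sub_eq ((h.tiling.mem_iff_mem_closure v).2 hv),
    ← h.affineValue_vadd hv]
  constructor
  · intro H w hw
    rw [← h.affineValue_vadd hw]
    exact H _ ((h.tiling.mem_iff_mem_closure w).2 hw)
  · intro H C hC
    obtain ⟨w, rfl⟩ := h.tiling.translate C hC
    have hw := (h.tiling.mem_iff_mem_closure w).1 hC
    rw [h.affineValue_vadd hw]
    exact H w hw

theorem mem_self_iff (h : IsQuadraticLift P T s u L c) (x : Euc d) :
    x ∈ P ↔ ∀ w ∈ AddSubgroup.closure (facetVectors P T), ⟪L w, x - c⟫ ≤ ⟪L w, w⟫ / 2 := by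
  have := h.mem_iff (zero_mem _) x
  simpa using this

/-- The inequalities defining `P` come in pairs `w`, `-w`, exchanged by the reflection in `c`. -/
theorem isCentre (h : IsQuadraticLift P T s u L c) : IsCentre c P := by
  intro x hx
  rw [h.mem_self_iff] at hx ⊢
  intro w hw
  have := hx (-w) (neg_mem hw)
  have h1 : (2 : ℝ) • c - x - c = -(x - c) := by rw [two_smul]; abel
  rw [h1, inner_neg_right]
  simpa using this

theorem centre_mem (h : IsQuadraticLift P T s u L c) : c ∈ P := by
  obtain ⟨x, hx⟩ := h.tiling.polytope.2.mono interior_subset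
  have h1 := h.tiling.polytope.convex hx (h.isCentre x hx) (by norm_num : (0 : ℝ) ≤ 1 / 2)
    (by norm_num : (0 : ℝ) ≤ 1 / 2) (by norm_num)
  convert h1 using 1
  module

/-- On the lattice this is the inequality of `P` at the point `c`. A multiple `n • v` is within
bounded distance of the lattice, so `v` is a limit of rescaled lattice vectors. -/
theorem inner_nonneg (h : IsQuadraticLift P T s u L c) (v : Euc d) : 0 ≤ ⟪L v, v⟫ := by
  have h0 : ∀ w ∈ AddSubgroup.closure (facetVectors P T), 0 ≤ ⟪L w, w⟫ := by
    intro w hw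
    have := (h.mem_self_iff c).1 h.centre_mem w hw
    rw [sub_self, inner_zero_right] at this
    linarith
  have hex : ∀ n : ℕ, ∃ r ∈ P, (n : ℝ) • v - r ∈ AddSubgroup.closure (facetVectors P T) := by
    intro n
    obtain ⟨C, hC, hx⟩ := h.tiling.cover ((n : ℝ) • v)
    obtain ⟨w, rfl⟩ := h.tiling.translate C hC
    obtain ⟨r, hr, hw⟩ := hx
    refine ⟨r, hr, ?_⟩
    rw [← hw]
    simpa using (h.tiling.mem_iff_mem_closure w).1 hC
  choose r hr hmem using hex
  obtain ⟨R, hR⟩ := h.tiling.polytope.isCompact.isBounded.exists_norm_le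
  have hlim : Tendsto (fun n : ℕ => v - (n : ℝ)⁻¹ • r n) atTop (𝓝 v) := by
    have h1 : Tendsto (fun n : ℕ => (n : ℝ)⁻¹ • r n) atTop (𝓝 0) := by
      refine squeeze_zero_norm (a := fun n : ℕ => (n : ℝ)⁻¹ * R) (fun n => ?_) ?_
      · rw [norm_smul, norm_inv, Real.norm_natCast]
        gcongr
        exact hR _ (hr n)
      · simpa using (tendsto_inv_atTop_nhds_zero_nat (𝕜 := ℝ)).mul_const R
    simpa using tendsto_const_nhds.sub h1
  have hc : Continuous fun x => ⟪L x, x⟫ := L.continuous_of_finiteDimensional.inner continuous_id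
  refine ge_of_tendsto ((hc.tendsto v).comp hlim) ?_
  filter_upwards [eventually_gt_atTop 0] with n hn
  have hn' : (n : ℝ) ≠ 0 := by positivity
  have h2 : v - (n : ℝ)⁻¹ • r n = (n : ℝ)⁻¹ • ((n : ℝ) • v - r n) := by
    rw [smul_sub, smul_smul, inv_mul_cancel₀ hn', one_smul]
  simp only [Function.comp_apply]
  rw [h2, map_smul, real_inner_smul_left, real_inner_smul_right]
  have := h0 _ (hmem n)
  positivity

end IsQuadraticLift

theorem exists_affineMap_affineValue {d : ℕ} (w : Euc d × ℝ) :
    ∃ m : Euc d →ᵃ[ℝ] ℝ, ∀ x, m x = affineValue w x :=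
  ⟨(innerₛₗ ℝ w.1).toAffineMap + AffineMap.const ℝ _ w.2, fun _ => rfl⟩

/-- Composing the two reflections gives the translation by $2(p-q)$, which maps a compact set into
itself only when trivial. -/
theorem IsCentre.eq {d : ℕ} {p q : Euc d} {K : Set (Euc d)} (hK : IsCompact K)
    (hne : K.Nonempty) (hp : IsCentre p K) (hq : IsCentre q K) : p = q := by
  have h : (2 : ℝ) • p - (2 : ℝ) • q = 0 := by
    refine eq_zero_of_vadd_subset hK hne ?_
    rintro _ ⟨x, hx, rfl⟩
    have := hp _ (hq x hx)
    rwa [sub_sub_eq_add_sub, add_sub_right_comm] at this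
  rw [← smul_sub] at h
  exact sub_eq_zero.1 ((smul_eq_zero.1 h).resolve_left two_ne_zero)

theorem mem_image_sub {d : ℕ} (A : Euc d ≃ₗ[ℝ] Euc d) (c y : Euc d) (C : Set (Euc d)) :
    y ∈ (fun x => A (x - c)) '' C ↔ A.symm y + c ∈ C := by
  constructor
  · rintro ⟨x, hx, rfl⟩
    simpa using hx
  · intro hy
    exact ⟨_, hy, by simp⟩

theorem mem_imageSurface {d : ℕ} (A : Euc d ≃ₗ[ℝ] Euc d) (c : Euc d) (S : Set (Euc d × ℝ))
    (z : Euc d × ℝ) : z ∈ imageSurface A c S ↔ (A.symm z.1 + c, z.2) ∈ S := by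
  constructor
  · rintro ⟨x, hx, rfl⟩
    simpa using hx
  · intro hy
    exact ⟨_, hy, by simp⟩

namespace IsQuadraticLift
variable {d : ℕ} {P : Set (Euc d)} {T : Set (Set (Euc d))} {s : Set (Euc d) → ℝ}
  {u : Set (Euc d) → Euc d × ℝ} {L : Euc d →ₗ[ℝ] Euc d} {c : Euc d}

/-! ### The generatrix -/

theorem affineValue_eq (h : IsQuadraticLift P T s u L c) {C D : Set (Euc d)} (hC : C ∈ T)
    (hD : D ∈ T) {x : Euc d} (hx : x ∈ C) (hx' : x ∈ D) :
    affineValue (u C) x = affineValue (u D) x :=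
  le_antisymm (h.tiling.affineValue_le h.scaling h.sub_eq hC hD hx')
    (h.tiling.affineValue_le h.scaling h.sub_eq hD hC hx)

/-- Independence of the chain: the gradient increment is the jump of `u`, and a point of the common
facet pins the height. -/
theorem chainLift_eq (h : IsQuadraticLift P T s u L c) {C : Set (Euc d)} {g : Euc d} {a : ℝ}
    (hl : IsChainLift T s P C g a) : C ∈ T ∧ u C = (g, a) := by
  induction hl with
  | start => exact ⟨h.tiling.self_mem, h.map_self⟩
  | step C C' g n a a' _ hC' hadj hn himg ih =>
    obtain ⟨hC, hu⟩ := ih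
    refine ⟨hC', ?_⟩
    have hn' : n = facetNormal C C' :=
      (h.tiling.facetNormal_spec hC hadj).eq (h.tiling.polytope_of_mem hC).2 hadj.1
        ((h.tiling.isNormalFromTo_iff hC hC' hadj).1 hn)
    obtain ⟨x, hx⟩ := hadj.1.2.1
    have hx' := hx
    rw [← himg] at hx'
    obtain ⟨z, ⟨⟨-, hz1⟩, -, hz2⟩, rfl⟩ := hx'
    have hsub := h.sub_eq C hC C' hC' hadj
    have h2 : (u C').2 - (u C).2 = -⟪s (C ∩ C') • facetNormal C C', z.1⟫ :=
      (congrArg Prod.snd hsub).trans (h.tiling.jump_snd hC hadj hx)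
    have h1 : (u C').1 - (u C).1 = s (C ∩ C') • facetNormal C C' := congrArg Prod.fst hsub
    rw [hu, ← hn'] at h1 h2
    refine Prod.ext (sub_eq_iff_eq_add'.1 h1) ?_
    rw [hz1, inner_add_left] at hz2
    change (u C').2 = a'
    change (u C').2 - a = _ at h2
    linarith

/-- Every cell is reached through facets. Consecutive lifts meet over the whole common facet because
the affine functions agree where cells overlap. -/
theorem isChainLift (h : IsQuadraticLift P T s u L c) {C : Set (Euc d)} (hC : C ∈ T) :
    IsChainLift T s P C (u C).1 (u C).2 := by
  have hT := h.tiling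
  have hch := hT.reflTransGen_adjacent isOpen_univ convex_univ hT.self_mem hC
    (by simpa using hT.polytope.2.mono interior_subset)
    (by simpa using (hT.polytope_of_mem hC).2.mono interior_subset)
  clear hC
  induction hch with
  | refl =>
    rw [h.map_self]
    exact IsChainLift.start
  | @tail C C' _ hstep ih =>
    obtain ⟨hC, hC', hadj, -⟩ := hstep
    have hn := (hT.isNormalFromTo_iff hC hC' hadj).2 (hT.facetNormal_spec hC hadj)
    have h1 : (u C).1 + s (C ∩ C') • facetNormal C C' = (u C').1 :=
      (sub_eq_iff_eq_add'.1 (congrArg Prod.fst (h.sub_eq C hC C' hC' hadj))).symm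
    have := IsChainLift.step C C' _ _ _ (u C').2 ih hC' hadj hn (by
      rw [h1]
      ext x
      constructor
      · rintro ⟨z, ⟨⟨hz, -⟩, hz', -⟩, rfl⟩
        exact ⟨hz, hz'⟩
      · intro hx
        exact ⟨(x, affineValue (u C) x), ⟨⟨hx.1, rfl⟩, hx.2,
          h.affineValue_eq hC hC' hx.1 hx.2⟩, rfl⟩)
    rwa [h1] at this

theorem mem_generatrixSurface (h : IsQuadraticLift P T s u L c) (z : Euc d × ℝ) :
    z ∈ generatrixSurface T s P ↔ ∃ C ∈ T, z.1 ∈ C ∧ z.2 = affineValue (u C) z.1 := by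
  constructor
  · rintro ⟨C, g, a, hl, hz⟩
    obtain ⟨hC, hu⟩ := h.chainLift_eq hl
    exact ⟨C, hC, hz.1, by rw [hu]; exact hz.2⟩
  · rintro ⟨C, hC, hz, hz2⟩
    exact ⟨C, _, _, h.isChainLift hC, hz, hz2⟩

theorem exists_continuous (h : IsQuadraticLift P T s u L c) :
    ∃ f : Euc d → ℝ, Continuous f ∧ ∀ C ∈ T, ∀ x ∈ C, f x = affineValue (u C) x := by
  choose K hK hmem using h.tiling.cover
  have heq : ∀ C ∈ T, ∀ x ∈ C, affineValue (u (K x)) x = affineValue (u C) x :=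
    fun C hC x hx => h.affineValue_eq (hK x) hC (hmem x) hx
  refine ⟨fun x => affineValue (u (K x)) x, ?_, heq⟩
  have hlf : LocallyFinite fun C : T => (C : Set (Euc d)) := by
    intro x
    refine ⟨Metric.ball x 1, Metric.ball_mem_nhds x one_pos, ?_⟩
    refine ((h.tiling.finite_meeting (Metric.isBounded_ball (x := x) (r := 1))).preimage
      Subtype.val_injective.injOn).subset ?_
    intro C hC
    exact ⟨C.2, hC⟩
  refine hlf.continuous ?_ (fun C => (h.tiling.polytope_of_mem C.2).isClosed) fun C => ?_
  · exact eq_univ_of_forall fun x => mem_iUnion.2 ⟨⟨K x, hK x⟩, hmem x⟩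
  · exact (continuous_affineValue (u C)).continuousOn.congr fun x hx => heq C C.2 x hx

theorem isGeneratrix (h : IsQuadraticLift P T s u L c) (A : Euc d ≃ₗ[ℝ] Euc d) (c' : Euc d) :
    IsGeneratrix (imageTiling A c' T) (imageSurface A c' (generatrixSurface T s P)) := by
  obtain ⟨f, hf, hfC⟩ := h.exists_continuous
  have hA : Continuous A.symm := A.symm.toLinearMap.continuous_of_finiteDimensional
  refine ⟨fun y => f (A.symm y + c'), by fun_prop, ?_, ?_, ?_⟩
  · ext z
    rw [mem_imageSurface, h.mem_generatrixSurface]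
    constructor
    · rintro ⟨C, hC, hz, hz2⟩
      exact hz2.trans (hfC C hC _ hz).symm
    · intro hz
      obtain ⟨C, hC, hx⟩ := h.tiling.cover (A.symm z.1 + c')
      exact ⟨C, hC, hx, Eq.trans hz (hfC C hC _ hx)⟩
  · rintro _ ⟨C, hC, rfl⟩
    obtain ⟨m, hm⟩ := exists_affineMap_affineValue (u C)
    refine ⟨m.comp (A.symm.toLinearMap.toAffineMap + AffineMap.const ℝ _ c'), fun y hy => ?_⟩
    exact (hfC C hC _ ((mem_image_sub A c' y C).1 hy)).trans (hm _).symm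
  · rintro _ ⟨C, hC, rfl⟩ _ ⟨C', hC', rfl⟩ hne ⟨l, hl⟩
    -- A cell has interior, so an affine function on it determines the function of `u D` everywhere;
    -- distinct cells carry distinct functions.
    have key : ∀ D ∈ T, EqOn (fun y => f (A.symm y + c')) l ((fun x => A (x - c')) '' D) →
        affineValue (u D) = fun x => l (A (x - c')) := by
      intro D hD hlD
      obtain ⟨m, hm⟩ := exists_affineMap_affineValue (u D)
      have h1 : m = l.comp (A.toLinearMap.toAffineMap.comp
          (AffineMap.id ℝ _ - AffineMap.const ℝ _ c')) := by
        refine AffineMap.ext_on (affineSpan_eq_top_of_nonempty_interior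
          (s := D) ?_) fun x hx => ?_
        · rw [(h.tiling.polytope_of_mem hD).convex.convexHull_eq]
          exact (h.tiling.polytope_of_mem hD).2
        · rw [hm, ← hfC D hD x hx]
          have := hlD ⟨x, hx, rfl⟩
          simpa using this
      funext x
      rw [← hm, h1]
      rfl
    refine hne (congrArg _ (h.tiling.eq_of_affineValue_eq h.scaling h.sub_eq hC hC' ?_))
    rw [key C hC (hl.mono subset_union_left), key C' hC' (hl.mono subset_union_right)]

/-! ### Voronoi cells -/

/-- Expanding the square identifies the bracket with the affine function of `v +ᵥ P`: the larger
this function, the nearer the lattice point `A v`. -/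
theorem norm_sq_sub (h : IsQuadraticLift P T s u L c) {A : Euc d ≃ₗ[ℝ] Euc d}
    (hA : ∀ x, ‖A x‖ ^ 2 = ⟪L x, x⟫ / 2) (v y : Euc d) :
    ‖y - A v‖ ^ 2 = ‖y‖ ^ 2 - (⟪L v, A.symm y⟫ - ⟪L v, v⟫ / 2) := by
  obtain ⟨x, rfl⟩ := A.surjective y
  rw [← map_sub, hA, hA, A.symm_apply_apply, map_sub, inner_sub_left, inner_sub_right,
    inner_sub_right, h.symm x v]
  ring

theorem isCentre_image_iff (h : IsQuadraticLift P T s u L c) (A : Euc d ≃ₗ[ℝ] Euc d)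
    (v p : Euc d) :
    IsCentre p ((fun x => A (x - c)) '' (v +ᵥ P)) ↔ p = A v := by
  have h1 : IsCentre (A v) ((fun x => A (x - c)) '' (v +ᵥ P)) := by
    rintro _ ⟨_, ⟨y, hy, rfl⟩, rfl⟩
    refine ⟨_, ⟨_, h.isCentre y hy, rfl⟩, ?_⟩
    simp only [vadd_eq_add, ← map_smul, ← map_sub]
    congr 1
    module
  refine ⟨fun hp => ?_, fun hp => hp ▸ h1⟩
  have hA : Continuous A := A.toLinearMap.continuous_of_finiteDimensional
  have hP := h.tiling.polytope.vadd v
  refine IsCentre.eq (hP.isCompact.image (by fun_prop)) ?_ hp h1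
  exact (hP.2.mono interior_subset).image _

theorem mem_cellCentres_iff (h : IsQuadraticLift P T s u L c) (A : Euc d ≃ₗ[ℝ] Euc d)
    (p : Euc d) : p ∈ cellCentres (imageTiling A c T) ↔
      ∃ v ∈ AddSubgroup.closure (facetVectors P T), A v = p := by
  constructor
  · rintro ⟨_, ⟨C, hC, rfl⟩, hp⟩
    obtain ⟨v, rfl⟩ := h.tiling.translate C hC
    exact ⟨v, (h.tiling.mem_iff_mem_closure v).1 hC, ((h.isCentre_image_iff A v p).1 hp).symm⟩
  · rintro ⟨v, hv, rfl⟩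
    exact ⟨_, ⟨_, (h.tiling.mem_iff_mem_closure v).2 hv, rfl⟩, (h.isCentre_image_iff A v _).2 rfl⟩

/-- Membership in a cell means maximality of its affine function, which by `norm_sq_sub` means
minimality of the distance to its centre. -/
theorem isVoronoiTiling (h : IsQuadraticLift P T s u L c) {A : Euc d ≃ₗ[ℝ] Euc d}
    (hA : ∀ x, ‖A x‖ ^ 2 = ⟪L x, x⟫ / 2) : IsVoronoiTiling (imageTiling A c T) := by
  constructor
  · obtain ⟨b, hb⟩ := h.tiling.exists_basis
    refine ⟨b.map A, ?_⟩
    ext p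
    have h1 : range (b.map A) = A.toLinearMap.restrictScalars ℤ '' range b := by
      rw [← range_comp]
      rfl
    rw [h.mem_cellCentres_iff, h1, Submodule.span_image]
    simp only [← hb]
    rfl
  · rintro _ ⟨C, hC, rfl⟩
    obtain ⟨v, rfl⟩ := h.tiling.translate C hC
    have hv := (h.tiling.mem_iff_mem_closure v).1 hC
    refine ⟨⟨_, (h.isCentre_image_iff A v _).2 rfl⟩, fun p hp => ?_⟩
    obtain rfl := (h.isCentre_image_iff A v p).1 hp
    ext y
    rw [mem_image_sub, h.mem_iff hv, add_sub_cancel_right]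
    have h2 : ∀ w, (‖y - A v‖ ≤ ‖y - A w‖ ↔
        ⟪L w, A.symm y⟫ - ⟪L w, w⟫ / 2 ≤ ⟪L v, A.symm y⟫ - ⟪L v, v⟫ / 2) := by
      intro w
      rw [← pow_le_pow_iff_left₀ (norm_nonneg _) (norm_nonneg _) two_ne_zero,
        h.norm_sq_sub hA, h.norm_sq_sub hA, sub_le_sub_iff_left]
    constructor
    · intro H q hq
      obtain ⟨w, hw, rfl⟩ := (h.mem_cellCentres_iff A q).1 hq
      exact (h2 w).2 (H w hw)
    · intro H w hw
      exact (h2 w).1 (H _ ((h.mem_cellCentres_iff A _).2 ⟨w, hw, rfl⟩))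

/-- The tangent hyperplane at the point over `A v` lies below the paraboloid by exactly
$\|z-Av\|^2$, so this form of the height contains all tangency statements. -/
theorem mem_imageSurface_iff (h : IsQuadraticLift P T s u L c) {A : Euc d ≃ₗ[ℝ] Euc d}
    (hA : ∀ x, ‖A x‖ ^ 2 = ⟪L x, x⟫ / 2) {v : Euc d}
    (hv : v ∈ AddSubgroup.closure (facetVectors P T)) {z : Euc d × ℝ}
    (hz : A.symm z.1 + c ∈ v +ᵥ P) :
    z ∈ imageSurface A c (generatrixSurface T s P) ↔ z.2 = ‖z.1‖ ^ 2 - ‖z.1 - A v‖ ^ 2 := by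
  have hvT := (h.tiling.mem_iff_mem_closure v).2 hv
  have h1 : ‖z.1‖ ^ 2 - ‖z.1 - A v‖ ^ 2 = affineValue (u (v +ᵥ P)) (A.symm z.1 + c) := by
    rw [h.norm_sq_sub hA, h.affineValue_vadd hv, add_sub_cancel_right, sub_sub_cancel]
  rw [mem_imageSurface, h.mem_generatrixSurface, h1]
  constructor
  · rintro ⟨C, hC, hx, hz2⟩
    exact hz2.trans (h.affineValue_eq hC hvT hx hz)
  · exact fun hz2 => ⟨_, hvT, hz, hz2⟩

theorem circumscribes (h : IsQuadraticLift P T s u L c) {A : Euc d ≃ₗ[ℝ] Euc d}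
    (hA : ∀ x, ‖A x‖ ^ 2 = ⟪L x, x⟫ / 2) :
    CircumscribesStdParaboloid (imageTiling A c T)
      (imageSurface A c (generatrixSurface T s P)) := by
  have hcell : ∀ y : Euc d, ∃ v ∈ AddSubgroup.closure (facetVectors P T),
      A.symm y + c ∈ v +ᵥ P := by
    intro y
    obtain ⟨C, hC, hx⟩ := h.tiling.cover (A.symm y + c)
    obtain ⟨v, rfl⟩ := h.tiling.translate C hC
    exact ⟨v, (h.tiling.mem_iff_mem_closure v).1 hC, hx⟩
  simp only [CircumscribesStdParaboloid, ← EuclideanSpace.real_norm_sq_eq]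
  refine ⟨fun z hz => ?_, fun z hz => ⟨fun hz2 => ?_, fun hz2 => ?_⟩, ?_⟩
  · obtain ⟨v, hv, hx⟩ := hcell z.1
    rw [(h.mem_imageSurface_iff hA hv hx).1 hz]
    linarith [sq_nonneg ‖z.1 - A v‖]
  · obtain ⟨v, hv, hx⟩ := hcell z.1
    rw [(h.mem_imageSurface_iff hA hv hx).1 hz, sub_eq_self, pow_eq_zero_iff two_ne_zero,
      norm_eq_zero, sub_eq_zero] at hz2
    exact (h.mem_cellCentres_iff A _).2 ⟨v, hv, hz2.symm⟩
  · obtain ⟨v, hv, hvz⟩ := (h.mem_cellCentres_iff A _).1 hz2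
    have hx : A.symm z.1 + c ∈ v +ᵥ P := by
      rw [← hvz, A.symm_apply_apply]
      exact ⟨c, h.centre_mem, rfl⟩
    rw [(h.mem_imageSurface_iff hA hv hx).1 hz, hvz]
    simp
  · rintro _ ⟨C, hC, rfl⟩ p hp y hy
    obtain ⟨v, rfl⟩ := h.tiling.translate C hC
    have hv := (h.tiling.mem_iff_mem_closure v).1 hC
    obtain rfl := (h.isCentre_image_iff A v p).1 hp
    rw [h.mem_imageSurface_iff hA hv ((mem_image_sub A c y _).1 hy)]
    simp only [EuclideanSpace.real_norm_sq_eq, ← Finset.sum_add_distrib, ← Finset.sum_sub_distrib]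
    refine Finset.sum_congr rfl fun i _ => ?_
    rw [PiLp.sub_apply]
    ring

/-! ### The matrix of the form -/

/-- The facet vectors span the space, so the prescribed values leave only the matrix of `L`; its
symmetry and injectivity give the remaining conditions. -/
theorem isFormMatrix_iff (h : IsQuadraticLift P T s u L c) (Q : Matrix (Fin d) (Fin d) ℝ) :
    IsFormMatrix P T s Q ↔ Q = Matrix.toEuclideanLin.symm L := by
  have hT := h.tiling
  have hLn : ∀ p ∈ facetVectors P T, ∀ n, IsNormalFromTo P (p +ᵥ P) n →
      L p = s (P ∩ (p +ᵥ P)) • n := by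
    intro p hp n hn
    rw [h.map_facetVector p hp, (hT.facetNormal_spec hT.self_mem hp.2).eq hT.polytope.2 hp.2.1
      ((hT.isNormalFromTo_iff hT.self_mem hp.1 hp.2).1 hn)]
    rfl
  rw [LinearEquiv.eq_symm_apply]
  constructor
  · rintro ⟨-, -, hQ⟩
    refine hT.ext_facetVectors fun p hp => ?_
    have hn := (hT.isNormalFromTo_iff hT.self_mem hp.1 hp.2).2
      (hT.facetNormal_spec hT.self_mem hp.2)
    rw [hLn p hp _ hn, ← hQ p _ hp.1 hp.2 hn]
    rfl
  · rintro rfl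
    refine ⟨?_, ?_, fun p n hp hadj hn => hLn p ⟨hp, hadj⟩ n hn⟩
    · have : (Matrix.toEuclideanLin Q).IsSymmetric := fun x y => by
        rw [h.symm, real_inner_comm]
      have := Matrix.isSymmetric_toEuclideanLin_iff.1 this
      rwa [Matrix.IsHermitian, Matrix.conjTranspose_eq_transpose_of_trivial] at this
    · rw [← Matrix.isUnit_iff_isUnit_det, ← Matrix.mulVec_injective_iff_isUnit]
      intro x y hxy
      have : Matrix.toEuclideanLin Q (WithLp.toLp 2 x) = Matrix.toEuclideanLin Q (WithLp.toLp 2 y) :=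
        congrArg (WithLp.toLp 2) hxy
      exact congrArg WithLp.ofLp (h.injective this)

/-- A positive semidefinite nondegenerate form is definite. -/
theorem posDef (h : IsQuadraticLift P T s u L c) :
    (Matrix.toEuclideanLin.symm L : Matrix (Fin d) (Fin d) ℝ).PosDef := by
  obtain ⟨Q, rfl⟩ := Matrix.toEuclideanLin.surjective L
  rw [LinearEquiv.symm_apply_apply]
  have hpos : Q.PosSemidef := Matrix.isPositive_toEuclideanLin_iff.1
    ⟨fun x y => by rw [h.symm, real_inner_comm], fun x => by simpa using h.inner_nonneg x⟩
  rw [hpos.posDef_iff_isUnit, Matrix.isUnit_iff_isUnit_det]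
  exact ((h.isFormMatrix_iff Q).2 (LinearEquiv.symm_apply_apply _ _).symm).2.1

end IsQuadraticLift

theorem halfForm_eq {d : ℕ} (Q : Matrix (Fin d) (Fin d) ℝ) (x : Euc d) :
    halfForm Q x = ⟪Matrix.toEuclideanLin Q x, x⟫ / 2 := by
  rw [halfForm, real_inner_comm, one_div_mul_eq_div]
  rfl

-- Write $Q=B^{T}B$ and rescale `B`; it is injective because `Q` is definite.
open scoped MatrixOrder in
theorem Matrix.PosDef.exists_sum_sq_eq_halfForm {d : ℕ} {Q : Matrix (Fin d) (Fin d) ℝ}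
    (hQ : Q.PosDef) : ∃ A : Euc d ≃ₗ[ℝ] Euc d, ∀ x, ∑ i, (A x i) ^ 2 = halfForm Q x := by
  obtain ⟨B, hB⟩ := CStarAlgebra.nonneg_iff_eq_star_mul_self.mp hQ.posSemidef.nonneg
  have hl : ∀ (M : Matrix (Fin d) (Fin d) ℝ) (x : Euc d),
      (Matrix.toEuclideanLin M x).ofLp = M.mulVec x.ofLp := fun _ _ => rfl
  have hform : ∀ x : Euc d, ‖Matrix.toEuclideanLin B x‖ ^ 2 = ⟪Matrix.toEuclideanLin Q x, x⟫ := by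
    intro x
    rw [← real_inner_self_eq_norm_sq, EuclideanSpace.inner_eq_star_dotProduct,
      EuclideanSpace.inner_eq_star_dotProduct]
    simp only [hl, star_trivial, hB]
    rw [← Matrix.mulVec_mulVec, Matrix.dotProduct_mulVec, Matrix.star_eq_conjTranspose,
      Matrix.conjTranspose_eq_transpose_of_trivial, Matrix.dotProduct_mulVec,
      Matrix.vecMul_transpose, ← Matrix.dotProduct_mulVec]
  have hinj : Function.Injective (Matrix.toEuclideanLin B) := by
    rw [injective_iff_map_eq_zero]
    intro x hx
    by_contra hne
    have h1 := hform x
    rw [hx, norm_zero] at h1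
    have h2 := hQ.dotProduct_mulVec_pos (x := x.ofLp) (by simpa using hne)
    rw [EuclideanSpace.inner_eq_star_dotProduct, hl] at h1
    simp only [star_trivial] at h1 h2
    linarith
  -- The factor $\sqrt{1/2}$ accounts for the $\tfrac12$ in the definition of the form.
  refine ⟨(LinearEquiv.ofInjectiveEndo _ hinj).trans
    (LinearEquiv.smulOfNeZero ℝ (Euc d) (Real.sqrt (1 / 2)) (by positivity)), fun x => ?_⟩
  rw [halfForm_eq, ← hform, ← EuclideanSpace.real_norm_sq_eq]
  change ‖Real.sqrt (1 / 2) • Matrix.toEuclideanLin B x‖ ^ 2 = _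
  rw [norm_smul, mul_pow, Real.norm_eq_abs, sq_abs, Real.sq_sqrt (by norm_num)]
  ring

end

theorem mainTheorem9 (d : ℕ) (P : Set (Euc d)) (T : Set (Set (Euc d)))
    (hT : IsParallelohedralTiling P T) (s : Set (Euc d) → ℝ)
    (hs : IsCanonicalScaling T s) (hinv : IsTranslationInvariant T s) :
    ∃ c : Euc d, IsCentre c P ∧
      ∃ Q : Matrix (Fin d) (Fin d) ℝ,
        (∀ Q' : Matrix (Fin d) (Fin d) ℝ, IsFormMatrix P T s Q' ↔ Q' = Q) ∧
        Q.PosDef ∧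
        (∃ A : Euc d ≃ₗ[ℝ] Euc d, ∀ x, ∑ i, (A x i) ^ 2 = halfForm Q x) ∧
        ∀ A : Euc d ≃ₗ[ℝ] Euc d, (∀ x, ∑ i, (A x i) ^ 2 = halfForm Q x) →
          IsVoronoiTiling (imageTiling A c T) ∧
          IsGeneratrix (imageTiling A c T) (imageSurface A c (generatrixSurface T s P)) ∧
          CircumscribesStdParaboloid (imageTiling A c T)
            (imageSurface A c (generatrixSurface T s P)) := by
  obtain ⟨u, L, c, h⟩ := hT.exists_isQuadraticLift hs hinv
  refine ⟨c, h.isCentre, Matrix.toEuclideanLin.symm L, h.isFormMatrix_iff, h.posDef,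
    h.posDef.exists_sum_sq_eq_halfForm, fun A hA => ?_⟩
  have hA' : ∀ x, ‖A x‖ ^ 2 = ⟪L x, x⟫ / 2 := by
    intro x
    rw [EuclideanSpace.real_norm_sq_eq, hA, halfForm_eq, LinearEquiv.apply_symm_apply]
  exact ⟨h.isVoronoiTiling hA', h.isGeneratrix A c, h.circumscribes hA'⟩
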